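/- Let $K$ be an imaginary quadratic field with ring of integers $\mathcal{O}_K$ and discriminant $\Delta_K$, let $\mathcal{I}_K$ be the set of nonzero ideals of $\mathcal{O}_K$, $\mathfrak{N}$ the ideal norm, and $\mu_K$ the Möbius function on $\mathcal{I}_K$; put $(\vartheta*\mu_K)(\mathfrak{a})=\sum_{\mathfrak{b}\mathfrak{c}=\mathfrak{a}}\vartheta(\mathfrak{b})\mu_K(\mathfrak{c})$ and $\phi_K^*(\mathfrak{q})=\#(\mathcal{O}_K/\mathfrak{q})^\times/\mathfrak{N}\mathfrak{q}$. Congruences $x\equiv_{\mathfrak q}y$ for $x,y\in K$ mean $v_{\mathfrak p}(x-y)\ge v_{\mathfrak p}(\mathfrak{q})$ for all primes $\mathfrak{p}\mid\mathfrak{q}$. Let $a\le 0$ and $C\ge 0$ be real. There is a constant $M>0$, depending only on $K$, $a$ and $C$, with the following property. Let $\mathcal{O}$ be a nonzero fractional ideal of $K$, $\mathfrak{q}\in\mathcal{I}_K$, $n\ge 1$ an integer, and $A\in K$ such that $v_{\mathfrak{p}}(A\mathcal{O})=0$ for all primes $\mathfrak{p}\mid\mathfrak{q}$. Let $\vartheta:\mathcal{I}_K\to\mathbb{R}$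 and $c_\vartheta>0$ satisfy $$\sum_{\mathfrak{a}\in\mathcal{I}_K,\ \mathfrak{N}\mathfrak{a}\le t}|(\vartheta*\mu_K)(\mathfrak{a})|\,\mathfrak{N}\mathfrak{a}\le c_\vartheta\, t\,(\log(t+2))^C\qquad\text{for all } t>0 .$$ Let $1\le t_1\le t_2$ and let $g:[t_1,t_2]\to\mathbb{R}$ be such that $[t_1,t_2]$ has a partition into at most $R$ intervals on whose interior $g$ is continuously differentiable and monotonic, and let $c_g>0$ be such that $|g(t)|\le c_g t^a$ on $[t_1,t_2]$. Then the series $$\mathcal{A}(\vartheta,\mathfrak{q}):=\sum_{\mathfrak{a}\in\mathcal{I}_K,\ \mathfrak{a}+\mathfrak{q}=\mathcal{O}_K}\frac{(\vartheta*\mu_K)(\mathfrak{a})}{\mathfrak{N}\mathfrak{a}}$$ converges absolutely, $g$ is integrable on $[t_1,t_2]$, and the sum $$S(t_1,t_2):=\sum_{\substack{z\in\mathcal{O}\setminus\{0\}\\ t_1<\mathfrak{N}(z\mathcal{O}^{-1})\le t_2}}\vartheta(z\mathcal{O}^{-1})\sum_{\substack{\rho \bmod \mathfrak{q}\\ \rho\mathcal{O}_K+\mathfrak{q}=\mathcal{O}_K\\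 \rho^n\equiv_{\mathfrak{q}}Az}}g(\mathfrak{N}(z\mathcal{O}^{-1}))$$ is finite and satisfies $$\left|S(t_1,t_2)-\frac{2\pi}{\sqrt{|\Delta_K|}}\,\phi_K^*(\mathfrak{q})\,\mathcal{A}(\vartheta,\mathfrak{q})\int_{t_1}^{t_2}g(t)\,dt\right|\le M\,c_\vartheta\, c_g\, R\left(\sqrt{\mathfrak{N}\mathfrak{q}}\;E_1+\mathfrak{N}\mathfrak{q}\;E_2\right),$$ where $E_1=\sup_{t_1\le t\le t_2}t^{a+1/2}$ if $a\ne-1/2$ and $E_1=\log(t_2+2)$ if $a=-1/2$, and $E_2=t_1^a\log(t_1+2)^{C+1}$ if $a<0$ and $E_2=\log(t_2+2)^{C+1}$ if $a=0$. The same holds if the range $t_1<\mathfrak{N}(z\mathcal{O}^{-1})\le t_2$ in the definition of $S(t_1,t_2)$ is replaced by $t_1\le\mathfrak{N}(z\mathcal{O}^{-1})\le t_2$. -/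

import Mathlib

open scoped NumberField nonZeroDivisors

noncomputable section

namespace SecondSummation

open NumberField IsDedekindDomain

section Arithmetic

variable {K : Type*} [Field K] [NumberField K]

/-- The Möbius function `μ_K` on nonzero ideals of `𝓞 K`. -/
def moebius (𝔞 : Ideal (𝓞 K)) : ℝ :=
  open Classical in
  if Squarefree 𝔞 then
    (-1 : ℝ) ^ Multiset.card (UniqueFactorizationMonoid.normalizedFactors 𝔞)
  else 0

/-- The Dirichlet convolution `(ϑ * μ_K)(𝔞) = ∑_{𝔟𝔠 = 𝔞} ϑ(𝔟) μ_K(𝔠)`, used only for `𝔞 ≠ 0`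
(then the sum is finite, and only values of `ϑ` at nonzero ideals occur in it). -/
def convMoebius (ϑ : Ideal (𝓞 K) → ℝ) (𝔞 : Ideal (𝓞 K)) : ℝ :=
  ∑ᶠ p ∈ {p : Ideal (𝓞 K) × Ideal (𝓞 K) | p.1 * p.2 = 𝔞}, ϑ p.1 * moebius p.2

/-- Euler's function `φ_K(𝔮) = #(𝓞 K / 𝔮)ˣ`. -/
def eulerPhi (𝔮 : Ideal (𝓞 K)) : ℕ := Nat.card ((𝓞 K) ⧸ 𝔮)ˣ

/-- `φ_K^*(𝔮) = φ_K(𝔮) / N𝔮`. -/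
def eulerPhiStar (𝔮 : Ideal (𝓞 K)) : ℝ := (eulerPhi 𝔮 : ℝ) / (Ideal.absNorm 𝔮 : ℝ)

/-- `∑_{𝔞 ≠ 0, N𝔞 ≤ t} |(ϑ * μ_K)(𝔞)| N𝔞`. -/
def convMoebiusSum (ϑ : Ideal (𝓞 K) → ℝ) (t : ℝ) : ℝ :=
  ∑ᶠ 𝔞 ∈ {𝔞 : Ideal (𝓞 K) | 𝔞 ≠ ⊥ ∧ (Ideal.absNorm 𝔞 : ℝ) ≤ t},
    |convMoebius ϑ 𝔞| * (Ideal.absNorm 𝔞 : ℝ)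

/-- The general term `(ϑ * μ_K)(𝔞) / N𝔞`, over nonzero ideals `𝔞` with `𝔞 + 𝔮 = 𝓞 K`. -/
def averageTerm (ϑ : Ideal (𝓞 K) → ℝ) (𝔮 : Ideal (𝓞 K))
    (𝔞 : {𝔞 : Ideal (𝓞 K) // 𝔞 ≠ ⊥ ∧ 𝔞 ⊔ 𝔮 = ⊤}) : ℝ :=
  convMoebius ϑ 𝔞.1 / (Ideal.absNorm 𝔞.1 : ℝ)

/-- `𝒜(ϑ, 𝔮) = ∑_{𝔞 + 𝔮 = 𝓞 K} (ϑ * μ_K)(𝔞) / N𝔞`. -/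
def average (ϑ : Ideal (𝓞 K) → ℝ) (𝔮 : Ideal (𝓞 K)) : ℝ :=
  ∑' 𝔞, averageTerm ϑ 𝔮 𝔞

/-- `x ≡ y mod 𝔮` for `x, y ∈ K`: `v_𝔭(x - y) ≥ v_𝔭(𝔮)` for all primes `𝔭 ∣ 𝔮`,
where `v_𝔭(0) = ∞`. -/
def CongrMod (𝔮 : Ideal (𝓞 K)) (x y : K) : Prop :=
  ∀ 𝔭 : HeightOneSpectrum (𝓞 K), 𝔭.asIdeal ∣ 𝔮 →
    x - y = 0 ∨
      FractionalIdeal.count K 𝔭 (𝔮 : FractionalIdeal (𝓞 K)⁰ K) ≤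
        FractionalIdeal.count K 𝔭 (FractionalIdeal.spanSingleton (𝓞 K)⁰ (x - y))

/-- The invertible residue classes `ρ` modulo `𝔮` with `ρ ^ n ≡ x mod 𝔮`. -/
def rootClasses (𝔮 : Ideal (𝓞 K)) (n : ℕ) (x : K) : Set ((𝓞 K) ⧸ 𝔮) :=
  {r | ∃ ρ : 𝓞 K, Ideal.Quotient.mk 𝔮 ρ = r ∧ Ideal.span {ρ} ⊔ 𝔮 = ⊤ ∧
    CongrMod 𝔮 ((ρ : K) ^ n) x}

/-- The ideal `z J⁻¹` of `𝓞 K`, for `z ∈ J` and `J` a nonzero fractional ideal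
(see `coe_idealOf`). -/
def idealOf (J : FractionalIdeal (𝓞 K)⁰ K) (z : K) : Ideal (𝓞 K) :=
  Submodule.comap (Algebra.linearMap (𝓞 K) K)
    ((FractionalIdeal.spanSingleton (𝓞 K)⁰ z * J⁻¹ : FractionalIdeal (𝓞 K)⁰ K) :
      Submodule (𝓞 K) K)

theorem coe_idealOf {J : FractionalIdeal (𝓞 K)⁰ K} (hJ : J ≠ 0) {z : K} (hz : z ∈ J) :
    (idealOf J z : FractionalIdeal (𝓞 K)⁰ K) =
      FractionalIdeal.spanSingleton (𝓞 K)⁰ z * J⁻¹ := by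
  have hle : FractionalIdeal.spanSingleton (𝓞 K)⁰ z * J⁻¹ ≤ 1 := by
    calc FractionalIdeal.spanSingleton (𝓞 K)⁰ z * J⁻¹ ≤ J * J⁻¹ := by
          gcongr
          exact (FractionalIdeal.spanSingleton_le_iff_mem).2 hz
      _ = 1 := mul_inv_cancel₀ hJ
  obtain ⟨I, hI⟩ := FractionalIdeal.le_one_iff_exists_coeIdeal.1 hle
  have h : idealOf J z = I := by
    ext x
    unfold idealOf
    rw [← hI]
    simp
  rw [h, hI]

/-- The nonzero elements `z` of `J` with `N(z J⁻¹) ∈ T`. -/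
def elementsWithNorm (J : FractionalIdeal (𝓞 K)⁰ K) (T : Set ℝ) : Set K :=
  {z | z ∈ J ∧ z ≠ 0 ∧ (Ideal.absNorm (idealOf J z) : ℝ) ∈ T}

/-- `∑_{z ∈ J, z ≠ 0, N(z J⁻¹) ∈ T} ϑ(z J⁻¹) ∑_ρ g(N(z J⁻¹))`, where `ρ` runs over the invertible
residue classes modulo `𝔮` with `ρ ^ n ≡ A z mod 𝔮`. -/
def secondSum (J : FractionalIdeal (𝓞 K)⁰ K) (𝔮 : Ideal (𝓞 K)) (n : ℕ) (A : K)
    (ϑ : Ideal (𝓞 K) → ℝ) (g : ℝ → ℝ) (T : Set ℝ) : ℝ :=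
  ∑ᶠ z ∈ elementsWithNorm J T,
    ϑ (idealOf J z) *
      ∑ᶠ _r ∈ rootClasses 𝔮 n (A * z), g (Ideal.absNorm (idealOf J z) : ℝ)

end Arithmetic

/-- There is a partition of `[t₁, t₂]` into at most `R` intervals (of any kind, possibly single
points) on whose interior `g` is continuously differentiable and monotonic. -/
def PiecewiseMonotone (g : ℝ → ℝ) (t₁ t₂ : ℝ) (R : ℕ) : Prop :=
  ∃ P : Finset (Set ℝ), P.card ≤ R ∧ (P : Set (Set ℝ)).PairwiseDisjoint id ∧
    ⋃₀ (P : Set (Set ℝ)) = Set.Icc t₁ t₂ ∧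
    ∀ I ∈ P, I.Nonempty ∧ I.OrdConnected ∧ ContDiffOn ℝ 1 g (interior I) ∧
      (MonotoneOn g (interior I) ∨ AntitoneOn g (interior I))

/-- The size of the first error term. -/
def errorOne (a t₁ t₂ : ℝ) : ℝ :=
  if a = -1 / 2 then Real.log (t₂ + 2)
  else sSup ((fun t : ℝ => t ^ (a + 1 / 2)) '' Set.Icc t₁ t₂)

/-- The size of the second error term. -/
def errorTwo (a C t₁ t₂ : ℝ) : ℝ :=
  if a = 0 then Real.log (t₂ + 2) ^ (C + 1)
  else t₁ ^ a * Real.log (t₁ + 2) ^ (C + 1)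

end SecondSummation

end

/-!
The arithmetic weight `ϑ` is opened by Möbius inversion, `ϑ(𝔞) = ∑_{𝔟 ∣ 𝔞} (ϑ * μ_K)(𝔟)`
(`sum_convMoebius_idealDivisors`). If `z` counts with some invertible class `ρ` modulo `𝔮`, then
`z J⁻¹` is coprime to `𝔮` (`sup_eq_top_of_mem_rootClasses`), so only `𝔟` coprime to `𝔮` contribute.
For such `𝔟` and for fixed `ρ`, the solutions `z ∈ 𝔟 J` of `ρ ^ n ≡ A z` modulo `𝔮` form one coset
of the fractional ideal `𝔮 𝔟 J` (`exists_coset_eq`). In particular the exponent `n` plays no role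
beyond this point: each of the `φ_K(𝔮)` classes contributes alike.

For an imaginary quadratic field a fractional ideal `I` is a lattice in `ℂ` of covolume
`√|Δ_K| N(I) / 2`, and the norm of an element is its squared absolute value. A coset of `I` thus
contains `(2π / √|Δ_K|) T / N(I) + O(√(T / N(I)) + 1)` elements of norm at most `T`. The constant is
uniform in `I` and in the coset, since scaling by `γ ∈ Kˣ` changes `T` and `N(I)` by the same factor
and there are finitely many ideal classes (`exists_forall_card_coset_sub_le`).

Summing over `ρ` and over `𝔟` with `N𝔟 ≤ m`, where partial summation turns the growth condition on
`ϑ * μ_K` into bounds for `∑ |(ϑ * μ_K)(𝔟)| / (N𝔟) ^ s` with `s = 0, 1/2` and for the tails with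
`s = 1`, gives the asymptotic formula without weight (`exists_sum_normCoeff_sub_le`): up to norm `m`
the sum is `κ m + O(c_ϑ (√(N𝔮 m) + N𝔮 log(m + 2) ^ (C + 1)))` with
`κ = (2π / √|Δ_K|) φ_K^*(𝔮) 𝒜(ϑ, 𝔮)`.

The norms `N(z J⁻¹)` are integers, so the weight `g` is introduced by discrete partial summation,
separately on each of the pieces where it is monotonic. If the error term is bounded by an
increasing `E`, then monotonicity allows one to sum by parts a second time, back to the sum of
`m ^ a (E(m + 1) - E(m))`; no derivative of `g` is needed, and each piece costs a bounded multiple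
of the same quantity (`PiecewiseMonotone.sum_sub_integral_le`). For the two parts of the error term
these sums are of size `errorOne` and `errorTwo` (`exists_rpow_mul_sqrt_sum_le`,
`exists_rpow_mul_log_sum_le`).
-/

namespace SecondSummation

/-! ### Sums of powers and logarithms -/

section

open Finset

theorem one_le_log_add_two {x : ℝ} (hx : 1 ≤ x) : 1 ≤ Real.log (x + 2) := by
  rw [Real.le_log_iff_exp_le (by linarith)]
  linarith [Real.exp_one_lt_d9]

theorem one_le_log_add_two_rpow {x B : ℝ} (hx : 1 ≤ x) (hB : 0 ≤ B) :
    1 ≤ Real.log (x + 2) ^ B :=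
  Real.one_le_rpow (one_le_log_add_two hx) hB

theorem log_add_two_rpow_nonneg {x : ℝ} (hx : 0 ≤ x) (B : ℝ) : 0 ≤ Real.log (x + 2) ^ B :=
  Real.rpow_nonneg (Real.log_nonneg (by linarith)) B

theorem log_add_two_rpow_mono {x y B : ℝ} (hx : 0 ≤ x) (hxy : x ≤ y) (hB : 0 ≤ B) :
    Real.log (x + 2) ^ B ≤ Real.log (y + 2) ^ B :=
  Real.rpow_le_rpow (Real.log_nonneg (by linarith))
    (Real.log_le_log (by linarith) (by linarith)) hB

/-- A power of the logarithm times a negative power is decreasing up to a constant factor. -/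
theorem exists_log_rpow_mul_rpow_le {ε B : ℝ} (hε : 0 < ε) (hB : 0 ≤ B) :
    ∃ D : ℝ, 0 < D ∧ ∀ x y : ℝ, 1 ≤ x → x ≤ y →
      Real.log (y + 2) ^ B * y ^ (-ε) ≤ D * (Real.log (x + 2) ^ B * x ^ (-ε)) := by
  -- `log` grows more slowly than the `δ`-th power; `δ` is chosen so that `δ B ≤ ε`, and `B + 1`
  -- in place of `B` allows `B = 0`.
  set δ : ℝ := ε / (B + 1) with hδ
  have hδ0 : 0 < δ := by positivity
  have hδB : δ * B ≤ ε := by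
    rw [hδ, div_mul_eq_mul_div, div_le_iff₀ (by linarith)]
    nlinarith
  refine ⟨(1 + 1 / δ) ^ B, by positivity, fun x y hx hxy => ?_⟩
  have hx0 : 0 < x := by linarith
  have hy0 : 0 < y := by linarith
  have hl : 1 ≤ y / x := (one_le_div hx0).2 hxy
  have hl0 : 0 < y / x := by linarith
  have hLx := one_le_log_add_two hx
  have hlog0 : 0 ≤ Real.log (y / x) := Real.log_nonneg hl
  have h1 : Real.log (y + 2) ≤ (1 + Real.log (y / x)) * Real.log (x + 2) := by
    have h2 : Real.log (y + 2) ≤ Real.log (y / x * (x + 2)) := by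
      apply Real.log_le_log (by linarith)
      have : y / x * (x + 2) = y + 2 * (y / x) := by field_simp
      rw [this]; linarith
    rw [Real.log_mul hl0.ne' (by linarith)] at h2
    nlinarith
  have h3 : 1 + Real.log (y / x) ≤ (1 + 1 / δ) * (y / x) ^ δ := by
    have h4 := Real.log_le_rpow_div hl0.le hδ0
    have h5 : 1 ≤ (y / x) ^ δ := Real.one_le_rpow hl hδ0.le
    have h6 : (1 + 1 / δ) * (y / x) ^ δ = (y / x) ^ δ + (y / x) ^ δ / δ := by ring
    linarith
  have h7 : Real.log (y + 2) ^ B ≤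
      (1 + 1 / δ) ^ B * (y / x) ^ ε * Real.log (x + 2) ^ B := by
    calc Real.log (y + 2) ^ B
        ≤ ((1 + 1 / δ) * (y / x) ^ δ * Real.log (x + 2)) ^ B := by
          exact Real.rpow_le_rpow (Real.log_nonneg (by linarith)) (h1.trans (by gcongr)) hB
      _ = (1 + 1 / δ) ^ B * (y / x) ^ (δ * B) * Real.log (x + 2) ^ B := by
          rw [Real.mul_rpow (by positivity) (by linarith),
            Real.mul_rpow (by positivity) (by positivity), ← Real.rpow_mul hl0.le]
      _ ≤ _ := by gcongr
  calc Real.log (y + 2) ^ B * y ^ (-ε)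
      ≤ (1 + 1 / δ) ^ B * (y / x) ^ ε * Real.log (x + 2) ^ B * y ^ (-ε) := by gcongr
    _ = (1 + 1 / δ) ^ B * (Real.log (x + 2) ^ B * x ^ (-ε)) := by
        rw [Real.div_rpow hy0.le hx0.le, Real.rpow_neg hx0.le, Real.rpow_neg hy0.le]
        have : y ^ ε ≠ 0 := (Real.rpow_pos_of_pos hy0 _).ne'
        field_simp

/-- The discrete form of `∫ x ^ (b - 1) = x ^ b / b`, from Bernoulli's inequality for `b > 0` and
from `1 + y ≤ exp y` for `b < 0`. -/
theorem rpow_sub_one_le_sub {b : ℝ} (hb : b ≠ 0) (hb1 : b ≤ 1) {x : ℝ} (hx : 0 < x) :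
    (x + 1) ^ (b - 1) ≤ (x + 1) ^ b / b - x ^ b / b := by
  have hy : 0 < x + 1 := by linarith
  have hq : 0 < x / (x + 1) := by positivity
  have hxb : x ^ b = (x + 1) ^ b * (x / (x + 1)) ^ b := by
    rw [← Real.mul_rpow hy.le hq.le]; congr 1; field_simp
  have hq1 : x / (x + 1) = 1 + -(1 / (x + 1)) := by field_simp; ring
  rw [hxb, Real.rpow_sub_one hy.ne']
  have hpos : 0 < (x + 1) ^ b := Real.rpow_pos_of_pos hy _
  suffices h : 1 / (x + 1) ≤ (1 - (x / (x + 1)) ^ b) / b by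
    calc (x + 1) ^ b / (x + 1) = (x + 1) ^ b * (1 / (x + 1)) := by ring
      _ ≤ (x + 1) ^ b * ((1 - (x / (x + 1)) ^ b) / b) := by gcongr
      _ = _ := by ring
  have hs : 1 / (x + 1) ≤ 1 := by rw [div_le_one hy]; linarith
  rcases lt_or_gt_of_ne hb with h | h
  · rw [le_div_iff_of_neg h, Real.rpow_def_of_pos hq]
    have h1 := Real.add_one_le_exp (Real.log (x / (x + 1)) * b)
    have h2 := Real.log_le_sub_one_of_pos hq
    have h3 : Real.log (x / (x + 1)) ≤ -(1 / (x + 1)) := by linarith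
    nlinarith
  · rw [le_div_iff₀ h]
    have h1 := rpow_one_add_le_one_add_mul_self (s := -(1 / (x + 1))) (by linarith) h.le hb1
    rw [← hq1] at h1
    linarith

/-- The mean value estimate for `x ^ (-s)`, from `1 + y ≤ exp y`. -/
theorem rpow_neg_sub_le {s : ℝ} (hs : 0 ≤ s) {x : ℝ} (hx : 0 < x) :
    x ^ (-s) - (x + 1) ^ (-s) ≤ s * x ^ (-s - 1) := by
  have hy : 0 < x + 1 := by linarith
  have hq : 0 < (x + 1) / x := by positivity
  have hxb : (x + 1) ^ (-s) = x ^ (-s) * ((x + 1) / x) ^ (-s) := by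
    rw [← Real.mul_rpow hx.le hq.le]; congr 1; field_simp
  rw [hxb, Real.rpow_sub_one hx.ne']
  have hpos : 0 < x ^ (-s) := Real.rpow_pos_of_pos hx _
  have h1 := Real.add_one_le_exp (Real.log ((x + 1) / x) * (-s))
  have h2 := Real.log_le_sub_one_of_pos hq
  have h3 : Real.log ((x + 1) / x) ≤ 1 / x := by
    have : (x + 1) / x - 1 = 1 / x := by field_simp; ring
    linarith
  rw [← Real.rpow_def_of_pos hq] at h1
  have h4 : 1 - ((x + 1) / x) ^ (-s) ≤ s * (1 / x) := by nlinarith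
  calc x ^ (-s) - x ^ (-s) * ((x + 1) / x) ^ (-s)
      = x ^ (-s) * (1 - ((x + 1) / x) ^ (-s)) := by ring
    _ ≤ x ^ (-s) * (s * (1 / x)) := by gcongr
    _ = _ := by ring

theorem sum_Ico_telescope {f : ℕ → ℝ} {k l : ℕ} (hkl : k ≤ l) :
    ∑ m ∈ Ico k l, (f (m + 1) - f m) = f l - f k := by
  induction l, hkl using Nat.le_induction with
  | base => simp
  | succ n hn ih => rw [Finset.sum_Ico_succ_top hn, ih]; ring

theorem sum_Ico_rpow_sub_one_le {b : ℝ} (hb : b ≠ 0) (hb1 : b ≤ 1) {k l : ℕ} (hk : 1 ≤ k)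
    (hkl : k ≤ l) :
    ∑ m ∈ Ico k l, ((m : ℝ) + 1) ^ (b - 1) ≤ (l : ℝ) ^ b / b - (k : ℝ) ^ b / b := by
  rw [← sum_Ico_telescope (f := fun m : ℕ => (m : ℝ) ^ b / b) hkl]
  refine Finset.sum_le_sum fun m hm => ?_
  have hm1 : (0 : ℝ) < m := by
    have := (Finset.mem_Ico.1 hm).1
    exact_mod_cast (by omega : 0 < m)
  push_cast
  exact rpow_sub_one_le_sub hb hb1 hm1

/-- Tails of `∑ m ^ (-1 - ε) log(m + 2) ^ B`. One half of the exponent `ε` absorbs the growth of the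
logarithm relative to its value at `k`; the other half makes the sum converge. -/
theorem exists_sum_Ico_rpow_mul_log_le {ε B : ℝ} (hε : 0 < ε) (hB : 0 ≤ B) :
    ∃ D : ℝ, 0 < D ∧ ∀ k l : ℕ, 1 ≤ k →
      ∑ m ∈ Ico k l, (m : ℝ) ^ (-1 - ε) * Real.log ((m : ℝ) + 2) ^ B ≤
        D * ((k : ℝ) ^ (-ε) * Real.log ((k : ℝ) + 2) ^ B) := by
  obtain ⟨D, hD, h⟩ := exists_log_rpow_mul_rpow_le (half_pos hε) hB
  refine ⟨D * 2 ^ (1 + ε / 2) * (1 / (ε / 2)), by positivity, fun k l hk => ?_⟩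
  have hk0 : (0 : ℝ) < k := by exact_mod_cast hk
  have hk1 : (1 : ℝ) ≤ k := by exact_mod_cast hk
  have hL := log_add_two_rpow_nonneg hk0.le B
  rcases lt_or_ge l k with hlk | hkl
  · rw [Finset.Ico_eq_empty (by omega), Finset.sum_empty]; positivity
  have hterm : ∀ m ∈ Ico k l, (m : ℝ) ^ (-1 - ε) * Real.log ((m : ℝ) + 2) ^ B ≤
      D * (Real.log ((k : ℝ) + 2) ^ B * (k : ℝ) ^ (-(ε / 2))) * 2 ^ (1 + ε / 2) *
        ((m : ℝ) + 1) ^ (-(ε / 2) - 1) := by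
    intro m hm
    have hkm : (k : ℝ) ≤ m := by exact_mod_cast (Finset.mem_Ico.1 hm).1
    have hm0 : (0 : ℝ) < m := by linarith
    have h1 := h k m hk1 hkm
    have h2 : (m : ℝ) ^ (-1 - ε) = (m : ℝ) ^ (-(ε / 2)) * (m : ℝ) ^ (-(1 + ε / 2)) := by
      rw [← Real.rpow_add hm0]; congr 1; ring
    have h3 : (m : ℝ) ^ (-(1 + ε / 2)) ≤ 2 ^ (1 + ε / 2) * ((m : ℝ) + 1) ^ (-(ε / 2) - 1) := by
      have h4 : (m : ℝ) ^ (-(1 + ε / 2)) = 2 ^ (1 + ε / 2) * (2 * (m : ℝ)) ^ (-(1 + ε / 2)) := by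
        rw [Real.mul_rpow (by norm_num) hm0.le, ← mul_assoc, ← Real.rpow_add (by norm_num)]
        simp
      rw [h4, show -(ε / 2) - 1 = -(1 + ε / 2) by ring]
      exact mul_le_mul_of_nonneg_left
        (Real.rpow_le_rpow_of_nonpos (by linarith) (by linarith) (by linarith)) (by positivity)
    calc (m : ℝ) ^ (-1 - ε) * Real.log ((m : ℝ) + 2) ^ B
        = (Real.log ((m : ℝ) + 2) ^ B * (m : ℝ) ^ (-(ε / 2))) * (m : ℝ) ^ (-(1 + ε / 2)) := by
          rw [h2]; ring
      _ ≤ (D * (Real.log ((k : ℝ) + 2) ^ B * (k : ℝ) ^ (-(ε / 2)))) *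
          (2 ^ (1 + ε / 2) * ((m : ℝ) + 1) ^ (-(ε / 2) - 1)) := by gcongr
      _ = _ := by ring
  refine (Finset.sum_le_sum hterm).trans ?_
  rw [← Finset.mul_sum]
  have h5 := sum_Ico_rpow_sub_one_le (b := -(ε / 2)) (by linarith) (by linarith) hk hkl
  have h6 : (l : ℝ) ^ (-(ε / 2)) / (-(ε / 2)) - (k : ℝ) ^ (-(ε / 2)) / (-(ε / 2)) ≤
      (1 / (ε / 2)) * (k : ℝ) ^ (-(ε / 2)) := by
    have : 0 ≤ (l : ℝ) ^ (-(ε / 2)) / (ε / 2) := by positivity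
    rw [div_neg, div_neg]
    have e : (1 / (ε / 2)) * (k : ℝ) ^ (-(ε / 2)) = (k : ℝ) ^ (-(ε / 2)) / (ε / 2) := by ring
    linarith
  calc _ ≤ D * (Real.log ((k : ℝ) + 2) ^ B * (k : ℝ) ^ (-(ε / 2))) * 2 ^ (1 + ε / 2) *
        ((1 / (ε / 2)) * (k : ℝ) ^ (-(ε / 2))) := by gcongr; exact h5.trans h6
    _ = D * 2 ^ (1 + ε / 2) * (1 / (ε / 2)) *
        (((k : ℝ) ^ (-(ε / 2)) * (k : ℝ) ^ (-(ε / 2))) * Real.log ((k : ℝ) + 2) ^ B) := by ring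
    _ = _ := by rw [← Real.rpow_add hk0]; congr 4; ring

/-- Summation by parts. -/
theorem sum_Ico_by_parts (w U : ℕ → ℝ) {k l : ℕ} (hkl : k ≤ l) :
    ∑ m ∈ Ico k l, w (m + 1) * (U (m + 1) - U m) =
      w l * U l - w k * U k - ∑ m ∈ Ico k l, U m * (w (m + 1) - w m) := by
  rw [← sum_Ico_telescope (f := fun m => w m * U m) hkl, ← Finset.sum_sub_distrib]
  exact Finset.sum_congr rfl fun m _ => by ring

theorem inv_add_one_le_log {x : ℝ} (hx : 0 < x) :
    1 / (x + 1) ≤ Real.log (x + 1) - Real.log x := by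
  have hq : 0 < x / (x + 1) := by positivity
  have h2 := Real.log_le_sub_one_of_pos hq
  rw [Real.log_div hx.ne' (by linarith)] at h2
  have : x / (x + 1) - 1 = -(1 / (x + 1)) := by field_simp; ring
  linarith

theorem sum_Ico_inv_le_log {k l : ℕ} (hk : 1 ≤ k) (hkl : k ≤ l) :
    ∑ m ∈ Ico k l, 1 / ((m : ℝ) + 1) ≤ Real.log l := by
  have h : ∑ m ∈ Ico k l, 1 / ((m : ℝ) + 1) ≤ Real.log l - Real.log k := by
    rw [← sum_Ico_telescope (f := fun m : ℕ => Real.log m) hkl]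
    refine Finset.sum_le_sum fun m hm => ?_
    have hm1 : (0 : ℝ) < m := by
      have := (Finset.mem_Ico.1 hm).1
      exact_mod_cast (by omega : 0 < m)
    push_cast
    exact inv_add_one_le_log hm1
  have : 0 ≤ Real.log k := Real.log_natCast_nonneg k
  linarith

/-- Partial summation for a nonnegative sequence whose summatory function `G` satisfies
`G(m) ≤ c m log(m + 2) ^ C`. -/
theorem sum_Ico_mul_rpow_neg_le {F : ℕ → ℝ} {c C s : ℝ} (hF0 : F 0 = 0) (hF : ∀ m, 0 ≤ F m)
    (hG : ∀ m, ∑ j ∈ range (m + 1), F j ≤ c * m * Real.log (m + 2) ^ C) (hs : 1 ≤ s)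
    {k l : ℕ} (hkl : k ≤ l) :
    ∑ m ∈ Ico k l, ((m : ℝ) + 1) ^ (-s) * F (m + 1) ≤
      c * ((l : ℝ) ^ (1 - s) * Real.log (l + 2) ^ C) +
        s * c * ∑ m ∈ Ico k l, (m : ℝ) ^ (-s) * Real.log (m + 2) ^ C := by
  set G : ℕ → ℝ := fun m => ∑ j ∈ range (m + 1), F j with hGdef
  have hGn : ∀ m, 0 ≤ G m := fun m => Finset.sum_nonneg fun j _ => hF j
  have hd : ∀ m, F (m + 1) = G (m + 1) - G m := fun m => by
    simp only [hGdef]; rw [Finset.sum_range_succ _ (m + 1)]; ring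
  -- The case `m = 0` is separate because `0 ^ (1 - s) = 1` for `s = 1`.
  have hpow : ∀ m : ℕ, (m : ℝ) * (m : ℝ) ^ (-s) = (m : ℝ) ^ (1 - s) ∨ m = 0 := fun m => by
    rcases Nat.eq_zero_or_pos m with h | h
    · exact Or.inr h
    · left
      have : (0 : ℝ) < m := by exact_mod_cast h
      rw [sub_eq_add_neg, Real.rpow_add this, Real.rpow_one]
  have hL : ∀ m : ℕ, 0 ≤ Real.log ((m : ℝ) + 2) ^ C :=
    fun m => log_add_two_rpow_nonneg (Nat.cast_nonneg m) C
  have habel := sum_Ico_by_parts (fun m : ℕ => (m : ℝ) ^ (-s)) G hkl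
  have e1 : ∑ m ∈ Ico k l, ((m : ℝ) + 1) ^ (-s) * F (m + 1) =
      ∑ m ∈ Ico k l, ((m + 1 : ℕ) : ℝ) ^ (-s) * (G (m + 1) - G m) :=
    Finset.sum_congr rfl fun m _ => by rw [hd m]; push_cast; rfl
  rw [e1, habel]
  have hG0 : G 0 = 0 := by simp [hGdef, hF0]
  have b1 : (l : ℝ) ^ (-s) * G l ≤ c * ((l : ℝ) ^ (1 - s) * Real.log (l + 2) ^ C) := by
    rcases hpow l with h | h
    · rw [← h]
      calc (l : ℝ) ^ (-s) * G l ≤ (l : ℝ) ^ (-s) * (c * l * Real.log (l + 2) ^ C) := by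
            gcongr; exact hG l
        _ = _ := by ring
    · subst h
      have : 0 ≤ c := by
        have h1 := (hGn 1).trans (hG 1)
        have h2 : 0 < Real.log (((1 : ℕ) : ℝ) + 2) ^ C := by
          apply Real.rpow_pos_of_pos (Real.log_pos (by norm_num))
        simp only [Nat.cast_one, mul_one] at h1 h2
        exact nonneg_of_mul_nonneg_left h1 h2
      rw [hG0, mul_zero]
      have := hL 0
      have h3 : (0 : ℝ) ≤ ((0 : ℕ) : ℝ) ^ (1 - s) := Real.rpow_nonneg (by simp) _
      positivity
  have b2 : 0 ≤ (k : ℝ) ^ (-s) * G k := mul_nonneg (by positivity) (hGn k)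
  have b3 : -∑ m ∈ Ico k l, G m * (((m + 1 : ℕ) : ℝ) ^ (-s) - (m : ℝ) ^ (-s)) ≤
      s * c * ∑ m ∈ Ico k l, (m : ℝ) ^ (-s) * Real.log (m + 2) ^ C := by
    rw [← Finset.sum_neg_distrib, Finset.mul_sum]
    refine Finset.sum_le_sum fun m _ => ?_
    rcases Nat.eq_zero_or_pos m with h | h
    -- At `m = 0` both `G 0` and the convention `0 ^ (-s) = 0` make the terms vanish.
    · subst h
      rw [hG0]
      simp [Real.zero_rpow (by linarith : -s ≠ 0)]
    · have hm : (0 : ℝ) < m := by exact_mod_cast h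
      have h1 := rpow_neg_sub_le (by linarith : 0 ≤ s) hm
      have h2 : (m : ℝ) ^ (-s) = m * (m : ℝ) ^ (-s - 1) := by
        rw [Real.rpow_sub_one hm.ne']; field_simp
      push_cast
      calc -(G m * (((m : ℝ) + 1) ^ (-s) - (m : ℝ) ^ (-s)))
          = G m * ((m : ℝ) ^ (-s) - ((m : ℝ) + 1) ^ (-s)) := by ring
        _ ≤ G m * (s * (m : ℝ) ^ (-s - 1)) := by gcongr; exact hGn m
        _ ≤ (c * m * Real.log (m + 2) ^ C) * (s * (m : ℝ) ^ (-s - 1)) := by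
            gcongr; exact hG m
        _ = _ := by rw [h2]; ring
  linarith

end

/-! ### Sums against a sequence of bounded growth, and the error terms -/

section

open Finset

section PartialSummation

variable {C : ℝ}

/-- If `∑_{j ≤ m} F j` is at most `c m log(m + 2) ^ C`, then `∑ F m / m` has one more logarithm. -/
theorem exists_sum_div_le (hC : 0 ≤ C) :
    ∃ M : ℝ, 0 < M ∧ ∀ (F : ℕ → ℝ) (c : ℝ), 0 < c → F 0 = 0 → (∀ m, 0 ≤ F m) →
      (∀ m : ℕ, ∑ j ∈ range (m + 1), F j ≤ c * m * Real.log (m + 2) ^ C) →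
      ∀ l : ℕ, 1 ≤ l →
        ∑ m ∈ range (l + 1), F m / m ≤ M * c * Real.log (l + 2) ^ (C + 1) := by
  refine ⟨3, by norm_num, fun F c hc hF0 hF hG l hl => ?_⟩
  have h := sum_Ico_mul_rpow_neg_le hF0 hF hG le_rfl (Nat.zero_le l)
  have hl1 : (1 : ℝ) ≤ l := by exact_mod_cast hl
  have hlog := one_le_log_add_two hl1
  have hLC := one_le_log_add_two_rpow hl1 hC
  have e1 : ∑ m ∈ range (l + 1), F m / m = ∑ m ∈ Ico 0 l, ((m : ℝ) + 1) ^ (-1 : ℝ) * F (m + 1) := by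
    rw [Finset.sum_range_succ', hF0, zero_div, add_zero, Finset.range_eq_Ico]
    refine Finset.sum_congr rfl fun m _ => ?_
    rw [Real.rpow_neg_one]; push_cast; rw [div_eq_inv_mul]
  have e2 : ∑ m ∈ Ico 0 l, (m : ℝ) ^ (-1 : ℝ) * Real.log (m + 2) ^ C ≤
      (1 + Real.log l) * Real.log (l + 2) ^ C := by
    have h0 : ∑ m ∈ Ico 0 l, (m : ℝ) ^ (-1 : ℝ) ≤ 1 + Real.log l := by
      have h1 : ∑ m ∈ Ico 0 l, (m : ℝ) ^ (-1 : ℝ) ≤ ∑ m ∈ range (l + 1), (m : ℝ) ^ (-1 : ℝ) := by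
        rw [← Finset.range_eq_Ico]
        exact Finset.sum_le_sum_of_subset_of_nonneg
          (Finset.range_subset_range.2 (by omega)) fun _ _ _ => by positivity
      refine h1.trans ?_
      have h2 := harmonic_le_one_add_log l
      rw [harmonic] at h2
      push_cast at h2
      rw [Finset.sum_range_succ']
      simp only [Real.rpow_neg_one]
      simpa using h2
    calc _ ≤ ∑ m ∈ Ico 0 l, (m : ℝ) ^ (-1 : ℝ) * Real.log (l + 2) ^ C := by
          refine Finset.sum_le_sum fun m hm => ?_
          have : (m : ℝ) ≤ l := by exact_mod_cast (Finset.mem_Ico.1 hm).2.le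
          exact mul_le_mul_of_nonneg_left
            (log_add_two_rpow_mono (Nat.cast_nonneg m) this hC) (by positivity)
      _ = (∑ m ∈ Ico 0 l, (m : ℝ) ^ (-1 : ℝ)) * Real.log (l + 2) ^ C := by rw [Finset.sum_mul]
      _ ≤ _ := by gcongr
  have h3 : Real.log l ≤ Real.log (l + 2) := Real.log_le_log (by linarith) (by linarith)
  rw [e1]
  refine h.trans ?_
  rw [Real.rpow_add_one (by linarith)]
  simp only [sub_self, Real.rpow_zero, one_mul]
  have h4 : c * ∑ m ∈ Ico 0 l, (m : ℝ) ^ (-1 : ℝ) * Real.log (m + 2) ^ C ≤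
      c * ((1 + Real.log l) * Real.log (l + 2) ^ C) := by gcongr
  have h5 : c * ((1 + Real.log l) * Real.log (l + 2) ^ C) + c * Real.log (l + 2) ^ C ≤
      c * (Real.log (l + 2) ^ C * (3 * Real.log (l + 2))) := by
    have : (1 + Real.log l) * Real.log (l + 2) ^ C + Real.log (l + 2) ^ C ≤
      Real.log (l + 2) ^ C * (3 * Real.log (l + 2)) := by nlinarith
    nlinarith
  linarith

/-- Tails of `∑ F m / m ^ s` for `s > 1`, if `∑_{j ≤ m} F j` is at most `c m log(m + 2) ^ C`. -/
theorem exists_sum_rpow_neg_le (hC : 0 ≤ C) {s : ℝ} (hs : 1 < s) :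
    ∃ M : ℝ, 0 < M ∧ ∀ (F : ℕ → ℝ) (c : ℝ), 0 < c → F 0 = 0 → (∀ m, 0 ≤ F m) →
      (∀ m : ℕ, ∑ j ∈ range (m + 1), F j ≤ c * m * Real.log (m + 2) ^ C) →
      ∀ k l : ℕ, 1 ≤ k →
        ∑ m ∈ Ico k l, ((m : ℝ) + 1) ^ (-s) * F (m + 1) ≤
          M * c * ((k : ℝ) ^ (1 - s) * Real.log (k + 2) ^ C) := by
  obtain ⟨D, hD, h⟩ := exists_log_rpow_mul_rpow_le (sub_pos.2 hs) hC
  obtain ⟨D', hD', h'⟩ := exists_sum_Ico_rpow_mul_log_le (sub_pos.2 hs) hC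
  refine ⟨D + s * D', by positivity, fun F c hc hF0 hF hG k l hk => ?_⟩
  have hk1 : (1 : ℝ) ≤ k := by exact_mod_cast hk
  have hL := log_add_two_rpow_nonneg (by linarith : (0 : ℝ) ≤ k) C
  rcases lt_or_ge l k with hlk | hkl
  · rw [Finset.Ico_eq_empty (by omega), Finset.sum_empty]; positivity
  refine (sum_Ico_mul_rpow_neg_le hF0 hF hG hs.le hkl).trans ?_
  have h1 := h k l hk1 (by exact_mod_cast hkl)
  have h2 := h' k l hk
  rw [show -(s - 1) = 1 - s by ring] at h1 h2
  rw [show -1 - (s - 1) = -s by ring] at h2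
  calc _ ≤ c * (D * (Real.log (k + 2) ^ C * (k : ℝ) ^ (1 - s))) +
        s * c * (D' * ((k : ℝ) ^ (1 - s) * Real.log (k + 2) ^ C)) := by
        rw [mul_comm ((l : ℝ) ^ (1 - s))]
        gcongr
    _ = _ := by ring

/-- The full sum for `s = 3 / 2`. The term with `m = 1` is the first nonzero one and is bounded
separately. -/
theorem exists_sum_rpow_neg_three_halves_le (hC : 0 ≤ C) :
    ∃ M : ℝ, 0 < M ∧ ∀ (F : ℕ → ℝ) (c : ℝ), 0 < c → F 0 = 0 → (∀ m, 0 ≤ F m) →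
      (∀ m : ℕ, ∑ j ∈ range (m + 1), F j ≤ c * m * Real.log (m + 2) ^ C) →
      ∀ l : ℕ, ∑ m ∈ range (l + 1), ((m : ℕ) : ℝ) ^ (-(3 / 2) : ℝ) * F m ≤ M * c := by
  obtain ⟨M, hM, h⟩ := exists_sum_rpow_neg_le hC (by norm_num : (1 : ℝ) < 3 / 2)
  refine ⟨Real.log 3 ^ C + M * Real.log 3 ^ C, ?_, fun F c hc hF0 hF hG l => ?_⟩
  · have := Real.rpow_pos_of_pos (Real.log_pos (by norm_num : (1 : ℝ) < 3)) C
    positivity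
  have h1 := h F c hc hF0 hF hG 1 l le_rfl
  have h2 := hG 1
  rw [Finset.sum_range_succ, Finset.sum_range_one, hF0] at h2
  norm_num at h1 h2
  have h3 : ∑ m ∈ range (l + 1), ((m : ℕ) : ℝ) ^ (-(3 / 2) : ℝ) * F m ≤
      F 1 + ∑ m ∈ Ico 1 l, ((m : ℝ) + 1) ^ (-(3 / 2) : ℝ) * F (m + 1) := by
    rcases Nat.eq_zero_or_pos l with hl | hl
    · subst hl; simp [hF0, hF]
    rw [Finset.sum_range_succ', hF0, mul_zero, add_zero, Finset.range_eq_Ico,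
      Finset.sum_eq_sum_Ico_succ_bot hl]
    simp
  calc _ ≤ _ := h3
    _ ≤ c * Real.log 3 ^ C + M * c * Real.log 3 ^ C := by gcongr
    _ = _ := by ring

end PartialSummation

/-- For the error `E(m) = log(m + 2) ^ (C + 1)` and a weight of size `t ^ a`, both the boundary term
and the increments in partial summation on `[t₁, t₂]` are of size `errorTwo`. For `a = 0` the sum
telescopes; for `a < 0` it is summed by parts a second time. -/
theorem exists_rpow_mul_log_sum_le {a C : ℝ} (ha : a ≤ 0) (hC : 0 ≤ C) :
    ∃ M : ℝ, 0 < M ∧ ∀ (t₁ t₂ : ℝ), 1 ≤ t₁ → ∀ k l : ℕ, t₁ ≤ k → k ≤ l → (l : ℝ) ≤ t₂ →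
      (l : ℝ) ^ a * Real.log (l + 2) ^ (C + 1) ≤ M * errorTwo a C t₁ t₂ ∧
      ∑ m ∈ Ico k l, ((m : ℝ) + 1) ^ a *
        (Real.log ((m : ℝ) + 1 + 2) ^ (C + 1) - Real.log ((m : ℝ) + 2) ^ (C + 1)) ≤
        M * errorTwo a C t₁ t₂ := by
  have hC1 : 0 ≤ C + 1 := by linarith
  rcases ha.eq_or_lt with h0 | h0
  · refine ⟨1, one_pos, fun t₁ t₂ ht k l hk hkl hl => ?_⟩
    have hm : Real.log ((l : ℝ) + 2) ^ (C + 1) ≤ Real.log (t₂ + 2) ^ (C + 1) :=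
      log_add_two_rpow_mono (Nat.cast_nonneg l) hl hC1
    rw [errorTwo, if_pos h0, one_mul, h0]
    simp only [Real.rpow_zero, one_mul]
    refine ⟨hm, ?_⟩
    have := sum_Ico_telescope (f := fun m : ℕ => Real.log ((m : ℝ) + 2) ^ (C + 1)) hkl
    push_cast at this
    rw [this]
    have := log_add_two_rpow_nonneg (Nat.cast_nonneg k) (C + 1)
    linarith
  · obtain ⟨D, hD, h⟩ := exists_log_rpow_mul_rpow_le (neg_pos.2 h0) hC1
    obtain ⟨D', hD', h'⟩ := exists_sum_Ico_rpow_mul_log_le (neg_pos.2 h0) hC1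
    rw [neg_neg] at h h'
    rw [show -1 - -a = a - 1 by ring] at h'
    refine ⟨D + -a * (D' * D), by have := neg_pos.2 h0; positivity,
      fun t₁ t₂ ht k l hk hkl hl => ?_⟩
    have hk1 : (1 : ℝ) ≤ k := ht.trans hk
    have hk1' : 1 ≤ k := by exact_mod_cast hk1
    have hE : errorTwo a C t₁ t₂ = Real.log (t₁ + 2) ^ (C + 1) * t₁ ^ a := by
      rw [errorTwo, if_neg h0.ne, mul_comm]
    have hE0 : 0 ≤ errorTwo a C t₁ t₂ := by
      rw [hE]
      have := log_add_two_rpow_nonneg (by linarith : (0 : ℝ) ≤ t₁) (C + 1)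
      positivity
    have hkl' : (k : ℝ) ≤ l := by exact_mod_cast hkl
    have h1 : (l : ℝ) ^ a * Real.log (l + 2) ^ (C + 1) ≤ D * errorTwo a C t₁ t₂ := by
      rw [hE, mul_comm]; exact h t₁ l ht (hk.trans hkl')
    have h2 : (k : ℝ) ^ a * Real.log (k + 2) ^ (C + 1) ≤ D * errorTwo a C t₁ t₂ := by
      rw [hE, mul_comm]; exact h t₁ k ht hk
    have hna : 0 ≤ -a := by linarith
    have h3 : 0 ≤ -a * (D' * D) * errorTwo a C t₁ t₂ := by positivity
    refine ⟨by linarith, ?_⟩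
    have habel := sum_Ico_by_parts (fun m : ℕ => (m : ℝ) ^ a)
      (fun m : ℕ => Real.log ((m : ℝ) + 2) ^ (C + 1)) hkl
    push_cast at habel
    rw [habel]
    have h4 : 0 ≤ (k : ℝ) ^ a * Real.log ((k : ℝ) + 2) ^ (C + 1) :=
      mul_nonneg (by positivity) (log_add_two_rpow_nonneg (Nat.cast_nonneg k) _)
    have h5 : -∑ m ∈ Ico k l, Real.log ((m : ℝ) + 2) ^ (C + 1) *
        (((m : ℝ) + 1) ^ a - (m : ℝ) ^ a) ≤ -a * (D' * D) * errorTwo a C t₁ t₂ := by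
      calc _ = ∑ m ∈ Ico k l, Real.log ((m : ℝ) + 2) ^ (C + 1) *
            ((m : ℝ) ^ a - ((m : ℝ) + 1) ^ a) := by
            rw [← Finset.sum_neg_distrib]
            exact Finset.sum_congr rfl fun m _ => by ring
        _ ≤ ∑ m ∈ Ico k l, -a * ((m : ℝ) ^ (a - 1) * Real.log ((m : ℝ) + 2) ^ (C + 1)) := by
            refine Finset.sum_le_sum fun m hm => ?_
            have hm0 : (0 : ℝ) < m := by
              exact_mod_cast hk1'.trans (Finset.mem_Ico.1 hm).1
            have h6 := rpow_neg_sub_le hna hm0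
            rw [neg_neg] at h6
            have h7 := log_add_two_rpow_nonneg hm0.le (C + 1)
            calc _ ≤ Real.log ((m : ℝ) + 2) ^ (C + 1) * (-a * (m : ℝ) ^ (a - 1)) := by gcongr
              _ = _ := by ring
        _ = -a * ∑ m ∈ Ico k l, (m : ℝ) ^ (a - 1) * Real.log ((m : ℝ) + 2) ^ (C + 1) := by
            rw [Finset.mul_sum]
        _ ≤ -a * (D' * (D * errorTwo a C t₁ t₂)) := by
            gcongr
            exact (h' k l hk1').trans (by gcongr)
        _ = _ := by ring
    linarith

/-- For the error `E(m) = √m` and a weight of size `t ^ a`, both the boundary term and the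
increments in partial summation on `[t₁, t₂]` are of size `errorOne`: the increments are at most
`(m + 1) ^ (a - 1 / 2)`, whose sum is logarithmic exactly when `a = -1 / 2`. -/
theorem exists_rpow_mul_sqrt_sum_le {a : ℝ} (ha : a ≤ 0) :
    ∃ M : ℝ, 0 < M ∧ ∀ (t₁ t₂ : ℝ), 1 ≤ t₁ → ∀ k l : ℕ, t₁ ≤ k → k ≤ l → (l : ℝ) ≤ t₂ →
      (l : ℝ) ^ a * √l ≤ M * errorOne a t₁ t₂ ∧
      ∑ m ∈ Ico k l, ((m : ℝ) + 1) ^ a * (√((m : ℝ) + 1) - √m) ≤ M * errorOne a t₁ t₂ := by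
  have hterm : ∀ m : ℕ, ((m : ℝ) + 1) ^ a * (√((m : ℝ) + 1) - √m) ≤
      ((m : ℝ) + 1) ^ (a + 1 / 2 - 1) := by
    intro m
    have hm : (0 : ℝ) < (m : ℝ) + 1 := by positivity
    have hs : √((m : ℝ) + 1) - √m ≤ ((m : ℝ) + 1) ^ (-(1 / 2) : ℝ) := by
      rw [Real.rpow_neg hm.le, ← Real.sqrt_eq_rpow, ← one_div,
        le_div_iff₀ (Real.sqrt_pos.2 hm)]
      have h1 := Real.mul_self_sqrt hm.le
      have h2 := Real.mul_self_sqrt (Nat.cast_nonneg (α := ℝ) m)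
      have h3 : √(m : ℝ) ≤ √((m : ℝ) + 1) := Real.sqrt_le_sqrt (by linarith)
      nlinarith [Real.sqrt_nonneg (m : ℝ)]
    calc _ ≤ ((m : ℝ) + 1) ^ a * ((m : ℝ) + 1) ^ (-(1 / 2) : ℝ) := by gcongr
      _ = _ := by rw [← Real.rpow_add hm]; congr 1; ring
  have hsqrt : ∀ l : ℕ, 1 ≤ l → (l : ℝ) ^ a * √l = (l : ℝ) ^ (a + 1 / 2) := by
    intro l hl
    rw [Real.sqrt_eq_rpow, ← Real.rpow_add (by exact_mod_cast hl)]
  rcases eq_or_ne a (-1 / 2) with h | h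
  · refine ⟨1, one_pos, fun t₁ t₂ ht k l hk hkl hl => ?_⟩
    have hk1 : (1 : ℝ) ≤ k := ht.trans hk
    have hk1' : 1 ≤ k := by exact_mod_cast hk1
    have hkl' : (k : ℝ) ≤ l := by exact_mod_cast hkl
    have hb : a + 1 / 2 = 0 := by rw [h]; norm_num
    rw [errorOne, if_pos h, one_mul, hsqrt l (hk1'.trans hkl), hb, Real.rpow_zero]
    refine ⟨one_le_log_add_two (by linarith), ?_⟩
    calc _ ≤ ∑ m ∈ Ico k l, 1 / ((m : ℝ) + 1) := by
          refine Finset.sum_le_sum fun m _ => (hterm m).trans (le_of_eq ?_)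
          rw [hb, zero_sub, Real.rpow_neg_one, one_div]
      _ ≤ Real.log l := sum_Ico_inv_le_log hk1' hkl
      _ ≤ _ := Real.log_le_log (by linarith) (by linarith)
  · have hb : a + 1 / 2 ≠ 0 := fun h' => h (by linarith)
    set b := a + 1 / 2 with hbdef
    have hb0 : 0 < |b| := abs_pos.2 hb
    refine ⟨1 + 1 / |b|, by positivity, fun t₁ t₂ ht k l hk hkl hl => ?_⟩
    have hk1 : (1 : ℝ) ≤ k := ht.trans hk
    have hk1' : 1 ≤ k := by exact_mod_cast hk1
    have hkl' : (k : ℝ) ≤ l := by exact_mod_cast hkl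
    have hE : errorOne a t₁ t₂ = sSup ((fun t : ℝ => t ^ b) '' Set.Icc t₁ t₂) := by
      rw [errorOne, if_neg h]
    have hbdd : BddAbove ((fun t : ℝ => t ^ b) '' Set.Icc t₁ t₂) := by
      refine isCompact_Icc.bddAbove_image fun t htt => ?_
      exact (Real.continuousAt_rpow_const _ _
        (Or.inl (by linarith [htt.1] : 0 < t).ne')).continuousWithinAt
    have hle : ∀ t ∈ Set.Icc t₁ t₂, t ^ b ≤ errorOne a t₁ t₂ := fun t htt => by
      rw [hE]; exact le_csSup hbdd ⟨t, htt, rfl⟩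
    have hkb := hle k ⟨hk, hkl'.trans hl⟩
    have hlb := hle l ⟨hk.trans hkl', hl⟩
    have hE0 : 0 ≤ errorOne a t₁ t₂ := (by positivity : 0 ≤ (k : ℝ) ^ b).trans hkb
    have h0 : 0 ≤ 1 / |b| * errorOne a t₁ t₂ := by positivity
    rw [hsqrt l (hk1'.trans hkl)]
    refine ⟨by linarith, ?_⟩
    have hsum := (Finset.sum_le_sum fun m (_ : m ∈ Ico k l) => hterm m).trans
      (sum_Ico_rpow_sub_one_le hb (by linarith) hk1' hkl)
    have hfin : (l : ℝ) ^ b / b - (k : ℝ) ^ b / b ≤ 1 / |b| * errorOne a t₁ t₂ := by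
      rcases lt_or_gt_of_ne hb with hneg | hpos
      · have e : (l : ℝ) ^ b / b - (k : ℝ) ^ b / b = 1 / -b * ((k : ℝ) ^ b - (l : ℝ) ^ b) := by
          field_simp; ring
        have h1 : 0 ≤ (l : ℝ) ^ b := by positivity
        rw [e, abs_of_neg hneg]
        have : 0 < -b := by linarith
        gcongr
        linarith
      · have e : (l : ℝ) ^ b / b - (k : ℝ) ^ b / b = 1 / b * ((l : ℝ) ^ b - (k : ℝ) ^ b) := by
          field_simp
        have h1 : 0 ≤ (k : ℝ) ^ b := by positivity
        rw [e, abs_of_pos hpos]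
        gcongr
        linarith
    linarith

end

/-! ### Partial summation against piecewise monotone functions -/

section

open Finset

/-- The hypotheses of partial summation on `[t₁, t₂]`: the summatory function of `α` is
`κ m + O(E(m))` with `E` nonnegative and increasing, `g(t) = O(t ^ a)` with constant `cg`,
and `V` bounds the weighted error terms that arise. -/
structure PartialSummationData (α : ℕ → ℝ) (κ : ℝ) (E : ℕ → ℝ) (g : ℝ → ℝ)
    (a t₁ t₂ cg V : ℝ) : Prop where
  exponent_nonpos : a ≤ 0
  one_le : 1 ≤ t₁
  error : ∀ m : ℕ, |∑ j ∈ range (m + 1), α j - κ * m| ≤ E m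
  mono : Monotone E
  bound_nonneg : 0 ≤ cg
  bound : ∀ t ∈ Set.Icc t₁ t₂, |g t| ≤ cg * t ^ a
  value_le : ∀ m : ℕ, t₁ ≤ m → (m : ℝ) ≤ t₂ → (m : ℝ) ^ a * E m ≤ V
  sum_le : ∀ k l : ℕ, t₁ ≤ k → k ≤ l → (l : ℝ) ≤ t₂ →
    ∑ m ∈ Ico k l, ((m : ℝ) + 1) ^ a * (E (m + 1) - E m) ≤ V
  main_le : |κ| * t₁ ^ a ≤ V

namespace PartialSummationData

variable {α : ℕ → ℝ} {κ : ℝ} {E : ℕ → ℝ} {g : ℝ → ℝ} {a t₁ t₂ cg V : ℝ}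

theorem neg (h : PartialSummationData α κ E g a t₁ t₂ cg V) :
    PartialSummationData α κ E (-g) a t₁ t₂ cg V :=
  { h with bound := fun t ht => by simpa using h.bound t ht }

theorem bound_const (h : PartialSummationData α κ E g a t₁ t₂ cg V) {t : ℝ}
    (ht : t ∈ Set.Icc t₁ t₂) : |g t| ≤ cg * t₁ ^ a := by
  have := h.bound_nonneg
  refine (h.bound t ht).trans ?_
  exact mul_le_mul_of_nonneg_left
    (Real.rpow_le_rpow_of_nonpos (by linarith [h.one_le]) ht.1 h.exponent_nonpos) this

theorem error_nonneg (h : PartialSummationData α κ E g a t₁ t₂ cg V) (m : ℕ) : 0 ≤ E m :=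
  (abs_nonneg _).trans (h.error m)

theorem main_bound (h : PartialSummationData α κ E g a t₁ t₂ cg V) :
    |κ| * (cg * t₁ ^ a) ≤ cg * V := by
  have := mul_le_mul_of_nonneg_left h.main_le h.bound_nonneg
  linarith

theorem value_bound (h : PartialSummationData α κ E g a t₁ t₂ cg V) {m : ℕ}
    (h1 : t₁ ≤ m) (h2 : (m : ℝ) ≤ t₂) : |g m| * E m ≤ cg * V := by
  have h3 := h.error_nonneg m
  have h4 := h.bound_nonneg
  calc |g m| * E m ≤ (cg * (m : ℝ) ^ a) * E m := by gcongr; exact h.bound m ⟨h1, h2⟩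
    _ = cg * ((m : ℝ) ^ a * E m) := by ring
    _ ≤ cg * V := by gcongr; exact h.value_le m h1 h2

/-- A single term: `α(m)` is the increment of the summatory function, so at most `|κ| + 2 E(m)`. -/
theorem term_le (h : PartialSummationData α κ E g a t₁ t₂ cg V) {m : ℕ}
    (h1 : t₁ ≤ m) (h2 : (m : ℝ) ≤ t₂) : |α m * g m| ≤ 3 * (cg * V) := by
  have hm : 1 ≤ m := by exact_mod_cast h.one_le.trans h1
  obtain ⟨n, rfl⟩ := Nat.exists_eq_add_of_le' hm
  have e1 := h.error (n + 1)
  have e0 := h.error n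
  rw [Finset.sum_range_succ] at e1
  have hα : |α (n + 1)| ≤ |κ| + 2 * E (n + 1) := by
    have hmono := h.mono (Nat.le_succ n)
    have e : α (n + 1) = κ + ((∑ j ∈ range (n + 1), α j + α (n + 1) - κ * ((n + 1 : ℕ) : ℝ)) -
        (∑ j ∈ range (n + 1), α j - κ * n)) := by push_cast; ring
    rw [e]
    refine (abs_add_le _ _).trans ?_
    have := abs_sub (∑ j ∈ range (n + 1), α j + α (n + 1) - κ * ((n + 1 : ℕ) : ℝ))
        (∑ j ∈ range (n + 1), α j - κ * n)
    simp only [Nat.succ_eq_add_one] at hmono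
    linarith
  rw [abs_mul]
  have hb := h.bound_const ⟨h1, h2⟩
  have hv := h.value_bound h1 h2
  have hm := h.main_bound
  calc _ ≤ (|κ| + 2 * E (n + 1)) * |g ((n + 1 : ℕ) : ℝ)| := by gcongr
    _ = |κ| * |g ((n + 1 : ℕ) : ℝ)| + 2 * (|g ((n + 1 : ℕ) : ℝ)| * E (n + 1)) := by ring
    _ ≤ |κ| * (cg * t₁ ^ a) + 2 * (cg * V) := by gcongr
    _ ≤ _ := by linarith

/-- Partial summation for increasing `g` between integers. The variation of `g` is
controlled by monotonicity alone: the sum of `E(m) (g(m + 1) - g(m))`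
has nonnegative terms and is summed by parts back to increments of `E`. -/
theorem sum_Ico_sub_integral_le_of_monotone (h : PartialSummationData α κ E g a t₁ t₂ cg V)
    {k l : ℕ} (hk : t₁ ≤ k) (hkl : k ≤ l) (hl : (l : ℝ) ≤ t₂)
    (hg : MonotoneOn g (Set.Icc (k : ℝ) l)) :
    |∑ m ∈ Ico k l, α (m + 1) * g ((m : ℝ) + 1) - κ * ∫ t in (k : ℝ)..l, g t| ≤ 7 * (cg * V) := by
  have hkl' : (k : ℝ) ≤ l := by exact_mod_cast hkl
  set e : ℕ → ℝ := fun m => ∑ j ∈ range (m + 1), α j - κ * m with he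
  have hα : ∀ m, α (m + 1) = κ + (e (m + 1) - e m) := fun m => by
    simp only [he]; rw [Finset.sum_range_succ _ (m + 1)]; push_cast; ring
  have hee : ∀ m, |e m| ≤ E m := h.error
  have hgm : ∀ m ∈ Ico k l, 0 ≤ g ((m : ℝ) + 1) - g m := by
    intro m hm
    rw [Finset.mem_Ico] at hm
    have h1 : (k : ℝ) ≤ m := by exact_mod_cast hm.1
    have h2 : (m : ℝ) + 1 ≤ l := by exact_mod_cast hm.2
    exact sub_nonneg.2 (hg ⟨h1, by linarith⟩ ⟨by linarith, h2⟩ (by linarith))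
  -- Summation by parts, once for the signed error `e` and once for its majorant `E`.
  have b1 := sum_Ico_by_parts (fun m : ℕ => g m) e hkl
  have b2 := sum_Ico_by_parts (fun m : ℕ => g m) E hkl
  push_cast at b1 b2
  have hvk := h.value_bound hk (hkl'.trans hl)
  have hvl := h.value_bound (hk.trans hkl') hl
  have c1 : |∑ m ∈ Ico k l, e m * (g ((m : ℝ) + 1) - g m)| ≤
      ∑ m ∈ Ico k l, E m * (g ((m : ℝ) + 1) - g m) := by
    refine (Finset.abs_sum_le_sum_abs _ _).trans (Finset.sum_le_sum fun m hm => ?_)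
    rw [abs_mul, abs_of_nonneg (hgm m hm)]
    exact mul_le_mul_of_nonneg_right (hee m) (hgm m hm)
  have c2 : -∑ m ∈ Ico k l, g ((m : ℝ) + 1) * (E (m + 1) - E m) ≤ cg * V := by
    rw [← Finset.sum_neg_distrib]
    calc _ ≤ ∑ m ∈ Ico k l, cg * (((m : ℝ) + 1) ^ a * (E (m + 1) - E m)) := by
          refine Finset.sum_le_sum fun m hm => ?_
          rw [Finset.mem_Ico] at hm
          have h1 : (k : ℝ) ≤ m := by exact_mod_cast hm.1
          have h2 : (m : ℝ) + 1 ≤ l := by exact_mod_cast hm.2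
          have h3 := (abs_le.1 (h.bound ((m : ℝ) + 1) ⟨by linarith, by linarith⟩)).1
          have h4 := sub_nonneg.2 (h.mono (Nat.le_succ m))
          have := mul_le_mul_of_nonneg_right h3 h4
          simp only [Nat.succ_eq_add_one] at this
          linarith
      _ = cg * ∑ m ∈ Ico k l, ((m : ℝ) + 1) ^ a * (E (m + 1) - E m) := by rw [Finset.mul_sum]
      _ ≤ cg * V := by
          have := h.bound_nonneg
          gcongr
          exact h.sum_le k l hk hkl hl
  have d1 : ∀ m : ℕ, |g m * e m| ≤ |g m| * E m := fun m => by
    rw [abs_mul]; exact mul_le_mul_of_nonneg_left (hee m) (abs_nonneg _)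
  have d2 : ∀ m : ℕ, |g m * E m| ≤ |g m| * E m := fun m => by
    rw [abs_mul, abs_of_nonneg (h.error_nonneg m)]
  have i1 := hg.integral_le_sum_Ico hkl
  have i2 := hg.sum_le_integral_Ico hkl
  have i3 := sum_Ico_telescope (f := fun m : ℕ => g m) hkl
  push_cast at i1 i3
  rw [Finset.sum_sub_distrib] at i3
  have gk := abs_le.1 (h.bound_const ⟨hk, hkl'.trans hl⟩)
  have gl := abs_le.1 (h.bound_const ⟨hk.trans hkl', hl⟩)
  have hsum : ∑ m ∈ Ico k l, α (m + 1) * g ((m : ℝ) + 1) =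
      κ * ∑ m ∈ Ico k l, g ((m : ℝ) + 1) +
        ∑ m ∈ Ico k l, g ((m : ℝ) + 1) * (e (m + 1) - e m) := by
    rw [Finset.mul_sum, ← Finset.sum_add_distrib]
    exact Finset.sum_congr rfl fun m _ => by rw [hα m]; ring
  rw [hsum]
  have f1 : |κ * ∑ m ∈ Ico k l, g ((m : ℝ) + 1) - κ * ∫ t in (k : ℝ)..l, g t| ≤
      2 * (cg * V) := by
    rw [← mul_sub, abs_mul]
    have : |∑ m ∈ Ico k l, g ((m : ℝ) + 1) - ∫ t in (k : ℝ)..l, g t| ≤ 2 * (cg * t₁ ^ a) := by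
      rw [abs_le]; constructor <;> linarith [gk.1, gl.2, gl.1, gk.2]
    calc _ ≤ |κ| * (2 * (cg * t₁ ^ a)) := by gcongr
      _ = 2 * (|κ| * (cg * t₁ ^ a)) := by ring
      _ ≤ _ := by linarith [h.main_bound]
  -- Two boundary terms for `e`, and the three terms that bound `∑ E(m) (g(m + 1) - g(m))`.
  have f2 : |∑ m ∈ Ico k l, g ((m : ℝ) + 1) * (e (m + 1) - e m)| ≤ 5 * (cg * V) := by
    rw [b1]
    have := abs_le.1 (d1 k); have := abs_le.1 (d1 l)
    have := abs_le.1 (d2 k); have := abs_le.1 (d2 l)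
    have := abs_le.1 c1
    rw [abs_le]; constructor <;> linarith
  have := abs_le.1 f1; have := abs_le.1 f2
  rw [abs_le]; constructor <;> linarith

theorem sum_Ico_sub_integral_le (h : PartialSummationData α κ E g a t₁ t₂ cg V)
    {k l : ℕ} (hk : t₁ ≤ k) (hkl : k ≤ l) (hl : (l : ℝ) ≤ t₂)
    (hg : MonotoneOn g (Set.Icc (k : ℝ) l) ∨ AntitoneOn g (Set.Icc (k : ℝ) l)) :
    |∑ m ∈ Ico k l, α (m + 1) * g ((m : ℝ) + 1) - κ * ∫ t in (k : ℝ)..l, g t| ≤ 7 * (cg * V) := by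
  rcases hg with hg | hg
  · exact h.sum_Ico_sub_integral_le_of_monotone hk hkl hl hg
  · have := h.neg.sum_Ico_sub_integral_le_of_monotone hk hkl hl hg.neg
    simp only [Pi.neg_apply, mul_neg, Finset.sum_neg_distrib, intervalIntegral.integral_neg,
      sub_neg_eq_add] at this
    rwa [← abs_neg, neg_sub, sub_eq_add_neg, add_comm]

theorem integral_bound (h : PartialSummationData α κ E g a t₁ t₂ cg V) {u v : ℝ}
    (hu : t₁ ≤ u) (huv : u ≤ v) (hv : v ≤ t₂) (h1 : v ≤ u + 1) :
    |κ * ∫ t in u..v, g t| ≤ cg * V := by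
  have h2 : ‖∫ t in u..v, g t‖ ≤ cg * t₁ ^ a * |v - u| := by
    refine intervalIntegral.norm_integral_le_of_norm_le_const fun x hx => ?_
    rw [Set.uIoc_of_le huv] at hx
    exact h.bound_const ⟨by linarith [hx.1], hx.2.trans hv⟩
  rw [abs_of_nonneg (sub_nonneg.2 huv), Real.norm_eq_abs] at h2
  have h0 : 0 ≤ cg * t₁ ^ a :=
    mul_nonneg h.bound_nonneg (Real.rpow_nonneg (by linarith [h.one_le]) _)
  have h3 : |∫ t in u..v, g t| ≤ cg * t₁ ^ a := h2.trans (mul_le_of_le_one_right h0 (by linarith))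
  rw [abs_mul]
  exact (mul_le_mul_of_nonneg_left h3 (abs_nonneg κ)).trans h.main_bound

/-- Partial summation on an open interval: a block between integers, the term at its first integer,
and two integrals over intervals of length at most `1`. -/
theorem sum_Ioo_sub_integral_le (h : PartialSummationData α κ E g a t₁ t₂ cg V) {u v : ℝ}
    (hint : MeasureTheory.IntegrableOn g (Set.Icc t₁ t₂))
    (hu : t₁ ≤ u) (huv : u ≤ v) (hv : v ≤ t₂)
    (hg : MonotoneOn g (Set.Ioo u v) ∨ AntitoneOn g (Set.Ioo u v))
    (s : Finset ℕ) (hs : ∀ m : ℕ, m ∈ s ↔ (m : ℝ) ∈ Set.Ioo u v) :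
    |∑ m ∈ s, α m * g m - κ * ∫ t in u..v, g t| ≤ 12 * (cg * V) := by
  have hu0 : 0 ≤ u := by linarith [h.one_le]
  have hcV : 0 ≤ cg * V := (by positivity : 0 ≤ |κ * ∫ t in u..u, g t|).trans
    (h.integral_bound hu le_rfl (huv.trans hv) (by linarith))
  have hii : ∀ x y : ℝ, u ≤ x → x ≤ y → y ≤ v →
      IntervalIntegrable g MeasureTheory.volume x y := fun x y hx hxy hy => by
    rw [intervalIntegrable_iff_integrableOn_Icc_of_le hxy]
    exact hint.mono_set (Set.Icc_subset_Icc (hu.trans hx) (hy.trans hv))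
  -- `k` is the first integer after `u`, and `l` below is the last integer before `v`.
  set k : ℕ := ⌊u⌋₊ + 1 with hkdef
  have hku : u < k := by rw [hkdef]; push_cast; exact Nat.lt_floor_add_one u
  have hku1 : (k : ℝ) ≤ u + 1 := by
    rw [hkdef]; push_cast; linarith [Nat.floor_le hu0]
  rcases le_or_gt v k with hvk | hvk
  · have : s = ∅ := by
      refine Finset.eq_empty_of_forall_notMem fun m hm => ?_
      have hm' := (hs m).1 hm
      have h1 : m < k := by exact_mod_cast hm'.2.trans_le hvk
      have h2 : ⌊u⌋₊ < m := (Nat.floor_lt hu0).2 hm'.1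
      omega
    rw [this, Finset.sum_empty, zero_sub, abs_neg]
    linarith [h.integral_bound hu huv hv (by linarith)]
  · set l : ℕ := ⌈v⌉₊ - 1 with hldef
    have hv0 : 0 < v := by linarith
    have hl1 : l + 1 = ⌈v⌉₊ := by
      have := Nat.ceil_pos.2 hv0; omega
    have hlv : (l : ℝ) < v := Nat.lt_ceil.1 (by omega)
    have hvl : v ≤ l + 1 := by
      have := Nat.le_ceil v
      rw [← hl1] at this; exact_mod_cast this
    have hkl : k ≤ l := by
      have := Nat.lt_ceil.2 hvk; omega
    have hkl' : (k : ℝ) ≤ l := by exact_mod_cast hkl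
    have hss : s = Finset.Icc k l := by
      ext m
      rw [hs m, Finset.mem_Icc, Set.mem_Ioo, ← Nat.floor_lt hu0, ← Nat.lt_ceil]
      omega
    have hsub : Set.Icc (k : ℝ) l ⊆ Set.Ioo u v :=
      fun x hx => ⟨hku.trans_le hx.1, hx.2.trans_lt hlv⟩
    have hblock := h.sum_Ico_sub_integral_le (hu.trans hku.le) hkl (hlv.le.trans hv)
      (hg.imp (fun h => h.mono hsub) (fun h => h.mono hsub))
    have hsum : ∑ m ∈ s, α m * g m =
        α k * g k + ∑ m ∈ Ico k l, α (m + 1) * g ((m : ℝ) + 1) := by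
      rw [hss, ← Finset.Ico_add_one_right_eq_Icc, Finset.sum_eq_sum_Ico_succ_bot (by omega)]
      congr 1
      rw [← Finset.sum_Ico_add' (fun m : ℕ => α m * g m) k l 1]
      push_cast; rfl
    have hsplit : ∫ t in u..v, g t =
        (∫ t in u..k, g t) + (∫ t in (k : ℝ)..l, g t) + ∫ t in (l : ℝ)..v, g t := by
      rw [intervalIntegral.integral_add_adjacent_intervals (hii _ _ le_rfl hku.le (by linarith))
        (hii _ _ hku.le hkl' hlv.le), intervalIntegral.integral_add_adjacent_intervals
        (hii _ _ le_rfl (by linarith) hlv.le) (hii _ _ (by linarith) hlv.le le_rfl)]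
    have p1 := abs_le.1 (h.integral_bound hu hku.le (by linarith) hku1)
    have p2 := abs_le.1 (h.integral_bound (by linarith) hlv.le hv hvl)
    have p3 := abs_le.1 (h.term_le (hu.trans hku.le) (by linarith))
    have p4 := abs_le.1 hblock
    rw [hsum, hsplit, abs_le]
    constructor <;> linarith

/-- Partial summation on an interval of any kind; it has at most two endpoints more than an open
one. These are bounded term by term, since `g` is controlled there only by its size. -/
theorem sum_piece_sub_integral_le (h : PartialSummationData α κ E g a t₁ t₂ cg V) {I : Set ℝ}
    (hint : MeasureTheory.IntegrableOn g (Set.Icc t₁ t₂)) (hI : I ⊆ Set.Icc t₁ t₂)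
    (hne : I.Nonempty) (hoc : I.OrdConnected)
    (hg : MonotoneOn g (interior I) ∨ AntitoneOn g (interior I))
    (s : Finset ℕ) (hs : ∀ m : ℕ, m ∈ s ↔ (m : ℝ) ∈ I) :
    |∑ m ∈ s, α m * g m - κ * ∫ t in I, g t| ≤ 18 * (cg * V) := by
  classical
  have hba : BddAbove I := bddAbove_Icc.mono hI
  have hbb : BddBelow I := bddBelow_Icc.mono hI
  set u := sInf I with hu
  set v := sSup I with hv
  have hIuv : I ⊆ Set.Icc u v := fun x hx => ⟨csInf_le hbb hx, le_csSup hba hx⟩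
  have huv : u ≤ v := csInf_le_csSup hne hbb hba
  have ht1u : t₁ ≤ u := le_csInf hne fun x hx => (hI hx).1
  have hvt2 : v ≤ t₂ := csSup_le hne fun x hx => (hI hx).2
  have hIoo : Set.Ioo u v ⊆ I := fun x hx => by
    obtain ⟨y, hy, hyx⟩ := (csInf_lt_iff hbb hne).1 hx.1
    obtain ⟨z, hz, hxz⟩ := (lt_csSup_iff hba hne).1 hx.2
    exact hoc.out hy hz ⟨hyx.le, hxz.le⟩
  have hIoo' : Set.Ioo u v ⊆ interior I := interior_maximal hIoo isOpen_Ioo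
  have hae : ∫ t in I, g t = ∫ t in u..v, g t := by
    rw [intervalIntegral.integral_of_le huv, MeasureTheory.integral_Ioc_eq_integral_Ioo]
    have h1 : I =ᵐ[MeasureTheory.volume] Set.Ioo u v := by
      refine Filter.EventuallyLE.antisymm ?_ hIoo.eventuallyLE
      exact hIuv.eventuallyLE.trans MeasureTheory.Ioo_ae_eq_Icc.symm.le
    exact MeasureTheory.setIntegral_congr_set h1
  have hmain := h.sum_Ioo_sub_integral_le hint ht1u huv hvt2
    (hg.imp (fun h => h.mono hIoo') (fun h => h.mono hIoo'))
    (s.filter fun m : ℕ => (m : ℝ) ∈ Set.Ioo u v) (fun m => by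
      rw [Finset.mem_filter, hs m]; exact ⟨fun h => h.2, fun h => ⟨hIoo h, h⟩⟩)
  have hcV : 0 ≤ cg * V := by linarith [abs_nonneg (∑ m ∈ s.filter fun m : ℕ => (m : ℝ) ∈
    Set.Ioo u v, α m * g m - κ * ∫ t in u..v, g t)]
  have hrest : |∑ m ∈ s.filter fun m : ℕ => ¬ (m : ℝ) ∈ Set.Ioo u v, α m * g m| ≤
      6 * (cg * V) := by
    have hcard : (s.filter fun m : ℕ => ¬ (m : ℝ) ∈ Set.Ioo u v).card ≤ 2 := by
      refine (Finset.card_le_card_of_injOn (t := ({u, v} : Finset ℝ)) (fun m : ℕ => (m : ℝ))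
        (fun m hm => ?_) (Nat.cast_injective.injOn)).trans Finset.card_le_two
      have hm' := Finset.mem_filter.1 (Finset.mem_coe.1 hm)
      have h1 := hIuv ((hs m).1 hm'.1)
      have h2 := hm'.2
      simp only [Set.mem_Ioo, not_and_or, not_lt] at h2
      simp only [Finset.coe_insert, Finset.coe_singleton, Set.mem_insert_iff,
        Set.mem_singleton_iff]
      rcases h2 with h2 | h2
      · exact Or.inl (le_antisymm h2 h1.1)
      · exact Or.inr (le_antisymm h1.2 h2)
    refine (Finset.abs_sum_le_sum_abs _ _).trans ?_
    refine (Finset.sum_le_card_nsmul _ _ (3 * (cg * V)) fun m hm => ?_).trans ?_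
    · have h1 := hI ((hs m).1 (Finset.mem_filter.1 hm).1)
      exact h.term_le h1.1 h1.2
    · rw [nsmul_eq_mul]
      have : ((s.filter fun m : ℕ => ¬ (m : ℝ) ∈ Set.Ioo u v).card : ℝ) ≤ 2 := by
        exact_mod_cast hcard
      nlinarith
  rw [hae, ← Finset.sum_filter_add_sum_filter_not s (fun m : ℕ => (m : ℝ) ∈ Set.Ioo u v)]
  have := abs_le.1 hmain; have := abs_le.1 hrest
  rw [abs_le]; constructor <;> linarith

end PartialSummationData

/-- Integrability needs no more than boundedness and continuity in the interiors of the pieces, as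
the frontier of an interval is a null set. -/
theorem PiecewiseMonotone.integrableOn {g : ℝ → ℝ} {t₁ t₂ B : ℝ} {R : ℕ}
    (hg : PiecewiseMonotone g t₁ t₂ R) (hB : ∀ t ∈ Set.Icc t₁ t₂, |g t| ≤ B) :
    MeasureTheory.IntegrableOn g (Set.Icc t₁ t₂) := by
  obtain ⟨P, -, -, hU, hP⟩ := hg
  rw [← hU, Set.sUnion_eq_biUnion]
  refine (MeasureTheory.integrableOn_finset_iUnion (s := P) (t := fun I => I)).2 fun I hI => ?_
  obtain ⟨-, hoc, hC, -⟩ := hP I hI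
  have hsub : I ⊆ Set.Icc t₁ t₂ := hU ▸ Set.subset_sUnion_of_mem (Finset.mem_coe.2 hI)
  have hae : (I : Set ℝ) =ᵐ[MeasureTheory.volume] interior I :=
    (interior_ae_eq_of_null_frontier (hoc.convex.addHaar_frontier _)).symm
  refine MeasureTheory.IntegrableOn.congr_set_ae ?_ hae
  refine ⟨hC.continuousOn.aestronglyMeasurable isOpen_interior.measurableSet,
    .restrict_of_bounded (C := B) ?_ ?_⟩
  · exact (MeasureTheory.measure_mono (interior_subset.trans hsub)).trans_lt measure_Icc_lt_top
  · exact (MeasureTheory.ae_restrict_iff' isOpen_interior.measurableSet).2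
      (Filter.Eventually.of_forall fun t ht => hB t (hsub (interior_subset ht)))

/-- Partial summation against a piecewise monotone function. -/
theorem PiecewiseMonotone.sum_sub_integral_le {α : ℕ → ℝ} {κ : ℝ} {E : ℕ → ℝ} {g : ℝ → ℝ}
    {a t₁ t₂ cg V : ℝ} {R : ℕ} (hg : PiecewiseMonotone g t₁ t₂ R) (ht : t₁ ≤ t₂)
    (h : PartialSummationData α κ E g a t₁ t₂ cg V) {T : Set ℝ}
    (hT : T = Set.Ioc t₁ t₂ ∨ T = Set.Icc t₁ t₂)
    (s : Finset ℕ) (hs : ∀ m : ℕ, m ∈ s ↔ (m : ℝ) ∈ T) :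
    |∑ m ∈ s, α m * g m - κ * ∫ t in t₁..t₂, g t| ≤ 21 * (R * (cg * V)) := by
  classical
  have hint := hg.integrableOn (fun t ht => h.bound_const ht)
  obtain ⟨P, hPR, hdisj, hU, hP⟩ := hg
  have hcV : 0 ≤ cg * V := (abs_nonneg _).trans (h.integral_bound le_rfl le_rfl ht (by linarith))
  have hmem : ∀ t : ℝ, t ∈ Set.Icc t₁ t₂ ↔ ∃ I ∈ P, t ∈ I := fun t => by
    rw [← hU]; simp
  have hsub : ∀ I ∈ P, I ⊆ Set.Icc t₁ t₂ := fun I hI t htI => (hmem t).2 ⟨I, hI, htI⟩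
  set s' : Finset ℕ := Finset.Icc ⌈t₁⌉₊ ⌊t₂⌋₊ with hs'def
  have hs' : ∀ m : ℕ, m ∈ s' ↔ (m : ℝ) ∈ Set.Icc t₁ t₂ := fun m => by
    rw [hs'def, Finset.mem_Icc, Nat.ceil_le, Nat.le_floor_iff (by linarith [h.one_le]), Set.mem_Icc]
  have hs'P : s' = P.biUnion fun I => s'.filter fun m : ℕ => (m : ℝ) ∈ I := by
    ext m
    simp only [Finset.mem_biUnion, Finset.mem_filter]
    constructor
    · intro hm
      obtain ⟨I, hI, hmI⟩ := (hmem m).1 ((hs' m).1 hm)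
      exact ⟨I, hI, hm, hmI⟩
    · rintro ⟨I, -, hm, -⟩; exact hm
  have hsum : ∑ m ∈ s', α m * g m =
      ∑ I ∈ P, ∑ m ∈ s'.filter (fun m : ℕ => (m : ℝ) ∈ I), α m * g m := by
    conv_lhs => rw [hs'P]
    refine Finset.sum_biUnion fun I hI I' hI' hne => ?_
    rw [Function.onFun, Finset.disjoint_left]
    intro m hm hm'
    exact Set.disjoint_left.1 (hdisj hI hI' hne) (Finset.mem_filter.1 hm).2
      (Finset.mem_filter.1 hm').2
  have hintsum : ∫ t in t₁..t₂, g t = ∑ I ∈ P, ∫ t in I, g t := by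
    rw [intervalIntegral.integral_of_le ht, ← MeasureTheory.integral_Icc_eq_integral_Ioc, ← hU,
      Set.sUnion_eq_biUnion]
    exact MeasureTheory.integral_biUnion_finset P (fun I hI => (hP I hI).2.1.measurableSet) hdisj
      (fun I hI => hint.mono_set (hsub I hI))
  have hfull : |∑ m ∈ s', α m * g m - κ * ∫ t in t₁..t₂, g t| ≤ P.card * (18 * (cg * V)) := by
    rw [hsum, hintsum, Finset.mul_sum, ← Finset.sum_sub_distrib, ← nsmul_eq_mul]
    refine (Finset.abs_sum_le_sum_abs _ _).trans (Finset.sum_le_card_nsmul _ _ _ fun I hI => ?_)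
    obtain ⟨hne, hoc, -, hmono⟩ := hP I hI
    refine h.sum_piece_sub_integral_le hint (hsub I hI) hne hoc hmono _ fun m => ?_
    rw [Finset.mem_filter, hs' m]
    exact ⟨fun h => h.2, fun h => ⟨hsub I hI h, h⟩⟩
  -- As `[t₁, t₂]` is nonempty, `R ≥ 1`, so the extra term is also absorbed by a multiple of `R`.
  have hR1 : 1 ≤ R := by
    obtain ⟨I, hI, -⟩ := (hmem t₁).1 ⟨le_rfl, ht⟩
    exact (Finset.card_pos.2 ⟨I, hI⟩).trans_le hPR
  have hPR' : (P.card : ℝ) ≤ R := by exact_mod_cast hPR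
  have hR1' : (1 : ℝ) ≤ R := by exact_mod_cast hR1
  have hss' : s ⊆ s' := fun m hm => (hs' m).2 (by
    rcases hT with rfl | rfl
    · exact Set.Ioc_subset_Icc_self ((hs m).1 hm)
    · exact (hs m).1 hm)
  -- The two choices of `T` differ only in the point `t₁`.
  have hrest : |∑ m ∈ s' \ s, α m * g m| ≤ 3 * (cg * V) := by
    have hcard : (s' \ s).card ≤ 1 := by
      rw [Finset.card_le_one]
      have key : ∀ m ∈ s' \ s, (m : ℝ) = t₁ := fun m hm => by
        obtain ⟨h1, h2⟩ := Finset.mem_sdiff.1 hm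
        rw [hs' m] at h1
        rw [hs m] at h2
        rcases hT with rfl | rfl
        · by_contra hne
          exact h2 ⟨lt_of_le_of_ne h1.1 (Ne.symm hne), h1.2⟩
        · exact absurd h1 h2
      intro m hm m' hm'
      exact_mod_cast (key m hm).trans (key m' hm').symm
    refine (Finset.abs_sum_le_sum_abs _ _).trans ?_
    refine (Finset.sum_le_card_nsmul _ _ (3 * (cg * V)) fun m hm => ?_).trans ?_
    · have h1 := (hs' m).1 (Finset.mem_sdiff.1 hm).1
      exact h.term_le h1.1 h1.2
    · rw [nsmul_eq_mul]
      have : ((s' \ s).card : ℝ) ≤ 1 := by exact_mod_cast hcard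
      exact mul_le_of_le_one_left (by linarith) this
  have hdiff := Finset.sum_sdiff (f := fun m : ℕ => α m * g m) hss'
  have e : ∑ m ∈ s, α m * g m = ∑ m ∈ s', α m * g m - ∑ m ∈ s' \ s, α m * g m := by linarith
  have q1 : (P.card : ℝ) * (18 * (cg * V)) ≤ R * (18 * (cg * V)) := by gcongr
  have q2 : 1 * (cg * V) ≤ R * (cg * V) := by gcongr
  have := abs_le.1 hfull; have := abs_le.1 hrest
  rw [e, abs_le]; constructor <;> linarith

end

/-! ### Möbius inversion over ideals -/

section

open NumberField

section MoebiusInversion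

variable {K : Type*} [Field K] [NumberField K]

theorem absNorm_le_of_dvd {𝔞 𝔟 : Ideal (𝓞 K)} (h𝔞 : 𝔞 ≠ ⊥) (h : 𝔟 ∣ 𝔞) :
    Ideal.absNorm 𝔟 ≤ Ideal.absNorm 𝔞 :=
  Nat.le_of_dvd (Nat.pos_of_ne_zero (Ideal.absNorm_eq_zero_iff.not.2 h𝔞)) (map_dvd _ h)

theorem finite_setOf_dvd {𝔞 : Ideal (𝓞 K)} (h𝔞 : 𝔞 ≠ ⊥) : {𝔟 : Ideal (𝓞 K) | 𝔟 ∣ 𝔞}.Finite :=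
  (Ideal.finite_setOfPred_absNorm_le _).subset fun _ hb => absNorm_le_of_dvd h𝔞 hb

/-- The finite set of divisors of a nonzero ideal (junk value `∅` for the zero ideal). -/
noncomputable def idealDivisors (𝔞 : Ideal (𝓞 K)) : Finset (Ideal (𝓞 K)) :=
  open Classical in
  if h : 𝔞 ≠ ⊥ then (finite_setOf_dvd h).toFinset else ∅

theorem mem_idealDivisors {𝔞 𝔟 : Ideal (𝓞 K)} (h𝔞 : 𝔞 ≠ ⊥) : 𝔟 ∈ idealDivisors 𝔞 ↔ 𝔟 ∣ 𝔞 := by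
  rw [idealDivisors, dif_pos h𝔞, Set.Finite.mem_toFinset, Set.mem_ofPred_eq]

/-- Agreement with Mathlib's Möbius function of a unique factorization monoid. -/
theorem moebius_eq_coe (𝔞 : Ideal (𝓞 K)) :
    moebius 𝔞 = (UniqueFactorizationMonoid.moebius 𝔞 : ℤ) := by
  by_cases h : Squarefree 𝔞
  · rw [moebius, if_pos h, h.moebius_eq, UniqueFactorizationMonoid.normalizedFactors]
    simp
  · rw [moebius, if_neg h, UniqueFactorizationMonoid.moebius_of_not_squarefree h]
    simp

theorem moebius_one : moebius (1 : Ideal (𝓞 K)) = 1 := by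
  rw [moebius_eq_coe, UniqueFactorizationMonoid.moebius_one]; simp

theorem moebius_prime_mul {𝔭 𝔡 : Ideal (𝓞 K)} (h𝔭 : Prime 𝔭) (h : ¬ 𝔭 ∣ 𝔡) :
    moebius (𝔭 * 𝔡) = -moebius 𝔡 := by
  have hrel : IsRelPrime 𝔭 𝔡 := h𝔭.irreducible.isRelPrime_iff_not_dvd.2 h
  rw [moebius_eq_coe, moebius_eq_coe, hrel.moebius_mul, h𝔭.irreducible.moebius_eq]
  simp

/-- Fix a prime `𝔭 ∣ 𝔞`. Among the squarefree divisors, `𝔡 ↦ 𝔭 𝔡` pairs those not divisible by `𝔭`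
with those divisible by `𝔭`, and the two members of a pair cancel. -/
theorem sum_moebius_idealDivisors {𝔞 : Ideal (𝓞 K)} (h𝔞 : 𝔞 ≠ ⊥) (h1 : 𝔞 ≠ 1) :
    ∑ 𝔡 ∈ idealDivisors 𝔞, moebius 𝔡 = 0 := by
  classical
  have hu : ¬ IsUnit 𝔞 := fun h => h1 (isUnit_iff_eq_one.1 h)
  obtain ⟨𝔭, hirr, h𝔭𝔞⟩ := WfDvdMonoid.exists_irreducible_factor hu h𝔞
  have h𝔭 : Prime 𝔭 := hirr.prime
  rw [← Finset.sum_filter_add_sum_filter_not _ (fun 𝔡 => Squarefree 𝔡)]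
  have hz : ∑ 𝔡 ∈ (idealDivisors 𝔞).filter (fun 𝔡 => ¬ Squarefree 𝔡), moebius 𝔡 = 0 :=
    Finset.sum_eq_zero fun 𝔡 h𝔡 => by rw [moebius, if_neg (Finset.mem_filter.1 h𝔡).2]
  rw [hz, add_zero, ← Finset.sum_filter_add_sum_filter_not _ (fun 𝔡 => 𝔭 ∣ 𝔡)]
  have key : ∑ 𝔡 ∈ ((idealDivisors 𝔞).filter Squarefree).filter (fun 𝔡 => ¬ 𝔭 ∣ 𝔡), -moebius 𝔡 =
      ∑ 𝔡 ∈ ((idealDivisors 𝔞).filter Squarefree).filter (fun 𝔡 => 𝔭 ∣ 𝔡), moebius 𝔡 := by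
    refine Finset.sum_bij (fun 𝔡 _ => 𝔭 * 𝔡) ?_ ?_ ?_ ?_
    · intro 𝔡 h
      simp only [Finset.mem_filter, mem_idealDivisors h𝔞] at h ⊢
      obtain ⟨⟨hd, hsq⟩, hnd⟩ := h
      have hrel : IsRelPrime 𝔭 𝔡 := h𝔭.irreducible.isRelPrime_iff_not_dvd.2 hnd
      exact ⟨⟨hrel.mul_dvd h𝔭𝔞 hd, squarefree_mul_iff.2 ⟨hrel, hirr.squarefree, hsq⟩⟩,
        dvd_mul_right _ _⟩
    · intro 𝔡 _ 𝔡' _ h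
      exact mul_left_cancel₀ h𝔭.ne_zero h
    · intro 𝔡 h
      simp only [Finset.mem_filter, mem_idealDivisors h𝔞] at h
      obtain ⟨⟨hd, hsq⟩, 𝔢, rfl⟩ := h
      refine ⟨𝔢, ?_, rfl⟩
      simp only [Finset.mem_filter, mem_idealDivisors h𝔞]
      refine ⟨⟨(dvd_mul_left _ _).trans hd, hsq.of_mul_right⟩, fun h => ?_⟩
      exact hirr.not_isUnit (hsq 𝔭 (mul_dvd_mul_left 𝔭 h))
    · intro 𝔡 h
      exact (moebius_prime_mul h𝔭 (Finset.mem_filter.1 h).2).symm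
  rw [← key, Finset.sum_neg_distrib, neg_add_cancel]

/-- Möbius inversion: `ϑ = (ϑ * μ_K) * 1`. -/
theorem sum_convMoebius_idealDivisors (ϑ : Ideal (𝓞 K) → ℝ) {𝔞 : Ideal (𝓞 K)} (h𝔞 : 𝔞 ≠ ⊥) :
    ∑ 𝔟 ∈ idealDivisors 𝔞, convMoebius ϑ 𝔟 = ϑ 𝔞 := by
  classical
  set D := idealDivisors 𝔞 with hD
  have hmem : ∀ 𝔟, 𝔟 ∈ D ↔ 𝔟 ∣ 𝔞 := fun 𝔟 => mem_idealDivisors h𝔞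
  set P := (D ×ˢ D).filter fun p => p.1 * p.2 ∣ 𝔞 with hP
  have hconv : ∀ 𝔟 ∈ D, convMoebius ϑ 𝔟 =
      ∑ p ∈ P.filter (fun p => p.1 * p.2 = 𝔟), ϑ p.1 * moebius p.2 := by
    intro 𝔟 h𝔟
    rw [convMoebius, ← finsum_mem_coe_finset]
    refine finsum_mem_congr ?_ fun _ _ => rfl
    ext p
    simp only [hP, Set.mem_ofPred_eq, Finset.coe_filter, Finset.mem_filter, Finset.mem_product,
      hmem]
    constructor
    · rintro rfl
      have h := (hmem _).1 h𝔟
      exact ⟨⟨⟨(dvd_mul_right _ _).trans h, (dvd_mul_left _ _).trans h⟩, h⟩, rfl⟩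
    · rintro ⟨-, h⟩; exact h
  rw [Finset.sum_congr rfl hconv, Finset.sum_fiberwise_of_maps_to
    (fun p hp => (hmem _).2 (Finset.mem_filter.1 hp).2), Finset.sum_filter,
    Finset.sum_product]
  -- The sum is over pairs `(𝔡, 𝔢)` with `𝔡 𝔢 ∣ 𝔞`; summing over `𝔢` first, only `𝔡 = 𝔞` survives.
  rw [Finset.sum_eq_single 𝔞]
  · rw [Finset.sum_eq_single 1]
    · rw [mul_one, if_pos dvd_rfl, moebius_one, mul_one]
    · intro 𝔢 _ hne
      rw [if_neg]
      intro h
      have : 𝔞 * 𝔢 ∣ 𝔞 * 1 := by rwa [mul_one]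
      exact hne (isUnit_iff_eq_one.1 (isUnit_of_dvd_one ((mul_dvd_mul_iff_left h𝔞).1 this)))
    · intro h; exact absurd ((hmem 1).2 (one_dvd _)) h
  · intro 𝔡 h𝔡 hne
    obtain ⟨𝔠, h𝔠⟩ := (hmem 𝔡).1 h𝔡
    have h𝔡0 : 𝔡 ≠ 0 := fun h => h𝔞 (by rw [h𝔠, h, zero_mul]; rfl)
    have h𝔠0 : 𝔠 ≠ ⊥ := fun h => h𝔞 (by rw [h𝔠, h]; exact mul_zero 𝔡)
    have h𝔠1 : 𝔠 ≠ 1 := fun h => hne (by rw [h𝔠, h, mul_one])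
    rw [← Finset.sum_filter]
    dsimp only
    rw [← Finset.mul_sum]
    have : D.filter (fun 𝔢 => 𝔡 * 𝔢 ∣ 𝔞) = idealDivisors 𝔠 := by
      ext 𝔢
      rw [Finset.mem_filter, hmem, mem_idealDivisors h𝔠0, h𝔠, mul_dvd_mul_iff_left h𝔡0]
      exact ⟨fun h => h.2, fun h => ⟨h.mul_left _, h⟩⟩
    rw [this, sum_moebius_idealDivisors h𝔠0 h𝔠1, mul_zero]
  · intro h; exact absurd ((hmem 𝔞).2 dvd_rfl) h

end MoebiusInversion

end

/-! ### Lattice points in cosets of fractional ideals -/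

section

open MeasureTheory

section LatticePoints

open scoped Classical in
/-- Comparison of the number of points of a translated lattice in a ball with volumes of balls,
by attaching to each lattice point a translate of a fundamental domain. -/
theorem lattice_coset_ball_volume {E ι : Type*} [NormedAddCommGroup E] [NormedSpace ℝ E]
    [FiniteDimensional ℝ E] [MeasurableSpace E] [BorelSpace E] (μ : Measure E)
    [μ.IsAddHaarMeasure] [Finite ι] (b : Module.Basis ι ℝ E) {d : ℝ}
    (hd : ∀ x ∈ ZSpan.fundamentalDomain b, ‖x‖ ≤ d) (x₀ : E) (r : ℝ) :
    {x : E | x - x₀ ∈ Submodule.span ℤ (Set.range b) ∧ ‖x‖ ≤ r}.Finite ∧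
    (({x : E | x - x₀ ∈ Submodule.span ℤ (Set.range b) ∧ ‖x‖ ≤ r}.ncard : ENNReal) *
        μ (ZSpan.fundamentalDomain b) ≤ μ (Metric.closedBall 0 (r + d))) ∧
    (μ (Metric.ball 0 (r - d)) ≤
      {x : E | x - x₀ ∈ Submodule.span ℤ (Set.range b) ∧ ‖x‖ ≤ r}.ncard *
        μ (ZSpan.fundamentalDomain b)) := by
  have : Fintype ι := Fintype.ofFinite ι
  set F := ZSpan.fundamentalDomain b with hF
  set S := {x : E | x - x₀ ∈ Submodule.span ℤ (Set.range b) ∧ ‖x‖ ≤ r} with hS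
  have hFm : MeasurableSet F := ZSpan.fundamentalDomain_measurableSet b
  have hfin : S.Finite := by
    have h1 := ZSpan.setFinite_inter b (Metric.isBounded_closedBall (x := -x₀) (r := r))
    refine (h1.image (fun x => x + x₀)).subset fun x hx => ⟨x - x₀, ⟨?_, hx.1⟩, by simp⟩
    rw [Metric.mem_closedBall, dist_eq_norm]
    simpa using hx.2
  have hmeas : ∀ x : E, μ ((fun y => x + y) '' F) = μ F := fun x => by
    rw [Set.image_add_left, measure_preimage_add]
  have hmeasS : ∀ x : E, MeasurableSet ((fun y => x + y) '' F) := fun x => by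
    rw [Set.image_add_left]; exact (measurable_const_add _) hFm
  have hsum : ∑ x ∈ hfin.toFinset, μ ((fun y => x + y) '' F) = S.ncard * μ F := by
    rw [Finset.sum_congr rfl fun x _ => hmeas x, Finset.sum_const, nsmul_eq_mul,
      Set.ncard_eq_toFinset_card S hfin]
  refine ⟨hfin, ?_, ?_⟩
  · rw [← hsum, ← measure_biUnion_finset ?_ fun x _ => hmeasS x]
    · refine measure_mono (Set.iUnion₂_subset fun x hx => ?_)
      rintro _ ⟨y, hy, rfl⟩
      rw [Set.Finite.mem_toFinset] at hx
      rw [mem_closedBall_zero_iff]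
      exact (norm_add_le _ _).trans (add_le_add hx.2 (hd y hy))
    · intro x hx x' hx' hne
      rw [Function.onFun, Set.disjoint_left]
      rintro _ ⟨y, hy, rfl⟩ ⟨y', hy', h⟩
      apply hne
      rw [Finset.mem_coe, Set.Finite.mem_toFinset] at hx hx'
      have h1 : ZSpan.fract b y = ZSpan.fract b y' := by
        rw [ZSpan.fract_eq_fract]
        have : -y + y' = (x - x₀) - (x' - x₀) := by
          have : x' + y' = x + y := h
          rw [sub_sub_sub_cancel_right, sub_eq_iff_eq_add.2]
          rw [show -y + y' + x' = -y + (x' + y') by abel, this]; abel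
        rw [this]
        exact sub_mem hx.1 hx'.1
      rw [ZSpan.fract_eq_self.2 hy, ZSpan.fract_eq_self.2 hy'] at h1
      have h2 : x' + y' = x + y := h
      rw [h1] at h2
      exact (add_right_cancel h2).symm
  · rw [← hsum]
    refine (measure_mono fun y hy => ?_).trans (measure_biUnion_finset_le hfin.toFinset _)
    rw [mem_ball_zero_iff] at hy
    have hfr := ZSpan.fract_mem_fundamentalDomain b (y - x₀)
    have hx : y - ZSpan.fract b (y - x₀) ∈ S := by
      refine ⟨?_, ?_⟩
      · rw [ZSpan.fract_apply, show y - (y - x₀ - (ZSpan.floor b (y - x₀) : E)) - x₀ =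
          (ZSpan.floor b (y - x₀) : E) by abel]
        exact SetLike.coe_mem _
      · have := norm_sub_le y (ZSpan.fract b (y - x₀))
        linarith [hd _ hfr]
    exact Set.mem_biUnion (by simpa using hx) ⟨_, hfr, by simp⟩

end LatticePoints

section ImaginaryQuadratic

open NumberField NumberField.InfinitePlace NumberField.mixedEmbedding

variable {K : Type*} [Field K] [NumberField K]

theorem nrComplexPlaces_eq_one (hdeg : Module.finrank ℚ K = 2) (him : IsTotallyComplex K) :
    nrComplexPlaces K = 1 := by
  have := IsTotallyComplex.finrank (K := K)
  omega

theorem exists_forall_place_eq (hdeg : Module.finrank ℚ K = 2) (him : IsTotallyComplex K) :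
    ∃ w₀ : InfinitePlace K, ∀ w, w = w₀ := by
  have h1 := nrComplexPlaces_eq_one hdeg him
  have h0 := IsTotallyComplex.nrRealPlaces_eq_zero K
  have h2 := card_eq_nrRealPlaces_add_nrComplexPlaces K
  rw [h0, h1] at h2
  obtain ⟨w, hw⟩ := Fintype.card_eq_one_iff.1 h2
  exact ⟨w, hw⟩

open scoped Classical in
/-- With a single complex place, the mixed space is `ℂ` and the norm of an element is its squared
absolute value. -/
theorem norm_mixedEmbedding_sq (hdeg : Module.finrank ℚ K = 2) (him : IsTotallyComplex K) (z : K) :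
    ‖mixedEmbedding K z‖ ^ 2 = |((Algebra.norm ℚ z : ℚ) : ℝ)| := by
  obtain ⟨w₀, hw₀⟩ := exists_forall_place_eq hdeg him
  have huniv : (Finset.univ : Finset (InfinitePlace K)) = {w₀} := by
    ext w; simp [hw₀ w]
  have h1 : ‖mixedEmbedding K z‖ = w₀ z := by
    rw [norm_eq_sup'_normAtPlace]
    simp_rw [normAtPlace_apply]
    apply le_antisymm
    · exact Finset.sup'_le _ _ fun w _ => by rw [hw₀ w]
    · exact Finset.le_sup' (fun w : InfinitePlace K => w z) (Finset.mem_univ w₀)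
  have h2 := prod_eq_abs_norm z
  rw [huniv, Finset.prod_singleton, mult_isComplex ⟨w₀, him.isComplex w₀⟩] at h2
  rw [h1, h2]
  simp

open scoped Classical in
theorem volume_ball_mixedSpace (hdeg : Module.finrank ℚ K = 2) (him : IsTotallyComplex K)
    {r : ℝ} (hr : 0 ≤ r) :
    volume (Metric.ball (0 : mixedSpace K) r) = ENNReal.ofReal (Real.pi * r ^ 2) := by
  rcases hr.eq_or_lt with rfl | hr'
  · simp
  obtain ⟨w₀, hw₀⟩ := exists_forall_place_eq hdeg him
  have huniv : (Finset.univ : Finset (InfinitePlace K)) = {w₀} := by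
    ext w; simp [hw₀ w]
  have h := convexBodyLT_volume K (fun _ => NNReal.mk r hr)
  rw [huniv, Finset.prod_singleton, mult_isComplex ⟨w₀, him.isComplex w₀⟩, convexBodyLTFactor,
    nrComplexPlaces_eq_one hdeg him, IsTotallyComplex.nrRealPlaces_eq_zero K] at h
  have hb : Metric.ball (0 : mixedSpace K) r = convexBodyLT K (fun _ => NNReal.mk r hr) := by
    ext x
    rw [mem_ball_zero_iff, Prod.norm_def, max_lt_iff, pi_norm_lt_iff hr', pi_norm_lt_iff hr']
    simp only [convexBodyLT, Set.mem_prod, Set.mem_pi, Set.mem_univ, forall_true_left,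
      mem_ball_zero_iff]
    rfl
  rw [hb, h, ENNReal.ofReal_mul Real.pi_pos.le, ENNReal.ofReal_pow hr]
  simp only [pow_zero, pow_one, one_mul]
  congr 1
  · rw [← NNReal.coe_real_pi, ENNReal.ofReal_coe_nnreal]
  · rw [ENNReal.ofReal, Real.toNNReal_of_nonneg hr, ENNReal.coe_pow]

open scoped Classical in
theorem volume_closedBall_mixedSpace (hdeg : Module.finrank ℚ K = 2) (him : IsTotallyComplex K)
    {r : ℝ} (hr : 0 ≤ r) :
    volume (Metric.closedBall (0 : mixedSpace K) r) = ENNReal.ofReal (Real.pi * r ^ 2) := by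
  rw [← volume_ball_mixedSpace hdeg him hr]
  exact Measure.addHaar_closedBall_eq_addHaar_ball _ 0 r

open scoped Classical in
/-- The covolume of a fractional ideal. The factor `1 / 2` reflects that the volume on `ℂ` is the
Lebesgue measure. -/
theorem volume_fundamentalDomain_eq (hdeg : Module.finrank ℚ K = 2) (him : IsTotallyComplex K)
    (I : (FractionalIdeal (𝓞 K)⁰ K)ˣ) :
    volume (ZSpan.fundamentalDomain (fractionalIdealLatticeBasis K I)) =
      ENNReal.ofReal ((FractionalIdeal.absNorm I.1 : ℚ) * (√|(discr K : ℝ)| / 2)) := by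
  rw [volume_fundamentalDomain_fractionalIdealLatticeBasis, volume_fundamentalDomain_latticeBasis,
    nrComplexPlaces_eq_one hdeg him, ENNReal.ofReal_mul
    (by exact_mod_cast FractionalIdeal.absNorm_nonneg I.1)]
  congr 1
  rw [pow_one, div_eq_inv_mul, ENNReal.ofReal_mul (by norm_num)]
  congr 1
  · rw [ENNReal.ofReal_inv_of_pos (by norm_num)]; norm_num
  · rw [← ENNReal.ofReal_coe_nnreal]
    congr 1
    simp [Int.norm_eq_abs]

theorem absNorm_pos (I : (FractionalIdeal (𝓞 K)⁰ K)ˣ) :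
    (0 : ℝ) < (FractionalIdeal.absNorm I.1 : ℚ) := by
  have h1 := FractionalIdeal.absNorm_nonneg I.1
  have h2 : FractionalIdeal.absNorm I.1 ≠ 0 :=
    FractionalIdeal.absNorm_eq_zero_iff.not.2 I.ne_zero
  exact_mod_cast lt_of_le_of_ne h1 h2.symm

theorem sqrt_abs_discr_pos : 0 < √|(discr K : ℝ)| :=
  Real.sqrt_pos.2 (abs_pos.2 (by exact_mod_cast discr_ne_zero K))

/-- Lattice points of norm at most `T` in a coset of a fixed fractional ideal. -/
theorem exists_card_coset_sub_le (hdeg : Module.finrank ℚ K = 2) (him : IsTotallyComplex K)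
    (I : (FractionalIdeal (𝓞 K)⁰ K)ˣ) :
    ∃ M : ℝ, 0 < M ∧ ∀ (x₀ : K) (T : ℝ), 0 ≤ T →
      {z : K | z - x₀ ∈ I.1 ∧ |((Algebra.norm ℚ z : ℚ) : ℝ)| ≤ T}.Finite ∧
      |({z : K | z - x₀ ∈ I.1 ∧ |((Algebra.norm ℚ z : ℚ) : ℝ)| ≤ T}.ncard : ℝ) -
        2 * Real.pi / √|(discr K : ℝ)| * (T / (FractionalIdeal.absNorm I.1 : ℚ))| ≤
        M * (√T + 1) := by
  classical
  set b := fractionalIdealLatticeBasis K I with hb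
  set N : ℝ := ((FractionalIdeal.absNorm I.1 : ℚ) : ℝ) with hN
  have hN0 : 0 < N := absNorm_pos I
  have hD0 := sqrt_abs_discr_pos (K := K)
  set V : ℝ := N * (√|(discr K : ℝ)| / 2) with hV
  have hV0 : 0 < V := by positivity
  obtain ⟨d, hd⟩ := (ZSpan.fundamentalDomain_isBounded b).exists_norm_le
  have hd0 : 0 ≤ d := (norm_nonneg _).trans (hd _ (ZSpan.fract_mem_fundamentalDomain b 0))
  refine ⟨Real.pi * (2 * d + d ^ 2 + 1) / V, by positivity, fun x₀ T hT => ?_⟩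
  set r := √T with hr
  have hr0 : 0 ≤ r := Real.sqrt_nonneg T
  have hrT : r ^ 2 = T := Real.sq_sqrt hT
  obtain ⟨hfin, hup, hlow⟩ := lattice_coset_ball_volume volume b hd (mixedEmbedding K x₀) r
  set S := {x : mixedSpace K | x - mixedEmbedding K x₀ ∈ Submodule.span ℤ (Set.range b) ∧
    ‖x‖ ≤ r} with hS
  set Z := {z : K | z - x₀ ∈ I.1 ∧ |((Algebra.norm ℚ z : ℚ) : ℝ)| ≤ T} with hZ
  have hinj : Function.Injective (mixedEmbedding K) := mixedEmbedding_injective K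
  have hSZ : S = mixedEmbedding K '' Z := by
    ext x
    simp only [hS, hZ, Set.mem_ofPred_eq, Set.mem_image]
    have hnorm : ∀ z : K, |((Algebra.norm ℚ z : ℚ) : ℝ)| ≤ T ↔ ‖mixedEmbedding K z‖ ≤ r := by
      intro z
      rw [← norm_mixedEmbedding_sq hdeg him, ← hrT]
      exact sq_le_sq₀ (norm_nonneg _) hr0
    rw [hb, mem_span_fractionalIdealLatticeBasis]
    constructor
    · rintro ⟨⟨y, hy, hyx⟩, hx⟩
      have hx' : mixedEmbedding K (y + x₀) = x := by rw [map_add, hyx]; abel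
      refine ⟨y + x₀, ⟨by simpa using hy, (hnorm _).2 (by rwa [hx'])⟩, hx'⟩
    · rintro ⟨z, ⟨hz, hzT⟩, rfl⟩
      exact ⟨⟨z - x₀, hz, by rw [map_sub]⟩, (hnorm z).1 hzT⟩
  have hcard : S.ncard = Z.ncard := by rw [hSZ, Set.ncard_image_of_injective _ hinj]
  have hZfin : Z.Finite := by rw [hSZ] at hfin; exact hfin.of_finite_image hinj.injOn
  refine ⟨hZfin, ?_⟩
  rw [hcard, volume_fundamentalDomain_eq hdeg him I, ← hV] at hup hlow
  rw [volume_closedBall_mixedSpace hdeg him (by positivity), ← ENNReal.ofReal_natCast,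
    ← ENNReal.ofReal_mul (Nat.cast_nonneg _), ENNReal.ofReal_le_ofReal_iff (by positivity)] at hup
  -- The lower bound holds trivially if `r < d`, as its left side is then nonpositive.
  have hlow' : Real.pi * (r ^ 2 - 2 * r * d) ≤ Z.ncard * V := by
    rcases le_or_gt d r with hdr | hdr
    · rw [volume_ball_mixedSpace hdeg him (by linarith), ← ENNReal.ofReal_natCast,
        ← ENNReal.ofReal_mul (Nat.cast_nonneg _),
        ENNReal.ofReal_le_ofReal_iff (by positivity)] at hlow
      have h1 : Real.pi * (r ^ 2 - 2 * r * d) ≤ Real.pi * (r - d) ^ 2 := by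
        have := Real.pi_pos
        gcongr
        nlinarith
      exact h1.trans hlow
    · have h1 : r ^ 2 - 2 * r * d ≤ 0 := by nlinarith
      have h2 : 0 ≤ (Z.ncard : ℝ) * V := by positivity
      nlinarith [Real.pi_pos]
  have hmain : 2 * Real.pi / √|(discr K : ℝ)| * (T / N) = Real.pi * r ^ 2 / V := by
    rw [hV, hrT]; field_simp
  rw [hmain]
  have habs : |(Z.ncard : ℝ) * V - Real.pi * r ^ 2| ≤
      Real.pi * (2 * d + d ^ 2 + 1) * (r + 1) := by
    have hp := Real.pi_pos
    have e1 : Real.pi * (2 * d + d ^ 2 + 1) * (r + 1) - Real.pi * (2 * r * d + d ^ 2) =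
        Real.pi * (2 * d + d ^ 2 * r + r + 1) := by ring
    have e2 : 0 ≤ Real.pi * (2 * d + d ^ 2 * r + r + 1) := by positivity
    have e3 : 0 ≤ Real.pi * d ^ 2 := by positivity
    rw [abs_le]
    constructor
    · linarith
    · have : Real.pi * (r + d) ^ 2 = Real.pi * r ^ 2 + Real.pi * (2 * r * d + d ^ 2) := by ring
      linarith
  have e : (Z.ncard : ℝ) - Real.pi * r ^ 2 / V = ((Z.ncard : ℝ) * V - Real.pi * r ^ 2) / V := by
    field_simp
  rw [e, abs_div, abs_of_pos hV0, div_mul_eq_mul_div]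
  gcongr

/-- Lattice points of norm at most `T` in a coset of a fractional ideal, with an error term that is
uniform in the ideal: up to scaling there are only finitely many of them. -/
theorem exists_forall_card_coset_sub_le (hdeg : Module.finrank ℚ K = 2)
    (him : IsTotallyComplex K) :
    ∃ M : ℝ, 0 < M ∧ ∀ (I : (FractionalIdeal (𝓞 K)⁰ K)ˣ) (x₀ : K) (T : ℝ), 0 ≤ T →
      {z : K | z - x₀ ∈ I.1 ∧ |((Algebra.norm ℚ z : ℚ) : ℝ)| ≤ T}.Finite ∧
      |({z : K | z - x₀ ∈ I.1 ∧ |((Algebra.norm ℚ z : ℚ) : ℝ)| ≤ T}.ncard : ℝ) -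
        2 * Real.pi / √|(discr K : ℝ)| * (T / (FractionalIdeal.absNorm I.1 : ℚ))| ≤
        M * (√(T / (FractionalIdeal.absNorm I.1 : ℚ)) + 1) := by
  choose M₀ hM₀ hM using fun I => exists_card_coset_sub_le hdeg him I
  have hrep : ∀ c : ClassGroup (𝓞 K), ∃ R : (FractionalIdeal (𝓞 K)⁰ K)ˣ,
      ∀ I : (FractionalIdeal (𝓞 K)⁰ K)ˣ,
        (QuotientGroup.mk I : _ ⧸ (toPrincipalIdeal (𝓞 K) K).range) = ClassGroup.equiv K c →
        ∃ γ : K, γ ≠ 0 ∧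
        (I : FractionalIdeal (𝓞 K)⁰ K) = FractionalIdeal.spanSingleton (𝓞 K)⁰ γ * R := by
    intro c
    obtain ⟨R, hR⟩ := QuotientGroup.mk_surjective (ClassGroup.equiv K c)
    refine ⟨R, fun I hI => ?_⟩
    rw [← hR, eq_comm, QuotientGroup.eq] at hI
    obtain ⟨γ, hγ⟩ := hI
    refine ⟨γ, γ.ne_zero, ?_⟩
    rw [← coe_toPrincipalIdeal, hγ, ← Units.val_mul, mul_comm, mul_inv_cancel_left]
  -- `R c` represents the ideal class `c`, and every `I` is `γ R c` for some `c` and `γ`.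
  choose R hR using hrep
  set M : ℝ := ∑ c, M₀ (R c) * (√(FractionalIdeal.absNorm (R c).1 : ℚ) + 1) with hMdef
  have hMle : ∀ c, M₀ (R c) * (√(FractionalIdeal.absNorm (R c).1 : ℚ) + 1) ≤ M := fun c =>
    Finset.single_le_sum (f := fun c => M₀ (R c) * (√(FractionalIdeal.absNorm (R c).1 : ℚ) + 1))
      (fun c _ => mul_nonneg (hM₀ _).le (by positivity)) (Finset.mem_univ c)
  have hMpos : 0 < M := lt_of_lt_of_le (mul_pos (hM₀ _) (by positivity)) (hMle 1)
  refine ⟨M, hMpos, fun I x₀ T hT => ?_⟩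
  set c := (ClassGroup.equiv K).symm (QuotientGroup.mk I) with hc
  obtain ⟨γ, hγ, hI⟩ := hR c I (by rw [hc, MulEquiv.apply_symm_apply])
  set n : ℝ := |((Algebra.norm ℚ γ : ℚ) : ℝ)| with hn
  have hn0 : 0 < n := abs_pos.2 (by exact_mod_cast Algebra.norm_ne_zero_iff.2 hγ)
  obtain ⟨hfin, hcard⟩ := hM (R c) (x₀ / γ) (T / n) (by positivity)
  set W := {z : K | z - x₀ / γ ∈ (R c).1 ∧ |((Algebra.norm ℚ z : ℚ) : ℝ)| ≤ T / n} with hW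
  have hZ : {z : K | z - x₀ ∈ I.1 ∧ |((Algebra.norm ℚ z : ℚ) : ℝ)| ≤ T} =
      (fun w => γ * w) '' W := by
    have hkey : ∀ w : K, (γ * w - x₀ ∈ I.1 ∧ |((Algebra.norm ℚ (γ * w) : ℚ) : ℝ)| ≤ T) ↔ w ∈ W := by
      intro w
      rw [hW, Set.mem_ofPred_eq, le_div_iff₀ hn0, map_mul, Rat.cast_mul, abs_mul, mul_comm n, hI,
        FractionalIdeal.mem_singleton_mul]
      refine and_congr_left fun _ => ?_
      constructor
      · rintro ⟨y, hy, h⟩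
        have : w - x₀ / γ = y := by field_simp; rw [mul_comm w]; exact h
        rwa [this]
      · intro h
        exact ⟨_, h, by field_simp⟩
    ext z
    constructor
    · intro hz
      refine ⟨γ⁻¹ * z, (hkey _).1 ?_, ?_⟩
      · rwa [mul_inv_cancel_left₀ hγ]
      · exact mul_inv_cancel_left₀ hγ z
    · rintro ⟨w, hw, rfl⟩
      exact (hkey w).2 hw
  have hNR := absNorm_pos (R c)
  set NR : ℝ := ((FractionalIdeal.absNorm (R c).1 : ℚ) : ℝ) with hNRdef
  have hNI : ((FractionalIdeal.absNorm I.1 : ℚ) : ℝ) = n * NR := by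
    rw [hI, map_mul, FractionalIdeal.absNorm_span_singleton]
    push_cast
    rfl
  rw [hZ, Set.ncard_image_of_injective _ (mul_right_injective₀ hγ), hNI]
  refine ⟨hfin.image _, ?_⟩
  rw [div_div] at hcard
  refine hcard.trans ?_
  have h1 : √(T / n) = √NR * √(T / (n * NR)) := by
    rw [← Real.sqrt_mul hNR.le]; congr 1; field_simp
  calc M₀ (R c) * (√(T / n) + 1)
      ≤ M₀ (R c) * ((√NR + 1) * (√(T / (n * NR)) + 1)) := by
        have := (hM₀ (R c)).le
        gcongr
        rw [h1]
        nlinarith [Real.sqrt_nonneg NR, Real.sqrt_nonneg (T / (n * NR))]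
    _ = M₀ (R c) * (√NR + 1) * (√(T / (n * NR)) + 1) := by ring
    _ ≤ M * (√(T / (n * NR)) + 1) := by gcongr; exact hMle c

end ImaginaryQuadratic

end

/-! ### Congruences and divisibility in fractional ideals -/

section

open NumberField IsDedekindDomain FractionalIdeal

section FractionalIdealCount

variable {R K : Type*} [CommRing R] [IsDedekindDomain R] [Field K] [Algebra R K]
  [IsFractionRing R K]

theorem le_one_of_count_nonneg {I : FractionalIdeal R⁰ K} (hI : I ≠ 0)
    (h : ∀ v : HeightOneSpectrum R, 0 ≤ count K v I) : I ≤ 1 := by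
  rw [← finprod_heightOneSpectrum_factorization' K hI]
  refine finprod_induction (· ≤ (1 : FractionalIdeal R⁰ K)) le_rfl
    (fun x y hx hy => mul_le_one' hx hy) fun v => ?_
  obtain ⟨n, hn⟩ := Int.eq_ofNat_of_zero_le (h v)
  rw [hn, zpow_natCast, ← coeIdeal_pow]
  exact coeIdeal_le_one

theorem le_of_forall_count_le {I J : FractionalIdeal R⁰ K} (hI : I ≠ 0) (hJ : J ≠ 0)
    (h : ∀ v : HeightOneSpectrum R, count K v J ≤ count K v I) : I ≤ J := by
  have h1 : I * J⁻¹ ≤ 1 := by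
    refine le_one_of_count_nonneg (mul_ne_zero hI (inv_ne_zero hJ)) fun v => ?_
    rw [count_mul K v hI (inv_ne_zero hJ), count_inv]
    linarith [h v]
  calc I = I * J⁻¹ * J := by rw [mul_assoc, inv_mul_cancel₀ hJ, mul_one]
    _ ≤ 1 * J := by gcongr
    _ = J := one_mul J

/-- There is a nonzero fractional ideal with any prescribed finitely supported exponents. -/
theorem exists_forall_count_eq (e : HeightOneSpectrum R → ℤ)
    (he : ∀ᶠ v in Filter.cofinite, e v = 0) :
    ∃ I : FractionalIdeal R⁰ K, I ≠ 0 ∧ ∀ v, count K v I = e v := by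
  refine ⟨∏ᶠ v : HeightOneSpectrum R, (v.asIdeal : FractionalIdeal R⁰ K) ^ e v, ?_,
    fun v => count_finprod K v e he⟩
  exact finprod_induction (· ≠ (0 : FractionalIdeal R⁰ K)) one_ne_zero
    (fun x y hx hy => mul_ne_zero hx hy)
    fun v => zpow_ne_zero _ (coeIdeal_ne_zero.2 v.ne_bot)

theorem one_le_count_coeIdeal_iff (v : HeightOneSpectrum R) {I : Ideal R} (hI : I ≠ ⊥) :
    1 ≤ count K v (I : FractionalIdeal R⁰ K) ↔ v.asIdeal ∣ I := by
  classical
  rw [count_coe K v hI, ← Associates.count_ne_zero_iff_dvd hI v.irreducible]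
  omega

theorem count_coeIdeal_eq_zero (v : HeightOneSpectrum R) {I : Ideal R} (hI : I ≠ ⊥)
    (h : ¬ v.asIdeal ∣ I) : count K v (I : FractionalIdeal R⁰ K) = 0 := by
  rw [← one_le_count_coeIdeal_iff (K := K) v hI] at h
  have := count_coe_nonneg K v I
  omega

variable (R) in
/-- `v(x) ≥ m`, with the convention `v(0) = ∞`. The case `x = 0` is separate because the exponents
of the zero fractional ideal are `0` by convention. -/
def ValuationGE (v : HeightOneSpectrum R) (m : ℤ) (x : K) : Prop :=
  x = 0 ∨ m ≤ count K v (spanSingleton R⁰ x)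

/-- The ultrametric inequality: `x` and `y` both lie in the fractional ideal whose exponents are the
minima of those of `x` and `y`, and so does `x + y`. -/
theorem ValuationGE.add {v : HeightOneSpectrum R} {m : ℤ} {x y : K} (hx : ValuationGE R v m x)
    (hy : ValuationGE R v m y) : ValuationGE R v m (x + y) := by
  rcases eq_or_ne x 0 with rfl | hx0
  · rwa [zero_add]
  rcases eq_or_ne y 0 with rfl | hy0
  · rwa [add_zero]
  by_cases hxy : x + y = 0
  · exact Or.inl hxy
  refine Or.inr ?_
  have hx' := hx.resolve_left hx0
  have hy' := hy.resolve_left hy0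
  obtain ⟨N, hN0, hN⟩ := exists_forall_count_eq (K := K)
    (fun w : HeightOneSpectrum R => min (count K w (spanSingleton R⁰ x))
      (count K w (spanSingleton R⁰ y))) (by
    filter_upwards [finite_factors (spanSingleton R⁰ x), finite_factors (spanSingleton R⁰ y)]
      with w h1 h2
    rw [h1, h2, min_self])
  have h1 : spanSingleton R⁰ x ≤ N := le_of_forall_count_le (spanSingleton_ne_zero_iff.2 hx0) hN0
    fun w => by rw [hN]; exact min_le_left _ _
  have h2 : spanSingleton R⁰ y ≤ N := le_of_forall_count_le (spanSingleton_ne_zero_iff.2 hy0) hN0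
    fun w => by rw [hN]; exact min_le_right _ _
  rw [spanSingleton_le_iff_mem] at h1 h2
  have h3 : spanSingleton R⁰ (x + y) ≤ N := by
    rw [spanSingleton_le_iff_mem]
    exact (N : Submodule R K).add_mem h1 h2
  have h4 := count_mono K v (spanSingleton_ne_zero_iff.2 hxy) h3
  rw [hN] at h4
  exact (le_min hx' hy').trans h4

theorem ValuationGE.neg {v : HeightOneSpectrum R} {m : ℤ} {x : K} (hx : ValuationGE R v m x) :
    ValuationGE R v m (-x) := by
  have : spanSingleton R⁰ (-x) = spanSingleton R⁰ x := by
    apply le_antisymm <;> rw [spanSingleton_le_iff_mem, mem_spanSingleton]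
    · exact ⟨-1, by simp⟩
    · exact ⟨-1, by simp⟩
  rw [ValuationGE, this, neg_eq_zero]
  exact hx

theorem ValuationGE.sub {v : HeightOneSpectrum R} {m : ℤ} {x y : K} (hx : ValuationGE R v m x)
    (hy : ValuationGE R v m y) : ValuationGE R v m (x - y) := by
  rw [sub_eq_add_neg]; exact hx.add hy.neg

theorem ValuationGE.of_mem {v : HeightOneSpectrum R} {I : FractionalIdeal R⁰ K} {x : K}
    (hx : x ∈ I) : ValuationGE R v (count K v I) x := by
  by_cases h : x = 0
  · exact Or.inl h
  · exact Or.inr (count_mono K v (spanSingleton_ne_zero_iff.2 h) (spanSingleton_le_iff_mem.2 hx))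

theorem ValuationGE.mono {v : HeightOneSpectrum R} {m n : ℤ} {x : K} (hx : ValuationGE R v n x)
    (h : m ≤ n) : ValuationGE R v m x := hx.imp_right h.trans

theorem valuationGE_one_algebraMap (v : HeightOneSpectrum R) {x : R}
    (hx : ValuationGE R v 1 (algebraMap R K x)) : x ∈ v.asIdeal := by
  rcases eq_or_ne x 0 with rfl | h0
  · exact zero_mem _
  have hx' := hx.resolve_left ((FaithfulSMul.algebraMap_eq_zero_iff R K).not.2 h0)
  rw [← coeIdeal_span_singleton, one_le_count_coeIdeal_iff v (by simpa using h0)] at hx'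
  exact (Ideal.dvd_span_singleton).1 hx'

/-- A fractional ideal whose exponents at the primes dividing `𝔮` vanish contains an integral
ideal coprime to `𝔮`. -/
theorem exists_coprime_le {L : FractionalIdeal R⁰ K} (hL : L ≠ 0) {𝔮 : Ideal R}
    (h : ∀ v : HeightOneSpectrum R, v.asIdeal ∣ 𝔮 → count K v L = 0) (h𝔮 : 𝔮 ≠ ⊥) :
    ∃ B : Ideal R, (B : FractionalIdeal R⁰ K) ≤ L ∧ B ⊔ 𝔮 = ⊤ := by
  obtain ⟨N, hN0, hN⟩ := exists_forall_count_eq (K := K)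
    (fun w : HeightOneSpectrum R => max (count K w L) 0) (by
    filter_upwards [finite_factors L] with w h1
    rw [h1, max_self])
  have h1 : N ≤ L := le_of_forall_count_le hN0 hL fun w => by rw [hN]; exact le_max_left _ _
  have h2 : N ≤ 1 := le_one_of_count_nonneg hN0 fun w => by rw [hN]; exact le_max_right _ _
  obtain ⟨B, rfl⟩ := le_one_iff_exists_coeIdeal.1 h2
  have hB0 : B ≠ ⊥ := coeIdeal_ne_zero.1 hN0
  refine ⟨B, h1, ?_⟩
  by_contra hne
  obtain ⟨m, hm, hle⟩ := Ideal.exists_le_maximal _ hne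
  have hq : 𝔮 ≤ m := le_sup_right.trans hle
  have hB : B ≤ m := le_sup_left.trans hle
  let v : HeightOneSpectrum R := ⟨m, hm.isPrime, fun h => h𝔮 (le_bot_iff.1 (h ▸ hq))⟩
  have h3 := (one_le_count_coeIdeal_iff (K := K) v hB0).2 (Ideal.dvd_iff_le.2 hB)
  rw [hN, h v (Ideal.dvd_iff_le.2 hq)] at h3
  simp at h3

end FractionalIdealCount

section Congruences

variable {K : Type*} [Field K] [NumberField K]

theorem congrMod_iff {𝔮 : Ideal (𝓞 K)} {x y : K} :
    CongrMod 𝔮 x y ↔ ∀ v : HeightOneSpectrum (𝓞 K), v.asIdeal ∣ 𝔮 →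
      ValuationGE (𝓞 K) v (count K v (𝔮 : FractionalIdeal (𝓞 K)⁰ K)) (x - y) := Iff.rfl

theorem CongrMod.of_sub_mem {𝔮 : Ideal (𝓞 K)} {x x' : 𝓞 K} {y : K} (h : x' - x ∈ 𝔮)
    (hxy : CongrMod 𝔮 (x : K) y) : CongrMod 𝔮 (x' : K) y := by
  rw [congrMod_iff] at hxy ⊢
  intro v hv
  have h1 : ValuationGE (𝓞 K) v (count K v (𝔮 : FractionalIdeal (𝓞 K)⁰ K)) ((x' : K) - x) := by
    apply ValuationGE.of_mem
    rw [mem_coeIdeal]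
    exact ⟨x' - x, h, by simp⟩
  have := h1.add (hxy v hv)
  rwa [sub_add_sub_cancel] at this

/-- For `𝔟` coprime to `𝔮`, the solutions in `𝔟 J` of `A z ≡ c mod 𝔮` form a coset of `𝔮 𝔟 J`. -/
theorem exists_coset_eq {J : FractionalIdeal (𝓞 K)⁰ K} (hJ : J ≠ 0) {𝔮 𝔟 : Ideal (𝓞 K)}
    (h𝔮 : 𝔮 ≠ ⊥) (h𝔟 : 𝔟 ≠ ⊥) (hcop : 𝔟 ⊔ 𝔮 = ⊤) {A : K}
    (hA : ∀ v : HeightOneSpectrum (𝓞 K), v.asIdeal ∣ 𝔮 →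
      A ≠ 0 ∧ count K v (spanSingleton (𝓞 K)⁰ A * J) = 0) (c : 𝓞 K) :
    ∃ z₀ : K, ∀ z : K, (z ∈ (𝔟 : FractionalIdeal (𝓞 K)⁰ K) * J ∧ CongrMod 𝔮 (c : K) (A * z)) ↔
      z - z₀ ∈ (𝔮 : FractionalIdeal (𝓞 K)⁰ K) * (𝔟 * J) := by
  -- For `𝔮 = 1` the congruence is empty, and `A` may vanish.
  by_cases htop : 𝔮 = ⊤
  · refine ⟨0, fun z => ?_⟩
    rw [htop, coeIdeal_top, one_mul, sub_zero]
    refine and_iff_left fun v hv => ?_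
    exact absurd (top_le_iff.1 (Ideal.dvd_iff_le.1 hv)) v.isPrime.ne_top
  obtain ⟨m, hm, hle⟩ := Ideal.exists_le_maximal _ htop
  let v₀ : HeightOneSpectrum (𝓞 K) := ⟨m, hm.isPrime, fun h => h𝔮 (le_bot_iff.1 (h ▸ hle))⟩
  have hA0 : A ≠ 0 := (hA v₀ (Ideal.dvd_iff_le.2 hle)).1
  have hsA : spanSingleton (𝓞 K)⁰ A ≠ 0 := spanSingleton_ne_zero_iff.2 hA0
  have h𝔮c : (𝔮 : FractionalIdeal (𝓞 K)⁰ K) ≠ 0 := coeIdeal_ne_zero.2 h𝔮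
  have h𝔟c : (𝔟 : FractionalIdeal (𝓞 K)⁰ K) ≠ 0 := coeIdeal_ne_zero.2 h𝔟
  have h𝔟J : (𝔟 : FractionalIdeal (𝓞 K)⁰ K) * J ≠ 0 := mul_ne_zero h𝔟c hJ
  have hcb : ∀ v : HeightOneSpectrum (𝓞 K), v.asIdeal ∣ 𝔮 →
      count K v (𝔟 : FractionalIdeal (𝓞 K)⁰ K) = 0 := by
    intro v hv
    refine count_coeIdeal_eq_zero v h𝔟 fun hvb => v.isPrime.ne_top (top_le_iff.1 ?_)
    rw [← hcop]
    exact sup_le (Ideal.dvd_iff_le.1 hvb) (Ideal.dvd_iff_le.1 hv)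
  have hcA : ∀ v : HeightOneSpectrum (𝓞 K), v.asIdeal ∣ 𝔮 →
      count K v (spanSingleton (𝓞 K)⁰ A) + count K v J = 0 := by
    intro v hv
    rw [← count_mul K v hsA hJ]; exact (hA v hv).2
  -- `A 𝔟 J` contains an integral ideal `B` coprime to `𝔮`. Writing `1 = β + κ` with `β ∈ B` and
  -- `κ ∈ 𝔮`, the element `c β` of `A 𝔟 J` is `A z₀` for a solution `z₀` of the congruence.
  obtain ⟨B, hBL, hB⟩ := exists_coprime_le
    (L := spanSingleton (𝓞 K)⁰ A * ((𝔟 : FractionalIdeal (𝓞 K)⁰ K) * J)) (𝔮 := 𝔮)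
    (mul_ne_zero hsA h𝔟J) (fun v hv => by
      rw [count_mul K v hsA h𝔟J, count_mul K v h𝔟c hJ, hcb v hv, zero_add, hcA v hv]) h𝔮
  obtain ⟨β, hβ, κ, hκ, hβκ⟩ := Submodule.mem_sup.1 (hB ▸ Submodule.mem_top : (1 : 𝓞 K) ∈ B ⊔ 𝔮)
  have hw : ((c * β : 𝓞 K) : K) ∈ spanSingleton (𝓞 K)⁰ A * ((𝔟 : FractionalIdeal (𝓞 K)⁰ K) * J) :=
    hBL ((mem_coeIdeal _).2 ⟨c * β, B.mul_mem_left c hβ, rfl⟩)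
  obtain ⟨z₀, hz₀, hwz⟩ := mem_singleton_mul.1 hw
  have hκ' : ∀ v : HeightOneSpectrum (𝓞 K),
      ValuationGE (𝓞 K) v (count K v (𝔮 : FractionalIdeal (𝓞 K)⁰ K)) ((c : K) - A * z₀) := by
    intro v
    apply ValuationGE.of_mem
    rw [mem_coeIdeal]
    refine ⟨c * κ, 𝔮.mul_mem_left c hκ, ?_⟩
    rw [← hwz, ← map_sub]
    congr 1
    linear_combination c * hβκ
  refine ⟨z₀, fun z => ?_⟩
  have hsub : (𝔮 : FractionalIdeal (𝓞 K)⁰ K) * (𝔟 * J) ≤ 𝔟 * J := by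
    calc (𝔮 : FractionalIdeal (𝓞 K)⁰ K) * (𝔟 * J) ≤ 1 * (𝔟 * J) := by
          gcongr; exact coeIdeal_le_one
      _ = _ := one_mul _
  constructor
  · rintro ⟨hz, hcongr⟩
    have hy : z - z₀ ∈ (𝔟 : FractionalIdeal (𝓞 K)⁰ K) * J :=
      Submodule.sub_mem (((𝔟 : FractionalIdeal (𝓞 K)⁰ K) * J :
        FractionalIdeal (𝓞 K)⁰ K) : Submodule (𝓞 K) K) hz hz₀
    by_cases hy0 : z - z₀ = 0
    · rw [hy0]; exact FractionalIdeal.zero_mem _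
    rw [← spanSingleton_le_iff_mem] at hy ⊢
    refine le_of_forall_count_le (spanSingleton_ne_zero_iff.2 hy0) (mul_ne_zero h𝔮c h𝔟J) fun v => ?_
    have hy' := count_mono K v (spanSingleton_ne_zero_iff.2 hy0) hy
    rw [count_mul K v h𝔮c h𝔟J]
    by_cases hv : v.asIdeal ∣ 𝔮
    · have h1 := (hκ' v).sub ((congrMod_iff.1 hcongr) v hv)
      rw [show (c : K) - A * z₀ - (c - A * z) = A * (z - z₀) by ring] at h1
      have h2 := h1.resolve_left (mul_ne_zero hA0 hy0)
      rw [← spanSingleton_mul_spanSingleton,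
        count_mul K v hsA (spanSingleton_ne_zero_iff.2 hy0)] at h2
      rw [count_mul K v h𝔟c hJ, hcb v hv]
      linarith [hcA v hv]
    · rwa [count_coeIdeal_eq_zero v h𝔮 hv, zero_add]
  · intro hz
    refine ⟨?_, congrMod_iff.2 fun v hv => ?_⟩
    · have := Submodule.add_mem (((𝔟 : FractionalIdeal (𝓞 K)⁰ K) * J :
        FractionalIdeal (𝓞 K)⁰ K) : Submodule (𝓞 K) K) (hsub hz) hz₀
      rwa [sub_add_cancel] at this
    · have h1 : ValuationGE (𝓞 K) v (count K v (𝔮 : FractionalIdeal (𝓞 K)⁰ K)) (A * (z - z₀)) := by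
        by_cases hy0 : z - z₀ = 0
        · rw [hy0, mul_zero]; exact Or.inl rfl
        refine Or.inr ?_
        have h2 := (ValuationGE.of_mem (v := v) hz).resolve_left hy0
        rw [count_mul K v h𝔮c h𝔟J, count_mul K v h𝔟c hJ, hcb v hv] at h2
        rw [← spanSingleton_mul_spanSingleton, count_mul K v hsA (spanSingleton_ne_zero_iff.2 hy0)]
        linarith [hcA v hv]
      have := (hκ' v).sub h1
      rwa [show (c : K) - A * z₀ - A * (z - z₀) = c - A * z by ring] at this

theorem isUnit_mk_iff {R : Type*} [CommRing R] {𝔮 : Ideal R} {ρ : R} :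
    IsUnit (Ideal.Quotient.mk 𝔮 ρ) ↔ Ideal.span {ρ} ⊔ 𝔮 = ⊤ := by
  rw [Ideal.eq_top_iff_one, Ideal.mem_span_singleton_sup, isUnit_iff_exists_inv']
  constructor
  · rintro ⟨b, hb⟩
    obtain ⟨b, rfl⟩ := Ideal.Quotient.mk_surjective b
    rw [← map_mul, ← map_one (Ideal.Quotient.mk 𝔮), Ideal.Quotient.eq] at hb
    exact ⟨b, -(b * ρ - 1), 𝔮.neg_mem hb, by ring⟩
  · rintro ⟨b, k, hk, h⟩
    refine ⟨Ideal.Quotient.mk 𝔮 b, ?_⟩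
    rw [← map_mul, ← map_one (Ideal.Quotient.mk 𝔮), ← h, map_add,
      Ideal.Quotient.eq_zero_iff_mem.2 hk, add_zero]

theorem isUnit_of_mem_rootClasses {𝔮 : Ideal (𝓞 K)} {n : ℕ} {x : K} {r : 𝓞 K ⧸ 𝔮}
    (hr : r ∈ rootClasses 𝔮 n x) : IsUnit r := by
  obtain ⟨ρ, rfl, hρ, -⟩ := hr
  exact isUnit_mk_iff.2 hρ

/-- Membership in `rootClasses` may be tested on any representative of the class. -/
theorem mem_rootClasses_iff {𝔮 : Ideal (𝓞 K)} {n : ℕ} {x : K} {ρ : 𝓞 K}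
    (hρ : IsUnit (Ideal.Quotient.mk 𝔮 ρ)) :
    Ideal.Quotient.mk 𝔮 ρ ∈ rootClasses 𝔮 n x ↔ CongrMod 𝔮 ((ρ ^ n : 𝓞 K) : K) x := by
  constructor
  · rintro ⟨ρ', h, -, hc⟩
    rw [← map_pow] at hc
    refine CongrMod.of_sub_mem ?_ hc
    rw [← Ideal.Quotient.eq, map_pow, map_pow, h]
  · intro h
    exact ⟨ρ, rfl, isUnit_mk_iff.1 hρ, by simpa using h⟩

/-- If `A z` is congruent to the power of an invertible class, then `z J⁻¹` is coprime to `𝔮`, and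
so are its divisors. Hence only `𝔟` coprime to `𝔮` occur in the sum. -/
theorem sup_eq_top_of_mem_rootClasses {J : FractionalIdeal (𝓞 K)⁰ K} (hJ : J ≠ 0)
    {𝔮 𝔟 : Ideal (𝓞 K)} (h𝔮 : 𝔮 ≠ ⊥) {A : K}
    (hA : ∀ v : HeightOneSpectrum (𝓞 K), v.asIdeal ∣ 𝔮 →
      A ≠ 0 ∧ count K v (spanSingleton (𝓞 K)⁰ A * J) = 0) {n : ℕ} {z : K} (hz : z ∈ J)
    (hz0 : z ≠ 0) (h𝔟 : 𝔟 ∣ idealOf J z) {r : 𝓞 K ⧸ 𝔮} (hr : r ∈ rootClasses 𝔮 n (A * z)) :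
    𝔟 ⊔ 𝔮 = ⊤ := by
  by_contra hne
  obtain ⟨m, hm, hle⟩ := Ideal.exists_le_maximal _ hne
  have hq : 𝔮 ≤ m := le_sup_right.trans hle
  have hB : 𝔟 ≤ m := le_sup_left.trans hle
  let v : HeightOneSpectrum (𝓞 K) := ⟨m, hm.isPrime, fun h => h𝔮 (le_bot_iff.1 (h ▸ hq))⟩
  have hvq : v.asIdeal ∣ 𝔮 := Ideal.dvd_iff_le.2 hq
  obtain ⟨ρ, -, hρ, hc⟩ := hr
  obtain ⟨hA0, hAJ⟩ := hA v hvq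
  have hsA : spanSingleton (𝓞 K)⁰ A ≠ 0 := spanSingleton_ne_zero_iff.2 hA0
  have hsz : spanSingleton (𝓞 K)⁰ z ≠ 0 := spanSingleton_ne_zero_iff.2 hz0
  have hid := coe_idealOf hJ hz
  have hid0 : idealOf J z ≠ ⊥ := by
    rw [← coeIdeal_ne_zero (K := K), hid]; exact mul_ne_zero hsz (inv_ne_zero hJ)
  have h1 := (one_le_count_coeIdeal_iff (K := K) v hid0).2 ((Ideal.dvd_iff_le.2 hB).trans h𝔟)
  rw [hid, count_mul K v hsz (inv_ne_zero hJ), count_inv] at h1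
  rw [count_mul K v hsA hJ] at hAJ
  have h2 : ValuationGE (𝓞 K) v 1 (A * z) := by
    refine Or.inr ?_
    rw [← spanSingleton_mul_spanSingleton, count_mul K v hsA hsz]
    linarith
  have h3 := ((congrMod_iff.1 hc v hvq).mono
    ((one_le_count_coeIdeal_iff (K := K) v h𝔮).2 hvq)).add h2
  rw [sub_add_cancel, ← map_pow] at h3
  have h4 : ρ ∈ m := hm.isPrime.mem_of_pow_mem n (valuationGE_one_algebraMap v h3)
  refine hm.ne_top (top_le_iff.1 ?_)
  rw [← hρ]
  exact sup_le ((Ideal.span_singleton_le_iff_mem _).2 h4) hq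

theorem dvd_idealOf_iff {J : FractionalIdeal (𝓞 K)⁰ K} (hJ : J ≠ 0) {𝔟 : Ideal (𝓞 K)} {z : K}
    (hz : z ∈ J) : 𝔟 ∣ idealOf J z ↔ z ∈ (𝔟 : FractionalIdeal (𝓞 K)⁰ K) * J := by
  rw [Ideal.dvd_iff_le, ← coeIdeal_le_coeIdeal K, coe_idealOf hJ hz, ← spanSingleton_le_iff_mem]
  constructor
  · intro h
    calc spanSingleton (𝓞 K)⁰ z = spanSingleton (𝓞 K)⁰ z * J⁻¹ * J := by
          rw [mul_assoc, inv_mul_cancel₀ hJ, mul_one]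
      _ ≤ _ := by gcongr
  · intro h
    calc spanSingleton (𝓞 K)⁰ z * J⁻¹ ≤ (𝔟 : FractionalIdeal (𝓞 K)⁰ K) * J * J⁻¹ := by gcongr
      _ = _ := by rw [mul_assoc, mul_inv_cancel₀ hJ, mul_one]

theorem absNorm_idealOf {J : FractionalIdeal (𝓞 K)⁰ K} (hJ : J ≠ 0) {z : K} (hz : z ∈ J) :
    (Ideal.absNorm (idealOf J z) : ℝ) =
      |((Algebra.norm ℚ z : ℚ) : ℝ)| / (FractionalIdeal.absNorm J : ℚ) := by
  have h1 : (Ideal.absNorm (idealOf J z) : ℚ) =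
      |Algebra.norm ℚ z| * (FractionalIdeal.absNorm J)⁻¹ := by
    rw [← coeIdeal_absNorm (K := K), coe_idealOf hJ hz, map_mul, absNorm_span_singleton, map_inv₀]
  rw [div_eq_mul_inv, ← Rat.cast_natCast, h1]
  push_cast
  rfl

theorem idealOf_ne_bot {J : FractionalIdeal (𝓞 K)⁰ K} (hJ : J ≠ 0) {z : K} (hz : z ∈ J)
    (hz0 : z ≠ 0) : idealOf J z ≠ ⊥ := by
  rw [← coeIdeal_ne_zero (K := K), coe_idealOf hJ hz]
  exact mul_ne_zero (spanSingleton_ne_zero_iff.2 hz0) (inv_ne_zero hJ)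

end Congruences

end

/-! ### Sums over ideals ordered by norm -/

section

open NumberField IsDedekindDomain

section SumsOverIdeals

variable {K : Type*} [Field K] [NumberField K]

theorem finite_normBall (m : ℕ) : {𝔟 : Ideal (𝓞 K) | 𝔟 ≠ ⊥ ∧ Ideal.absNorm 𝔟 ≤ m}.Finite :=
  (Ideal.finite_setOfPred_absNorm_le m).subset fun _ h => h.2

variable (K) in
/-- The nonzero ideals of norm at most `m`. -/
noncomputable def normBall (m : ℕ) : Finset (Ideal (𝓞 K)) := (finite_normBall m).toFinset

theorem mem_normBall {m : ℕ} {𝔟 : Ideal (𝓞 K)} :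
    𝔟 ∈ normBall K m ↔ 𝔟 ≠ ⊥ ∧ Ideal.absNorm 𝔟 ≤ m := by
  rw [normBall, Set.Finite.mem_toFinset, Set.mem_ofPred_eq]

theorem absNorm_pos_of_ne_bot {𝔟 : Ideal (𝓞 K)} (h : 𝔟 ≠ ⊥) : 0 < Ideal.absNorm 𝔟 :=
  Nat.pos_of_ne_zero (Ideal.absNorm_eq_zero_iff.not.2 h)

open scoped Classical in
/-- The total weight `∑_{N𝔟 = j} |(ϑ * μ_K)(𝔟)| N𝔟` of the ideals of norm `j`. -/
noncomputable def normWeight (ϑ : Ideal (𝓞 K) → ℝ) (j : ℕ) : ℝ :=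
  ∑ 𝔟 ∈ (normBall K j).filter (fun 𝔟 => Ideal.absNorm 𝔟 = j), |convMoebius ϑ 𝔟| * j

theorem normWeight_nonneg (ϑ : Ideal (𝓞 K) → ℝ) (j : ℕ) : 0 ≤ normWeight ϑ j :=
  Finset.sum_nonneg fun _ _ => by positivity

theorem normWeight_zero (ϑ : Ideal (𝓞 K) → ℝ) : normWeight ϑ 0 = 0 := by
  rw [normWeight]; simp

/-- Sums over ideals with `k < N𝔟 ≤ m`, sorted by norm. -/
theorem sum_normBall_sdiff_eq (ϑ : Ideal (𝓞 K) → ℝ) (h : ℕ → ℝ) (k m : ℕ) :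
    ∑ 𝔟 ∈ (normBall K m) \ (normBall K k), |convMoebius ϑ 𝔟| * h (Ideal.absNorm 𝔟) =
      ∑ j ∈ Finset.Ico k m, h (j + 1) / ((j : ℝ) + 1) * normWeight ϑ (j + 1) := by
  classical
  have e := Finset.sum_Ico_add' (fun j : ℕ => h j / (j : ℝ) * normWeight ϑ j) k m 1
  push_cast at e
  rw [e, ← Finset.sum_fiberwise_of_maps_to (t := Finset.Ico (k + 1) (m + 1))
    (g := fun 𝔟 : Ideal (𝓞 K) => Ideal.absNorm 𝔟)]
  · refine Finset.sum_congr rfl fun j hj => ?_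
    rw [Finset.mem_Ico] at hj
    have hj0 : (j : ℝ) ≠ 0 := by
      have : j ≠ 0 := by omega
      exact_mod_cast this
    rw [normWeight, Finset.mul_sum]
    have : ((normBall K m) \ (normBall K k)).filter (fun 𝔟 => Ideal.absNorm 𝔟 = j) =
        (normBall K j).filter (fun 𝔟 => Ideal.absNorm 𝔟 = j) := by
      ext 𝔟
      simp only [Finset.mem_filter, Finset.mem_sdiff, mem_normBall]
      constructor
      · rintro ⟨⟨⟨h1, -⟩, -⟩, h2⟩; exact ⟨⟨h1, h2.le⟩, h2⟩
      · rintro ⟨⟨h1, -⟩, h2⟩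
        exact ⟨⟨⟨h1, by omega⟩, fun h => by have := h.2; omega⟩, h2⟩
    rw [this]
    refine Finset.sum_congr rfl fun 𝔟 h𝔟 => ?_
    rw [(Finset.mem_filter.1 h𝔟).2]
    field_simp
  · intro 𝔟 h𝔟
    simp only [Finset.mem_sdiff, mem_normBall, not_and, not_le] at h𝔟
    have := h𝔟.2 h𝔟.1.1
    have := h𝔟.1.2
    rw [Finset.mem_Ico]; omega

theorem normBall_zero : normBall K 0 = ∅ := by
  refine Finset.eq_empty_of_forall_notMem fun 𝔟 h => ?_
  have h1 := absNorm_pos_of_ne_bot (mem_normBall.1 h).1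
  have h2 := (mem_normBall.1 h).2
  omega

theorem sum_normBall_eq (ϑ : Ideal (𝓞 K) → ℝ) (h : ℕ → ℝ) (m : ℕ) :
    ∑ 𝔟 ∈ normBall K m, |convMoebius ϑ 𝔟| * h (Ideal.absNorm 𝔟) =
      ∑ j ∈ Finset.range (m + 1), h j / (j : ℝ) * normWeight ϑ j := by
  have := sum_normBall_sdiff_eq ϑ h 0 m
  rw [normBall_zero, Finset.sdiff_empty] at this
  rw [this, Finset.sum_range_succ', normWeight_zero, mul_zero, add_zero, Finset.range_eq_Ico]
  push_cast; rfl

/-- The growth condition on the Möbius convolution of `ϑ`. -/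
def GrowthCondition (ϑ : Ideal (𝓞 K) → ℝ) (c C : ℝ) : Prop :=
  ∀ t : ℝ, 0 < t → convMoebiusSum ϑ t ≤ c * t * Real.log (t + 2) ^ C

theorem GrowthCondition.sum_normWeight_le {ϑ : Ideal (𝓞 K) → ℝ} {c C : ℝ}
    (h : GrowthCondition ϑ c C) (m : ℕ) :
    ∑ j ∈ Finset.range (m + 1), normWeight ϑ j ≤ c * m * Real.log (m + 2) ^ C := by
  rcases Nat.eq_zero_or_pos m with rfl | hm
  · simp [normWeight_zero]
  refine le_trans (le_of_eq ?_) (h m (by exact_mod_cast hm))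
  have h1 := sum_normBall_eq ϑ (fun j => j) m
  have h2 : ∑ j ∈ Finset.range (m + 1), (j : ℝ) / j * normWeight ϑ j =
      ∑ j ∈ Finset.range (m + 1), normWeight ϑ j := by
    refine Finset.sum_congr rfl fun j _ => ?_
    rcases Nat.eq_zero_or_pos j with rfl | hj
    · rw [normWeight_zero, mul_zero]
    · rw [div_self (by exact_mod_cast hj.ne'), one_mul]
  rw [← h2, ← h1, convMoebiusSum, ← finsum_mem_coe_finset]
  refine finsum_mem_congr ?_ fun _ _ => rfl
  ext 𝔟
  rw [Finset.mem_coe, mem_normBall]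
  simp

/-- The `O(1)` errors in counting lattice points, summed over `𝔟`. -/
theorem exists_sum_normBall_le {C : ℝ} (hC : 0 ≤ C) :
    ∃ M : ℝ, 0 < M ∧ ∀ (ϑ : Ideal (𝓞 K) → ℝ) (c : ℝ), 0 < c → GrowthCondition ϑ c C →
      ∀ m : ℕ, 1 ≤ m →
        ∑ 𝔟 ∈ normBall K m, |convMoebius ϑ 𝔟| ≤ M * c * Real.log (m + 2) ^ (C + 1) := by
  obtain ⟨M, hM, h⟩ := exists_sum_div_le hC
  refine ⟨M, hM, fun ϑ c hc hϑ m hm => ?_⟩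
  have h1 := h _ c hc (normWeight_zero ϑ) (normWeight_nonneg ϑ) hϑ.sum_normWeight_le m hm
  have h2 := sum_normBall_eq ϑ (fun _ => 1) m
  simp only [mul_one] at h2
  rw [h2]
  refine le_trans (le_of_eq (Finset.sum_congr rfl fun j _ => ?_)) h1
  rw [one_div, div_eq_inv_mul]

/-- The errors `√(m / N𝔟)` in counting lattice points, summed over `𝔟`, up to the factor `√m`. -/
theorem exists_sum_normBall_div_sqrt_le {C : ℝ} (hC : 0 ≤ C) :
    ∃ M : ℝ, 0 < M ∧ ∀ (ϑ : Ideal (𝓞 K) → ℝ) (c : ℝ), 0 < c → GrowthCondition ϑ c C →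
      ∀ m : ℕ, ∑ 𝔟 ∈ normBall K m, |convMoebius ϑ 𝔟| * (1 / √(Ideal.absNorm 𝔟 : ℝ)) ≤ M * c := by
  obtain ⟨M, hM, h⟩ := exists_sum_rpow_neg_three_halves_le hC
  refine ⟨M, hM, fun ϑ c hc hϑ m => ?_⟩
  have h1 := h _ c hc (normWeight_zero ϑ) (normWeight_nonneg ϑ) hϑ.sum_normWeight_le m
  have h2 := sum_normBall_eq ϑ (fun j => 1 / √(j : ℝ)) m
  rw [h2]
  refine le_trans (le_of_eq (Finset.sum_congr rfl fun j _ => ?_)) h1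
  rcases Nat.eq_zero_or_pos j with rfl | hj
  · rw [normWeight_zero, mul_zero, mul_zero]
  · have hj' : (0 : ℝ) < j := by exact_mod_cast hj
    congr 1
    rw [show (-(3 / 2) : ℝ) = -(1 / 2) - 1 by norm_num, Real.rpow_sub_one hj'.ne',
      Real.rpow_neg hj'.le, Real.sqrt_eq_rpow, one_div]

theorem exists_sum_normBall_sdiff_le {C : ℝ} (hC : 0 ≤ C) :
    ∃ M : ℝ, 0 < M ∧ ∀ (ϑ : Ideal (𝓞 K) → ℝ) (c : ℝ), 0 < c → GrowthCondition ϑ c C →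
      ∀ k m : ℕ, 1 ≤ k → k ≤ m →
        ∑ 𝔟 ∈ (normBall K m) \ (normBall K k),
          |convMoebius ϑ 𝔟| * (1 / (Ideal.absNorm 𝔟 : ℝ)) ≤
          M * c * (Real.log (k + 2) ^ C / k) := by
  obtain ⟨M, hM, h⟩ := exists_sum_rpow_neg_le hC (by norm_num : (1 : ℝ) < 2)
  refine ⟨M, hM, fun ϑ c hc hϑ k m hk hkm => ?_⟩
  have h1 := h _ c hc (normWeight_zero ϑ) (normWeight_nonneg ϑ) hϑ.sum_normWeight_le k m hk
  have h2 := sum_normBall_sdiff_eq ϑ (fun j => 1 / (j : ℝ)) k m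
  rw [h2]
  have e : (k : ℝ) ^ ((1 : ℝ) - 2) = 1 / k := by
    rw [show (1 : ℝ) - 2 = -1 by norm_num, Real.rpow_neg_one, one_div]
  rw [e, one_div_mul_eq_div] at h1
  refine le_trans (le_of_eq (Finset.sum_congr rfl fun j _ => ?_)) h1
  have hj' : (0 : ℝ) < (j : ℝ) + 1 := by positivity
  congr 1
  rw [Real.rpow_neg hj'.le, Real.rpow_two]
  push_cast
  field_simp

open scoped Classical in
/-- The terms of `𝒜(ϑ, 𝔮)`, extended by zero to all ideals, so that partial sums for different `𝔮`
are indexed by the same sets `normBall K m`. -/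
noncomputable def averageCoeff (ϑ : Ideal (𝓞 K) → ℝ) (𝔮 𝔟 : Ideal (𝓞 K)) : ℝ :=
  if 𝔟 ≠ ⊥ ∧ 𝔟 ⊔ 𝔮 = ⊤ then convMoebius ϑ 𝔟 / (Ideal.absNorm 𝔟 : ℝ) else 0

theorem abs_averageCoeff_le (ϑ : Ideal (𝓞 K) → ℝ) (𝔮 𝔟 : Ideal (𝓞 K)) :
    |averageCoeff ϑ 𝔮 𝔟| ≤ |convMoebius ϑ 𝔟| * (1 / (Ideal.absNorm 𝔟 : ℝ)) := by
  rw [averageCoeff]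
  split_ifs
  · rw [abs_div, Nat.abs_cast, mul_one_div]
  · rw [abs_zero]; positivity

theorem averageCoeff_bot (ϑ : Ideal (𝓞 K) → ℝ) (𝔮 : Ideal (𝓞 K)) : averageCoeff ϑ 𝔮 ⊥ = 0 := by
  rw [averageCoeff, if_neg]; simp

theorem averageCoeff_eq_indicator (ϑ : Ideal (𝓞 K) → ℝ) (𝔮 : Ideal (𝓞 K)) :
    averageCoeff ϑ 𝔮 = Set.indicator {𝔟 : Ideal (𝓞 K) | 𝔟 ≠ ⊥ ∧ 𝔟 ⊔ 𝔮 = ⊤}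
      (fun 𝔟 => convMoebius ϑ 𝔟 / (Ideal.absNorm 𝔟 : ℝ)) := by
  classical
  ext 𝔟
  rw [averageCoeff, Set.indicator_apply]
  rfl

theorem average_eq_tsum (ϑ : Ideal (𝓞 K) → ℝ) (𝔮 : Ideal (𝓞 K)) :
    average ϑ 𝔮 = ∑' 𝔟, averageCoeff ϑ 𝔮 𝔟 := by
  rw [averageCoeff_eq_indicator, ← tsum_subtype]
  rfl

theorem summable_averageTerm_iff (ϑ : Ideal (𝓞 K) → ℝ) (𝔮 : Ideal (𝓞 K)) :
    Summable (averageTerm ϑ 𝔮) ↔ Summable (averageCoeff ϑ 𝔮) := by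
  rw [averageCoeff_eq_indicator, ← summable_subtype_iff_indicator]
  rfl

/-- Up to the zero ideal, every finite set of ideals is contained in some `normBall`. -/
theorem exists_forall_mem_normBall (u : Finset (Ideal (𝓞 K))) (k : ℕ) :
    ∃ m, k ≤ m ∧ ∀ 𝔟 ∈ u, 𝔟 ≠ ⊥ → 𝔟 ∈ normBall K m := by
  refine ⟨max k (u.sup Ideal.absNorm), le_max_left _ _, fun 𝔟 h𝔟 h0 => mem_normBall.2 ⟨h0, ?_⟩⟩
  exact (Finset.le_sup (f := Ideal.absNorm) h𝔟).trans (le_max_right _ _)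

theorem sum_abs_averageCoeff_le (ϑ : Ideal (𝓞 K) → ℝ) (𝔮 : Ideal (𝓞 K))
    (u s : Finset (Ideal (𝓞 K))) (h : ∀ 𝔟 ∈ u, 𝔟 ≠ ⊥ → 𝔟 ∈ s) :
    ∑ 𝔟 ∈ u, |averageCoeff ϑ 𝔮 𝔟| ≤
      ∑ 𝔟 ∈ s, |convMoebius ϑ 𝔟| * (1 / (Ideal.absNorm 𝔟 : ℝ)) := by
  classical
  calc ∑ 𝔟 ∈ u, |averageCoeff ϑ 𝔮 𝔟| = ∑ 𝔟 ∈ u.filter (· ≠ ⊥), |averageCoeff ϑ 𝔮 𝔟| := by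
        symm
        refine Finset.sum_filter_of_ne fun 𝔟 _ hne h0 => hne ?_
        rw [h0, averageCoeff_bot, abs_zero]
    _ ≤ ∑ 𝔟 ∈ u.filter (· ≠ ⊥), |convMoebius ϑ 𝔟| * (1 / (Ideal.absNorm 𝔟 : ℝ)) :=
        Finset.sum_le_sum fun 𝔟 _ => abs_averageCoeff_le ϑ 𝔮 𝔟
    _ ≤ _ := Finset.sum_le_sum_of_subset_of_nonneg (fun 𝔟 h𝔟 =>
        h 𝔟 (Finset.mem_filter.1 h𝔟).1 (Finset.mem_filter.1 h𝔟).2) fun _ _ _ => by positivity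

/-- The series `𝒜(ϑ, 𝔮)` converges absolutely; bounds for its size and its tails that are uniform
in `𝔮`. -/
theorem exists_average_bounds {C : ℝ} (hC : 0 ≤ C) :
    ∃ M : ℝ, 0 < M ∧ ∀ (ϑ : Ideal (𝓞 K) → ℝ) (c : ℝ), 0 < c → GrowthCondition ϑ c C →
      ∀ 𝔮 : Ideal (𝓞 K), Summable (averageCoeff ϑ 𝔮) ∧ |average ϑ 𝔮| ≤ M * c ∧
        ∀ m : ℕ, 1 ≤ m → |average ϑ 𝔮 - ∑ 𝔟 ∈ normBall K m, averageCoeff ϑ 𝔮 𝔟| ≤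
          M * c * (Real.log (m + 2) ^ C / m) := by
  classical
  obtain ⟨M₁, hM₁, h₁⟩ := exists_sum_normBall_div_sqrt_le (K := K) hC
  obtain ⟨M₂, hM₂, h₂⟩ := exists_sum_normBall_sdiff_le (K := K) hC
  refine ⟨M₁ + M₂, by positivity, fun ϑ c hc hϑ 𝔮 => ?_⟩
  have hb : ∀ u : Finset (Ideal (𝓞 K)), ∑ 𝔟 ∈ u, |averageCoeff ϑ 𝔮 𝔟| ≤ M₁ * c := by
    intro u
    obtain ⟨m, -, hm⟩ := exists_forall_mem_normBall u 0
    refine (sum_abs_averageCoeff_le ϑ 𝔮 u _ hm).trans (le_trans ?_ (h₁ ϑ c hc hϑ m))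
    refine Finset.sum_le_sum fun 𝔟 h𝔟 => ?_
    have h1 : (1 : ℝ) ≤ Ideal.absNorm 𝔟 := by
      exact_mod_cast absNorm_pos_of_ne_bot (mem_normBall.1 h𝔟).1
    have h2 : √(Ideal.absNorm 𝔟 : ℝ) ≤ Ideal.absNorm 𝔟 := by
      rw [Real.sqrt_le_iff]; exact ⟨by positivity, by nlinarith⟩
    gcongr
  have hsum : Summable (averageCoeff ϑ 𝔮) :=
    (summable_of_sum_le (fun _ => abs_nonneg _) hb).of_abs
  have hlim := hsum.hasSum
  rw [← average_eq_tsum] at hlim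
  refine ⟨hsum, ?_, fun m hm => ?_⟩
  · refine le_of_tendsto hlim.abs (Filter.Eventually.of_forall fun u => ?_)
    refine (Finset.abs_sum_le_sum_abs _ _).trans ((hb u).trans ?_)
    gcongr; linarith
  · have hlim' := (hlim.sub_const (∑ 𝔟 ∈ normBall K m, averageCoeff ϑ 𝔮 𝔟)).abs
    refine le_of_tendsto hlim' ?_
    filter_upwards [Filter.eventually_ge_atTop (normBall K m)] with u hu
    rw [← Finset.sum_sdiff hu, add_sub_cancel_right]
    refine (Finset.abs_sum_le_sum_abs _ _).trans ?_
    obtain ⟨l, hl, hl'⟩ := exists_forall_mem_normBall u m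
    refine (sum_abs_averageCoeff_le ϑ 𝔮 _ (normBall K l \ normBall K m) fun 𝔟 h𝔟 h0 => ?_).trans
      ((h₂ ϑ c hc hϑ m l hm hl).trans ?_)
    · rw [Finset.mem_sdiff] at h𝔟 ⊢
      exact ⟨hl' 𝔟 h𝔟.1 h0, h𝔟.2⟩
    · have := log_add_two_rpow_nonneg (Nat.cast_nonneg m) C
      gcongr; linarith

end SumsOverIdeals

end

/-! ### The sum over elements without weight -/

section

open NumberField IsDedekindDomain FractionalIdeal

section SumsOverElements

variable {K : Type*} [Field K] [NumberField K]

/-- The hypotheses on the fractional ideal `J`, the modulus `𝔮` and the twist `A`. -/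
structure Admissible (J : FractionalIdeal (𝓞 K)⁰ K) (𝔮 : Ideal (𝓞 K)) (A : K) : Prop where
  ideal_ne_zero : J ≠ 0
  modulus_ne_bot : 𝔮 ≠ ⊥
  count_eq_zero : ∀ v : HeightOneSpectrum (𝓞 K), v.asIdeal ∣ 𝔮 →
    A ≠ 0 ∧ count K v (spanSingleton (𝓞 K)⁰ A * J) = 0

theorem absNorm_fractionalIdeal_pos {J : FractionalIdeal (𝓞 K)⁰ K} (hJ : J ≠ 0) :
    (0 : ℝ) < (FractionalIdeal.absNorm J : ℚ) := absNorm_pos (Units.mk0 J hJ)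

theorem elementsWithNorm_mono (J : FractionalIdeal (𝓞 K)⁰ K) {T T' : Set ℝ} (h : T ⊆ T') :
    elementsWithNorm J T ⊆ elementsWithNorm J T' := fun _ hz => ⟨hz.1, hz.2.1, h hz.2.2⟩

theorem finite_elementsWithNorm_Iic (hdeg : Module.finrank ℚ K = 2) (him : IsTotallyComplex K)
    {J : FractionalIdeal (𝓞 K)⁰ K} (hJ : J ≠ 0) {t : ℝ} (ht : 0 ≤ t) :
    (elementsWithNorm J (Set.Iic t)).Finite := by
  obtain ⟨M, -, h⟩ := exists_forall_card_coset_sub_le hdeg him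
  have hN := absNorm_fractionalIdeal_pos hJ
  refine (h (Units.mk0 J hJ) 0 (t * (FractionalIdeal.absNorm J : ℚ)) (by positivity)).1.subset ?_
  rintro z ⟨hz, -, hT⟩
  rw [Set.mem_Iic, absNorm_idealOf hJ hz, div_le_iff₀ hN] at hT
  exact ⟨by simpa using hz, hT⟩

/-- Sorting the elements by their norm. -/
theorem finsum_elementsWithNorm_eq {J : FractionalIdeal (𝓞 K)⁰ K} {T : Set ℝ}
    (hfin : (elementsWithNorm J T).Finite) (s : Finset ℕ)
    (hs : ∀ m : ℕ, m ∈ s ↔ (m : ℝ) ∈ T) (w : K → ℝ) :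
    ∑ᶠ z ∈ elementsWithNorm J T, w z = ∑ m ∈ s, ∑ᶠ z ∈ elementsWithNorm J {(m : ℝ)}, w z := by
  have hU : elementsWithNorm J T = ⋃ m ∈ (s : Set ℕ), elementsWithNorm J {(m : ℝ)} := by
    ext z
    simp only [elementsWithNorm, Set.mem_iUnion, Set.mem_ofPred_eq, Finset.mem_coe,
      Set.mem_singleton_iff, exists_prop]
    constructor
    · rintro ⟨h1, h2, h3⟩
      exact ⟨_, (hs _).2 h3, h1, h2, rfl⟩
    · rintro ⟨m, hm, h1, h2, h3⟩
      exact ⟨h1, h2, h3 ▸ (hs m).1 hm⟩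
  rw [hU, finsum_mem_biUnion _ s.finite_toSet, finsum_mem_coe_finset]
  · intro m hm
    refine hfin.subset (elementsWithNorm_mono J ?_)
    rw [Set.singleton_subset_iff]; exact (hs m).1 hm
  · intro m _ m' _ hne
    rw [Function.onFun, Set.disjoint_left]
    rintro z ⟨-, -, h⟩ ⟨-, -, h'⟩
    apply hne
    rw [Set.mem_singleton_iff] at h h'
    exact_mod_cast h.symm.trans h'

/-- `∑ ϑ(z J⁻¹) #{ρ mod 𝔮 : ρ ^ n ≡ A z}` over the nonzero `z ∈ J` with `N(z J⁻¹) = m`. -/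
noncomputable def normCoeff (J : FractionalIdeal (𝓞 K)⁰ K) (𝔮 : Ideal (𝓞 K)) (n : ℕ) (A : K)
    (ϑ : Ideal (𝓞 K) → ℝ) (m : ℕ) : ℝ :=
  ∑ᶠ z ∈ elementsWithNorm J {(m : ℝ)}, ϑ (idealOf J z) * (rootClasses 𝔮 n (A * z)).ncard

theorem finite_quotient {𝔮 : Ideal (𝓞 K)} (h𝔮 : 𝔮 ≠ ⊥) : Finite (𝓞 K ⧸ 𝔮) :=
  Ideal.finiteQuotientOfFreeOfNeBot 𝔮 h𝔮

theorem secondSum_eq {J : FractionalIdeal (𝓞 K)⁰ K} {𝔮 : Ideal (𝓞 K)} (h𝔮 : 𝔮 ≠ ⊥) {T : Set ℝ}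
    (hfin : (elementsWithNorm J T).Finite) (s : Finset ℕ)
    (hs : ∀ m : ℕ, m ∈ s ↔ (m : ℝ) ∈ T) (n : ℕ) (A : K) (ϑ : Ideal (𝓞 K) → ℝ) (g : ℝ → ℝ) :
    secondSum J 𝔮 n A ϑ g T = ∑ m ∈ s, normCoeff J 𝔮 n A ϑ m * g m := by
  have := finite_quotient h𝔮
  rw [secondSum, finsum_elementsWithNorm_eq hfin s hs]
  refine Finset.sum_congr rfl fun m hm => ?_
  have hfin' : (elementsWithNorm J {(m : ℝ)}).Finite :=
    hfin.subset (elementsWithNorm_mono J (Set.singleton_subset_iff.2 ((hs m).1 hm)))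
  rw [normCoeff, finsum_mem_eq_finite_toFinset_sum _ hfin',
    finsum_mem_eq_finite_toFinset_sum _ hfin', Finset.sum_mul]
  refine Finset.sum_congr rfl fun z hz => ?_
  have hz' : (Ideal.absNorm (idealOf J z) : ℝ) = m := ((Set.Finite.mem_toFinset _).1 hz).2.2
  have hr : (rootClasses 𝔮 n (A * z)).Finite := Set.toFinite _
  rw [hz', finsum_mem_eq_finite_toFinset_sum _ hr, Finset.sum_const, nsmul_eq_mul,
    Set.ncard_eq_toFinset_card _ hr, mul_assoc]

theorem eulerPhi_le_absNorm {𝔮 : Ideal (𝓞 K)} (h𝔮 : 𝔮 ≠ ⊥) : eulerPhi 𝔮 ≤ Ideal.absNorm 𝔮 := by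
  have := finite_quotient h𝔮
  rw [eulerPhi, Ideal.absNorm_apply, Submodule.cardQuot_apply]
  exact Nat.card_le_card_of_injective _ Units.val_injective

open scoped Classical in
/-- The number of nonzero `z ∈ 𝔟 J` with `N(z J⁻¹) ≤ m` and `ρ ^ n ≡ A z mod 𝔮`, for a given
invertible residue class `ρ` and `𝔟` coprime to `𝔮`. Up to `0`, such `z` are the points of a
coset of `𝔮 𝔟 J`. -/
theorem exists_card_elements_sub_le (hdeg : Module.finrank ℚ K = 2) (him : IsTotallyComplex K) :
    ∃ M : ℝ, 0 < M ∧ ∀ {J : FractionalIdeal (𝓞 K)⁰ K} {𝔮 : Ideal (𝓞 K)} {A : K}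
      (_ : Admissible J 𝔮 A) (n m : ℕ) {𝔟 : Ideal (𝓞 K)} (_ : 𝔟 ≠ ⊥) (_ : 𝔟 ⊔ 𝔮 = ⊤)
      {r : 𝓞 K ⧸ 𝔮} (_ : IsUnit r) (Z : Finset K)
      (_ : ∀ z, z ∈ Z ↔ z ∈ elementsWithNorm J (Set.Iic (m : ℝ))),
      |((Z.filter fun z => 𝔟 ∣ idealOf J z ∧ r ∈ rootClasses 𝔮 n (A * z)).card : ℝ) -
        2 * Real.pi / √|(discr K : ℝ)| *
          (m / ((Ideal.absNorm 𝔮 : ℝ) * (Ideal.absNorm 𝔟 : ℝ)))| ≤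
        M * (√(m / ((Ideal.absNorm 𝔮 : ℝ) * (Ideal.absNorm 𝔟 : ℝ))) + 1) := by
  obtain ⟨M, hM, h⟩ := exists_forall_card_coset_sub_le hdeg him
  -- The point `z = 0` is excluded, which changes the count by at most `1`.
  refine ⟨M + 1, by positivity, fun {J 𝔮 A} hadm n m {𝔟} h𝔟 hcop {r} hr Z hZ => ?_⟩
  have hJ := hadm.ideal_ne_zero
  have h𝔮 := hadm.modulus_ne_bot
  have hN := absNorm_fractionalIdeal_pos hJ
  obtain ⟨ρ, rfl⟩ := Ideal.Quotient.mk_surjective r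
  obtain ⟨z₀, hz₀⟩ := exists_coset_eq hJ h𝔮 h𝔟 hcop hadm.count_eq_zero (ρ ^ n)
  have h𝔮c : (𝔮 : FractionalIdeal (𝓞 K)⁰ K) ≠ 0 := coeIdeal_ne_zero.2 h𝔮
  have h𝔟c : (𝔟 : FractionalIdeal (𝓞 K)⁰ K) ≠ 0 := coeIdeal_ne_zero.2 h𝔟
  have hI0 : (𝔮 : FractionalIdeal (𝓞 K)⁰ K) * (𝔟 * J) ≠ 0 :=
    mul_ne_zero h𝔮c (mul_ne_zero h𝔟c hJ)
  set NJ : ℝ := ((FractionalIdeal.absNorm J : ℚ) : ℝ) with hNJ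
  obtain ⟨hfin, hcard⟩ := h (Units.mk0 _ hI0) z₀ (m * NJ) (by positivity)
  have hNI : (((FractionalIdeal.absNorm (Units.mk0 _ hI0).1 : ℚ)) : ℝ) =
      (Ideal.absNorm 𝔮 : ℝ) * (Ideal.absNorm 𝔟 : ℝ) * NJ := by
    rw [Units.val_mk0, map_mul, map_mul, coeIdeal_absNorm, coeIdeal_absNorm]
    push_cast
    ring
  rw [hNI, mul_div_mul_right _ _ hN.ne'] at hcard
  set S := {z : K | z - z₀ ∈ (Units.mk0 _ hI0).1 ∧ |((Algebra.norm ℚ z : ℚ) : ℝ)| ≤ m * NJ}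
    with hS
  have hbJ : (𝔟 : FractionalIdeal (𝓞 K)⁰ K) * J ≤ J := by
    calc (𝔟 : FractionalIdeal (𝓞 K)⁰ K) * J ≤ 1 * J := by gcongr; exact coeIdeal_le_one
      _ = J := one_mul J
  have hset : ((Z.filter fun z => 𝔟 ∣ idealOf J z ∧
      Ideal.Quotient.mk 𝔮 ρ ∈ rootClasses 𝔮 n (A * z) : Finset K) : Set K) = S \ {0} := by
    ext z
    rw [Finset.mem_coe, Finset.mem_filter, hZ, mem_rootClasses_iff hr, Set.mem_sdiff,
      Set.mem_singleton_iff, hS, Set.mem_ofPred_eq, Units.val_mk0, ← hz₀ z]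
    constructor
    · rintro ⟨⟨hzJ, hz0, hzm⟩, hd, hc⟩
      rw [Set.mem_Iic, absNorm_idealOf hJ hzJ, div_le_iff₀ hN] at hzm
      exact ⟨⟨⟨(dvd_idealOf_iff hJ hzJ).1 hd, hc⟩, hzm⟩, hz0⟩
    · rintro ⟨⟨⟨hzb, hc⟩, hzm⟩, hz0⟩
      have hzJ := hbJ hzb
      refine ⟨⟨hzJ, hz0, ?_⟩, (dvd_idealOf_iff hJ hzJ).2 hzb, hc⟩
      rw [Set.mem_Iic, absNorm_idealOf hJ hzJ, div_le_iff₀ hN]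
      exact hzm
  rw [← Set.ncard_coe_finset, hset]
  have h1 : (S \ {0}).ncard ≤ S.ncard := Set.ncard_le_ncard Set.sdiff_subset hfin
  have h2 : S.ncard ≤ (S \ {0}).ncard + 1 := by
    have := Set.ncard_le_ncard_sdiff_add_ncard S {0} (Set.finite_singleton 0)
    rwa [Set.ncard_singleton] at this
  have h1' : ((S \ {0}).ncard : ℝ) ≤ S.ncard := by exact_mod_cast h1
  have h2' : (S.ncard : ℝ) ≤ (S \ {0}).ncard + 1 := by exact_mod_cast h2
  have h3 := abs_le.1 hcard
  have h4 := Real.sqrt_nonneg ((m : ℝ) / ((Ideal.absNorm 𝔮 : ℝ) * (Ideal.absNorm 𝔟 : ℝ)))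
  rw [abs_le]
  constructor <;> nlinarith

open scoped Classical in
/-- Opening `ϑ` by Möbius inversion and sorting by the divisor `𝔟` and the residue class `r`. -/
theorem sum_normCoeff_eq (hdeg : Module.finrank ℚ K = 2) (him : IsTotallyComplex K)
    {J : FractionalIdeal (𝓞 K)⁰ K} {𝔮 : Ideal (𝓞 K)} {A : K} (hadm : Admissible J 𝔮 A)
    (n : ℕ) (ϑ : Ideal (𝓞 K) → ℝ) (m : ℕ) [Fintype (𝓞 K ⧸ 𝔮)] (Z : Finset K)
    (hZ : ∀ z, z ∈ Z ↔ z ∈ elementsWithNorm J (Set.Iic (m : ℝ))) :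
    ∑ j ∈ Finset.range (m + 1), normCoeff J 𝔮 n A ϑ j =
      ∑ 𝔟 ∈ (normBall K m).filter (fun 𝔟 => 𝔟 ⊔ 𝔮 = ⊤), convMoebius ϑ 𝔟 *
        ∑ r : 𝓞 K ⧸ 𝔮 with IsUnit r,
          ((Z.filter fun z => 𝔟 ∣ idealOf J z ∧ r ∈ rootClasses 𝔮 n (A * z)).card : ℝ) := by
  have hJ := hadm.ideal_ne_zero
  have h𝔮 := hadm.modulus_ne_bot
  have hfin := finite_elementsWithNorm_Iic hdeg him hJ (Nat.cast_nonneg m)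
  have hcoe : elementsWithNorm J (Set.Iic (m : ℝ)) = (Z : Set K) := by
    ext z; rw [Finset.mem_coe, hZ]
  simp only [normCoeff]
  rw [← finsum_elementsWithNorm_eq hfin (Finset.range (m + 1)) (fun j => by
    rw [Finset.mem_range, Set.mem_Iic, Nat.cast_le, Nat.lt_succ_iff]), hcoe, finsum_mem_coe_finset]
  have hz : ∀ z ∈ Z, ϑ (idealOf J z) * ((rootClasses 𝔮 n (A * z)).ncard : ℝ) =
      ∑ 𝔟 ∈ (normBall K m).filter (fun 𝔟 => 𝔟 ⊔ 𝔮 = ⊤), ∑ r : 𝓞 K ⧸ 𝔮 with IsUnit r,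
        convMoebius ϑ 𝔟 *
          if 𝔟 ∣ idealOf J z ∧ r ∈ rootClasses 𝔮 n (A * z) then (1 : ℝ) else 0 := by
    intro z hzZ
    obtain ⟨hzJ, hz0, hzm⟩ := (hZ z).1 hzZ
    have hid := idealOf_ne_bot hJ hzJ hz0
    have hzm' : Ideal.absNorm (idealOf J z) ≤ m := Nat.cast_le.1 (Set.mem_Iic.1 hzm)
    have hroots : ((rootClasses 𝔮 n (A * z)).ncard : ℝ) =
        ∑ r : 𝓞 K ⧸ 𝔮 with IsUnit r, if r ∈ rootClasses 𝔮 n (A * z) then (1 : ℝ) else 0 := by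
      rw [← Finset.sum_filter, Finset.sum_const, nsmul_eq_mul, mul_one, Finset.filter_filter,
        ← Set.ncard_coe_finset]
      congr 2
      ext r
      simp only [Finset.coe_filter, Finset.mem_univ, true_and, Set.mem_ofPred_eq]
      exact ⟨fun h => ⟨isUnit_of_mem_rootClasses h, h⟩, fun h => h.2⟩
    rw [← sum_convMoebius_idealDivisors ϑ hid, hroots, Finset.sum_mul_sum]
    have hdiv : idealDivisors (idealOf J z) =
        (normBall K m).filter (fun 𝔟 => 𝔟 ∣ idealOf J z) := by
      ext 𝔟
      rw [mem_idealDivisors hid, Finset.mem_filter, mem_normBall]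
      refine ⟨fun h => ⟨⟨?_, (absNorm_le_of_dvd hid h).trans hzm'⟩, h⟩, fun h => h.2⟩
      rintro rfl
      exact hid (zero_dvd_iff.1 h)
    rw [hdiv, Finset.sum_filter, Finset.sum_filter]
    refine Finset.sum_congr rfl fun 𝔟 _ => ?_
    by_cases hd : 𝔟 ∣ idealOf J z
    · rw [if_pos hd]
      by_cases hcop : 𝔟 ⊔ 𝔮 = ⊤
      · rw [if_pos hcop]; simp only [hd, true_and]
      · rw [if_neg hcop]
        refine Finset.sum_eq_zero fun r _ => ?_
        rw [if_neg, mul_zero]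
        exact fun hr => hcop
          (sup_eq_top_of_mem_rootClasses hJ h𝔮 hadm.count_eq_zero hzJ hz0 hd hr)
    · rw [if_neg hd]
      simp [hd]
  rw [Finset.sum_congr rfl hz, Finset.sum_comm]
  refine Finset.sum_congr rfl fun 𝔟 _ => ?_
  rw [Finset.sum_comm, Finset.mul_sum]
  refine Finset.sum_congr rfl fun r _ => ?_
  rw [← Finset.mul_sum, Finset.sum_boole]

theorem card_filter_isUnit {R : Type*} [CommRing R] [Fintype R] [DecidablePred (IsUnit (M := R))] :
    (Finset.univ.filter fun r : R => IsUnit r).card = Nat.card Rˣ := by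
  classical
  rw [Nat.card_eq_fintype_card, ← Finset.card_univ,
    ← Finset.card_image_of_injective _ (Units.val_injective (α := R))]
  congr 1
  ext r
  simp only [Finset.mem_filter, Finset.mem_univ, true_and, Finset.mem_image]
  rfl

/-- The asymptotic formula for the sum without weight `g`. The bound for the coefficient of the main
term is needed because partial summation compares `∑ g(m)` with `∫ g`. -/
theorem exists_sum_normCoeff_sub_le (hdeg : Module.finrank ℚ K = 2) (him : IsTotallyComplex K)
    {C : ℝ} (hC : 0 ≤ C) :
    ∃ M : ℝ, 0 < M ∧ ∀ {J : FractionalIdeal (𝓞 K)⁰ K} {𝔮 : Ideal (𝓞 K)} {A : K}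
      (_ : Admissible J 𝔮 A) (n : ℕ) (ϑ : Ideal (𝓞 K) → ℝ) (c : ℝ) (_ : 0 < c)
      (_ : GrowthCondition ϑ c C),
      |2 * Real.pi / √|(discr K : ℝ)| * eulerPhiStar 𝔮 * average ϑ 𝔮| ≤ M * c ∧
      ∀ m : ℕ, |∑ j ∈ Finset.range (m + 1), normCoeff J 𝔮 n A ϑ j -
        2 * Real.pi / √|(discr K : ℝ)| * eulerPhiStar 𝔮 * average ϑ 𝔮 * m| ≤
        M * c * (√(Ideal.absNorm 𝔮 : ℝ) * √(m : ℝ) +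
          (Ideal.absNorm 𝔮 : ℝ) * Real.log (m + 2) ^ (C + 1)) := by
  classical
  obtain ⟨M₀, hM₀, h₀⟩ := exists_card_elements_sub_le hdeg him
  obtain ⟨M₁, hM₁, h₁⟩ := exists_sum_normBall_le (K := K) hC
  obtain ⟨M₂, hM₂, h₂⟩ := exists_sum_normBall_div_sqrt_le (K := K) hC
  obtain ⟨M₃, hM₃, h₃⟩ := exists_average_bounds (K := K) hC
  set κ₀ : ℝ := 2 * Real.pi / √|(discr K : ℝ)| with hκ₀
  have hκ₀pos : 0 < κ₀ := by
    have := sqrt_abs_discr_pos (K := K)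
    have := Real.pi_pos
    positivity
  refine ⟨M₀ * M₂ + M₀ * M₁ + κ₀ * M₃, by positivity, fun {J 𝔮 A} hadm n ϑ c hc hϑ => ?_⟩
  have hJ := hadm.ideal_ne_zero
  have h𝔮 := hadm.modulus_ne_bot
  obtain ⟨-, havg, htail⟩ := h₃ ϑ c hc hϑ 𝔮
  set Nq : ℝ := (Ideal.absNorm 𝔮 : ℝ) with hNq
  have hNq1 : 1 ≤ Nq := by rw [hNq]; exact_mod_cast absNorm_pos_of_ne_bot h𝔮
  have hφ : (eulerPhi 𝔮 : ℝ) ≤ Nq := by rw [hNq]; exact_mod_cast eulerPhi_le_absNorm h𝔮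
  have hφs0 : 0 ≤ eulerPhiStar 𝔮 := by unfold eulerPhiStar; positivity
  have hφs1 : eulerPhiStar 𝔮 ≤ 1 := by
    rw [eulerPhiStar, div_le_one (by linarith)]; exact hφ
  have hκφ : κ₀ * eulerPhiStar 𝔮 ≤ κ₀ := mul_le_of_le_one_right hκ₀pos.le hφs1
  have hκφ0 : 0 ≤ κ₀ * eulerPhiStar 𝔮 := by positivity
  have hMc : 0 ≤ M₀ * M₂ * c + M₀ * M₁ * c := by positivity
  refine ⟨?_, fun m => ?_⟩
  · rw [abs_mul, abs_of_nonneg hκφ0]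
    calc κ₀ * eulerPhiStar 𝔮 * |average ϑ 𝔮| ≤ κ₀ * (M₃ * c) := by gcongr
      _ ≤ _ := by linarith
  rcases Nat.eq_zero_or_pos m with rfl | hm
  · have h0 : normCoeff J 𝔮 n A ϑ 0 = 0 := by
      rw [normCoeff, finsum_mem_eq_zero_of_forall_eq_zero]
      rintro z ⟨hz, hz0, hN⟩
      have := absNorm_pos_of_ne_bot (idealOf_ne_bot hJ hz hz0)
      rw [Set.mem_singleton_iff, Nat.cast_inj] at hN
      omega
    rw [zero_add, Finset.sum_range_one, h0, Nat.cast_zero, mul_zero, sub_zero, abs_zero]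
    have := log_add_two_rpow_nonneg (le_refl (0 : ℝ)) (C + 1)
    positivity
  have hm1 : (1 : ℝ) ≤ m := by exact_mod_cast hm
  have hm0 : (0 : ℝ) < m := by linarith
  have := finite_quotient h𝔮
  have : Fintype (𝓞 K ⧸ 𝔮) := Fintype.ofFinite _
  have hfin := finite_elementsWithNorm_Iic hdeg him hJ (Nat.cast_nonneg m)
  have hZ : ∀ z, z ∈ hfin.toFinset ↔ z ∈ elementsWithNorm J (Set.Iic (m : ℝ)) := fun z =>
    Set.Finite.mem_toFinset _
  rw [sum_normCoeff_eq hdeg him hadm n ϑ m _ hZ]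
  set cnt : Ideal (𝓞 K) → (𝓞 K ⧸ 𝔮) → ℝ := fun 𝔟 r =>
    ((hfin.toFinset.filter fun z => 𝔟 ∣ idealOf J z ∧ r ∈ rootClasses 𝔮 n (A * z)).card : ℝ)
    with hcnt
  set B := (normBall K m).filter (fun 𝔟 => 𝔟 ⊔ 𝔮 = ⊤) with hB
  have hcard : ((Finset.univ.filter fun r : 𝓞 K ⧸ 𝔮 => IsUnit r).card : ℝ) = eulerPhi 𝔮 := by
    rw [card_filter_isUnit]; rfl
  -- Each of the `φ(𝔮)` invertible classes contributes the same main term, and `φ(𝔮) ≤ N𝔮`.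
  have hinner : ∀ 𝔟 ∈ B, |∑ r : 𝓞 K ⧸ 𝔮 with IsUnit r, cnt 𝔟 r -
      eulerPhi 𝔮 * (κ₀ * (m / (Nq * (Ideal.absNorm 𝔟 : ℝ))))| ≤
      Nq * (M₀ * (√(m / (Nq * (Ideal.absNorm 𝔟 : ℝ))) + 1)) := by
    intro 𝔟 h𝔟
    obtain ⟨h𝔟1, h𝔟2⟩ := Finset.mem_filter.1 h𝔟
    rw [← hcard, ← nsmul_eq_mul, ← Finset.sum_const, ← Finset.sum_sub_distrib]
    refine (Finset.abs_sum_le_sum_abs _ _).trans ?_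
    refine (Finset.sum_le_card_nsmul _ _ _ fun r hr =>
      h₀ hadm n m (mem_normBall.1 h𝔟1).1 h𝔟2 (Finset.mem_filter.1 hr).2 _ hZ).trans ?_
    rw [nsmul_eq_mul, hcard]
    gcongr
  have hmainsum : κ₀ * eulerPhiStar 𝔮 * m * ∑ 𝔟 ∈ normBall K m, averageCoeff ϑ 𝔮 𝔟 =
      ∑ 𝔟 ∈ B, convMoebius ϑ 𝔟 *
        (eulerPhi 𝔮 * (κ₀ * (m / (Nq * (Ideal.absNorm 𝔟 : ℝ))))) := by
    rw [hB, Finset.sum_filter, Finset.mul_sum]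
    refine Finset.sum_congr rfl fun 𝔟 h𝔟 => ?_
    have hb0 := (mem_normBall.1 h𝔟).1
    by_cases hcop : 𝔟 ⊔ 𝔮 = ⊤
    · rw [if_pos hcop, averageCoeff, if_pos ⟨hb0, hcop⟩, eulerPhiStar, ← hNq]
      have : (Ideal.absNorm 𝔟 : ℝ) ≠ 0 := by exact_mod_cast (absNorm_pos_of_ne_bot hb0).ne'
      field_simp
    · rw [if_neg hcop, averageCoeff, if_neg (fun h => hcop h.2), mul_zero]
  have herr1 : |∑ 𝔟 ∈ B, convMoebius ϑ 𝔟 * ∑ r : 𝓞 K ⧸ 𝔮 with IsUnit r, cnt 𝔟 r -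
      κ₀ * eulerPhiStar 𝔮 * m * ∑ 𝔟 ∈ normBall K m, averageCoeff ϑ 𝔮 𝔟| ≤
      M₀ * M₂ * c * (√Nq * √m) + M₀ * M₁ * c * (Nq * Real.log (m + 2) ^ (C + 1)) := by
    rw [hmainsum, ← Finset.sum_sub_distrib]
    refine (Finset.abs_sum_le_sum_abs _ _).trans ?_
    have hsN : Nq = √Nq * √Nq := (Real.mul_self_sqrt (by linarith)).symm
    have hsN0 : 0 < √Nq := Real.sqrt_pos.2 (by linarith)
    calc _ ≤ ∑ 𝔟 ∈ B, |convMoebius ϑ 𝔟| *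
          (Nq * (M₀ * (√(m / (Nq * (Ideal.absNorm 𝔟 : ℝ))) + 1))) := by
          refine Finset.sum_le_sum fun 𝔟 h𝔟 => ?_
          rw [← mul_sub, abs_mul]
          exact mul_le_mul_of_nonneg_left (hinner 𝔟 h𝔟) (abs_nonneg _)
      _ ≤ ∑ 𝔟 ∈ normBall K m, |convMoebius ϑ 𝔟| *
          (Nq * (M₀ * (√(m / (Nq * (Ideal.absNorm 𝔟 : ℝ))) + 1))) :=
          Finset.sum_le_sum_of_subset_of_nonneg (Finset.filter_subset _ _)
            fun _ _ _ => by positivity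
      _ = M₀ * (√Nq * √m) * ∑ 𝔟 ∈ normBall K m,
            |convMoebius ϑ 𝔟| * (1 / √(Ideal.absNorm 𝔟 : ℝ)) +
          M₀ * Nq * ∑ 𝔟 ∈ normBall K m, |convMoebius ϑ 𝔟| := by
          rw [Finset.mul_sum, Finset.mul_sum, ← Finset.sum_add_distrib]
          refine Finset.sum_congr rfl fun 𝔟 _ => ?_
          rw [Real.sqrt_div hm0.le, Real.sqrt_mul (by linarith)]
          have e : Nq * (√(m : ℝ) / (√Nq * √(Ideal.absNorm 𝔟 : ℝ))) =
              √Nq * √m * (1 / √(Ideal.absNorm 𝔟 : ℝ)) := by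
            rw [mul_div_assoc', mul_one_div]
            nth_rewrite 1 [hsN]
            rw [mul_assoc, mul_div_mul_left _ _ hsN0.ne']
          linear_combination |convMoebius ϑ 𝔟| * M₀ * e
      _ ≤ M₀ * (√Nq * √m) * (M₂ * c) +
          M₀ * Nq * (M₁ * c * Real.log (m + 2) ^ (C + 1)) := by
          gcongr
          · exact h₂ ϑ c hc hϑ m
          · exact h₁ ϑ c hc hϑ m hm
      _ = _ := by ring
  -- Completing the truncated series for `𝒜(ϑ, 𝔮)`.
  have herr2 : |κ₀ * eulerPhiStar 𝔮 * m * ∑ 𝔟 ∈ normBall K m, averageCoeff ϑ 𝔮 𝔟 -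
      κ₀ * eulerPhiStar 𝔮 * average ϑ 𝔮 * m| ≤
      κ₀ * M₃ * c * (Nq * Real.log (m + 2) ^ (C + 1)) := by
    have e : κ₀ * eulerPhiStar 𝔮 * m * ∑ 𝔟 ∈ normBall K m, averageCoeff ϑ 𝔮 𝔟 -
        κ₀ * eulerPhiStar 𝔮 * average ϑ 𝔮 * m =
        -(κ₀ * eulerPhiStar 𝔮 * m) *
          (average ϑ 𝔮 - ∑ 𝔟 ∈ normBall K m, averageCoeff ϑ 𝔮 𝔟) := by ring
    have hlog := one_le_log_add_two hm1
    have hLC := log_add_two_rpow_nonneg hm0.le C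
    rw [e, abs_mul, abs_neg, abs_of_nonneg (by positivity)]
    calc κ₀ * eulerPhiStar 𝔮 * m * |average ϑ 𝔮 - ∑ 𝔟 ∈ normBall K m, averageCoeff ϑ 𝔮 𝔟|
        ≤ κ₀ * m * (M₃ * c * (Real.log (m + 2) ^ C / m)) := by
          gcongr
          exact htail m hm
      _ = κ₀ * M₃ * c * (1 * (Real.log (m + 2) ^ C * 1)) := by field_simp
      _ ≤ κ₀ * M₃ * c * (Nq * (Real.log (m + 2) ^ C * Real.log (m + 2))) := by gcongr
      _ = _ := by rw [Real.rpow_add_one (by linarith)]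
  have hP : 0 ≤ √Nq * √(m : ℝ) := by positivity
  have hQ : 0 ≤ Nq * Real.log (m + 2) ^ (C + 1) :=
    mul_nonneg (by linarith) (log_add_two_rpow_nonneg hm0.le _)
  have hfinal := (abs_sub_le _ _ _).trans (add_le_add herr1 herr2)
  refine hfinal.trans ?_
  have k1 : 0 ≤ (M₀ * M₁ * c + κ₀ * M₃ * c) * (√Nq * √(m : ℝ)) := by positivity
  have k2 : 0 ≤ M₀ * M₂ * c * (Nq * Real.log (m + 2) ^ (C + 1)) := by positivity
  linarith

end SumsOverElements

end

/-! ### The weighted sum -/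

theorem errorOne_nonneg {a t₁ t₂ : ℝ} (h1 : 1 ≤ t₁) (h2 : t₁ ≤ t₂) : 0 ≤ errorOne a t₁ t₂ := by
  rw [errorOne]
  split_ifs
  · exact Real.log_nonneg (by linarith)
  · refine Real.sSup_nonneg ?_
    rintro _ ⟨t, ht, rfl⟩
    exact Real.rpow_nonneg (by linarith [ht.1]) _

theorem rpow_le_errorTwo {a C t₁ t₂ : ℝ} (hC : 0 ≤ C) (h1 : 1 ≤ t₁) (h2 : t₁ ≤ t₂) :
    t₁ ^ a ≤ errorTwo a C t₁ t₂ := by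
  rw [errorTwo]
  split_ifs with h
  · rw [h, Real.rpow_zero]
    exact one_le_log_add_two_rpow (h1.trans h2) (by linarith)
  · exact le_mul_of_one_le_right (Real.rpow_nonneg (by linarith) _)
      (one_le_log_add_two_rpow h1 (by linarith))

/-- The error term `x √m + y log(m + 2) ^ (C + 1)` satisfies the requirements of partial
summation. The hypothesis `|κ| ≤ y` serves the comparison of `∑ g(m)` with `∫ g`. -/
theorem exists_partialSummationData {a C : ℝ} (ha : a ≤ 0) (hC : 0 ≤ C) :
    ∃ M : ℝ, 0 < M ∧ ∀ (α : ℕ → ℝ) (κ x y : ℝ) (g : ℝ → ℝ) (t₁ t₂ cg : ℝ), 0 ≤ x → 0 ≤ y →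
      |κ| ≤ y → 1 ≤ t₁ → t₁ ≤ t₂ → 0 ≤ cg →
      (∀ m : ℕ, |∑ j ∈ Finset.range (m + 1), α j - κ * m| ≤
        x * √m + y * Real.log (m + 2) ^ (C + 1)) →
      (∀ t ∈ Set.Icc t₁ t₂, |g t| ≤ cg * t ^ a) →
      PartialSummationData α κ (fun m => x * √m + y * Real.log (m + 2) ^ (C + 1)) g a t₁ t₂ cg
        (M * (x * errorOne a t₁ t₂ + y * errorTwo a C t₁ t₂)) := by
  obtain ⟨M₁, hM₁, h₁⟩ := exists_rpow_mul_sqrt_sum_le ha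
  obtain ⟨M₂, hM₂, h₂⟩ := exists_rpow_mul_log_sum_le ha hC
  refine ⟨M₁ + M₂ + 1, by positivity,
    fun α κ x y g t₁ t₂ cg hx hy hκ ht₁ ht hcg hS hg => ?_⟩
  have hC1 : 0 ≤ C + 1 := by linarith
  have hE1 := errorOne_nonneg (a := a) ht₁ ht
  have ht1a : 0 ≤ t₁ ^ a := Real.rpow_nonneg (by linarith) _
  have hE2' := rpow_le_errorTwo (a := a) hC ht₁ ht
  have hE2 : 0 ≤ errorTwo a C t₁ t₂ := ht1a.trans hE2'
  have hxE : 0 ≤ x * errorOne a t₁ t₂ := by positivity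
  have hyE : 0 ≤ y * errorTwo a C t₁ t₂ := by positivity
  have hcomb : x * (M₁ * errorOne a t₁ t₂) + y * (M₂ * errorTwo a C t₁ t₂) ≤
      (M₁ + M₂ + 1) * (x * errorOne a t₁ t₂ + y * errorTwo a C t₁ t₂) := by nlinarith
  refine ⟨ha, ht₁, hS, ?_, hcg, hg, ?_, ?_, ?_⟩
  · intro m m' hmm
    have hmm' : (m : ℝ) ≤ m' := by exact_mod_cast hmm
    have := log_add_two_rpow_mono (Nat.cast_nonneg m) hmm' hC1
    dsimp only
    gcongr
  · intro m h1 h2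
    have b1 := (h₁ t₁ t₂ ht₁ m m h1 le_rfl h2).1
    have b2 := (h₂ t₁ t₂ ht₁ m m h1 le_rfl h2).1
    refine le_trans (le_of_eq ?_) ((add_le_add (mul_le_mul_of_nonneg_left b1 hx)
      (mul_le_mul_of_nonneg_left b2 hy)).trans hcomb)
    ring
  · intro k l h1 hkl h2
    have b1 := (h₁ t₁ t₂ ht₁ k l h1 hkl h2).2
    have b2 := (h₂ t₁ t₂ ht₁ k l h1 hkl h2).2
    refine le_trans (le_of_eq ?_) ((add_le_add (mul_le_mul_of_nonneg_left b1 hx)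
      (mul_le_mul_of_nonneg_left b2 hy)).trans hcomb)
    rw [Finset.mul_sum, Finset.mul_sum, ← Finset.sum_add_distrib]
    refine Finset.sum_congr rfl fun m _ => ?_
    push_cast
    ring
  · calc |κ| * t₁ ^ a ≤ y * errorTwo a C t₁ t₂ := by gcongr
      _ ≤ _ := by nlinarith

end SecondSummation

theorem mainTheorem4 (K : Type*) [Field K] [NumberField K]
    (hdeg : Module.finrank ℚ K = 2) (him : NumberField.IsTotallyComplex K)
    (a C : ℝ) (ha : a ≤ 0) (hC : 0 ≤ C) :
    ∃ M : ℝ, 0 < M ∧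
      ∀ (J : FractionalIdeal (𝓞 K)⁰ K) (𝔮 : Ideal (𝓞 K)) (n : ℕ) (A : K)
        (ϑ : Ideal (𝓞 K) → ℝ) (cϑ : ℝ) (t₁ t₂ : ℝ) (g : ℝ → ℝ) (cg : ℝ) (R : ℕ),
        J ≠ 0 → 𝔮 ≠ ⊥ → 0 < n →
        (∀ 𝔭 : IsDedekindDomain.HeightOneSpectrum (𝓞 K), 𝔭.asIdeal ∣ 𝔮 →
          A ≠ 0 ∧
            FractionalIdeal.count K 𝔭 (FractionalIdeal.spanSingleton (𝓞 K)⁰ A * J) = 0) →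
        0 < cϑ →
        (∀ t : ℝ, 0 < t →
          SecondSummation.convMoebiusSum ϑ t ≤ cϑ * t * Real.log (t + 2) ^ C) →
        1 ≤ t₁ → t₁ ≤ t₂ →
        SecondSummation.PiecewiseMonotone g t₁ t₂ R →
        0 < cg →
        (∀ t ∈ Set.Icc t₁ t₂, |g t| ≤ cg * t ^ a) →
        Summable (SecondSummation.averageTerm ϑ 𝔮) ∧
        IntervalIntegrable g MeasureTheory.volume t₁ t₂ ∧
        ∀ T : Set ℝ, T = Set.Ioc t₁ t₂ ∨ T = Set.Icc t₁ t₂ →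
          (SecondSummation.elementsWithNorm J T).Finite ∧
          |SecondSummation.secondSum J 𝔮 n A ϑ g T -
              2 * Real.pi / Real.sqrt |(NumberField.discr K : ℝ)| *
                SecondSummation.eulerPhiStar 𝔮 * SecondSummation.average ϑ 𝔮 *
                ∫ t in t₁..t₂, g t|
            ≤ M * cϑ * cg * R *
                (Real.sqrt (Ideal.absNorm 𝔮 : ℝ) * SecondSummation.errorOne a t₁ t₂ +
                  (Ideal.absNorm 𝔮 : ℝ) * SecondSummation.errorTwo a C t₁ t₂) := by
  classical
  obtain ⟨M₁, hM₁, h₁⟩ := SecondSummation.exists_sum_normCoeff_sub_le hdeg him hC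
  obtain ⟨M₂, hM₂, h₂⟩ := SecondSummation.exists_partialSummationData ha hC
  obtain ⟨M₃, -, h₃⟩ := SecondSummation.exists_average_bounds (K := K) hC
  refine ⟨21 * (M₁ * M₂), by positivity,
    fun J 𝔮 n A ϑ cϑ t₁ t₂ g cg R hJ h𝔮 hn hA hcϑ hϑ ht₁ ht hg hcg hgb => ?_⟩
  have hadm : SecondSummation.Admissible J 𝔮 A := ⟨hJ, h𝔮, hA⟩
  obtain ⟨hκ, hS⟩ := h₁ hadm n ϑ cϑ hcϑ hϑ
  have hN : (1 : ℝ) ≤ Ideal.absNorm 𝔮 := by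
    exact_mod_cast SecondSummation.absNorm_pos_of_ne_bot h𝔮
  have hdata := h₂ (SecondSummation.normCoeff J 𝔮 n A ϑ)
    (2 * Real.pi / √|(NumberField.discr K : ℝ)| * SecondSummation.eulerPhiStar 𝔮 *
      SecondSummation.average ϑ 𝔮)
    (M₁ * cϑ * √(Ideal.absNorm 𝔮 : ℝ)) (M₁ * cϑ * (Ideal.absNorm 𝔮 : ℝ)) g t₁ t₂ cg
    (by positivity) (by positivity)
    (hκ.trans (le_mul_of_one_le_right (by positivity) hN)) ht₁ ht hcg.le
    (fun m => (hS m).trans (le_of_eq (by ring))) hgb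
  refine ⟨(SecondSummation.summable_averageTerm_iff ϑ 𝔮).2 (h₃ ϑ cϑ hcϑ hϑ 𝔮).1, ?_,
    fun T hT => ?_⟩
  · rw [intervalIntegrable_iff_integrableOn_Icc_of_le ht]
    exact hg.integrableOn fun t htt => hdata.bound_const htt
  · have hTt : T ⊆ Set.Iic t₂ := by
      rcases hT with rfl | rfl
      · exact fun t h => h.2
      · exact fun t h => h.2
    have hfin : (SecondSummation.elementsWithNorm J T).Finite :=
      (SecondSummation.finite_elementsWithNorm_Iic hdeg him hJ (by linarith)).subset
        (SecondSummation.elementsWithNorm_mono J hTt)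
    have hs : ∀ m : ℕ, m ∈ (Finset.range (⌊t₂⌋₊ + 1)).filter (fun m : ℕ => (m : ℝ) ∈ T) ↔
        (m : ℝ) ∈ T := fun m => by
      rw [Finset.mem_filter, Finset.mem_range, Nat.lt_succ_iff]
      exact ⟨fun h => h.2, fun h => ⟨Nat.le_floor (hTt h), h⟩⟩
    refine ⟨hfin, ?_⟩
    rw [SecondSummation.secondSum_eq h𝔮 hfin _ hs]
    refine (hg.sum_sub_integral_le ht hdata hT _ hs).trans (le_of_eq ?_)
    ring
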